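/- **Notation.** For $\alpha\in\mathbf N^d$ let $h_\alpha(x)=\pi^{-d/4}(-1)^{|\alpha|}(2^{|\alpha|}\alpha!)^{-1/2}e^{|x|^2/2}\,\partial^\alpha e^{-|x|^2}$ be the Hermite functions on $\mathbf R^d$, and $c_h(f,\alpha)=(f,h_\alpha)_{L^2(\mathbf R^d)}$. For $r\in\mathbf R_+^d$ put $$\vartheta_{r,s}(\alpha)=e^{-\sum_j \alpha_j^{1/(2s)}/r_j}\ (s>0,\ s\ne\tfrac12),\qquad \vartheta_{r,\flat_\sigma}(\alpha)=r^\alpha\alpha!^{-1/(2\sigma)}\ (\sigma>0),\qquad \vartheta_{r,1/2}(\alpha)=r^\alpha,$$ $$\vartheta'_{r,\flat_\sigma}(\alpha)=r^\alpha\alpha!^{1/(2\sigma)},\qquad \vartheta'_{r,1/2}(\alpha)=r^\alpha .$$ The space $\mathcal H_s(\mathbf R^d)$ (resp. $\mathcal H_{0,s}(\mathbf R^d)$) consists of all $f\in L^2(\mathbf R^d)$ such that $|c_h(f,\alpha)|\lesssim\vartheta_{r,s}(\alpha)$ for some (resp. every) $r\in\mathbf R_+^d$, where $s>0$ or $s=\flat_\sigma$.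 Identify a power series $F_0(z)=\sum_\alpha c(\alpha)\,z^\alpha/\sqrt{\alpha!}$ on $\mathbf C^d$ with its coefficients $c$. Then $F_0\in\mathcal A_s$ (resp. $\mathcal A_{0,s}$) means $|c(\alpha)|\lesssim\vartheta_{r,s}(\alpha)$ for some (resp. every) $r\in\mathbf R^d_+$, and $F_0\in\mathcal A'_s$ (resp. $\mathcal A'_{0,s}$) means $|c(\alpha)|\lesssim\vartheta'_{r,s}(\alpha)$ for every (resp. some) $r\in\mathbf R^d_+$. In all cases below these series converge on $\mathbf C^d$, so that $F_0$ is an entire function. Let $\mathcal R^\infty(\mathbf C^d)$ be the set of all non-negative $\chi\in L^\infty(\mathbf C^d)$ of the form $\chi(z)=\chi_0(|z_1|,\dots,|z_d|)$ for which there are $t_1\le t_2$ in $\mathbf R_+^d$ and $c>0$ such that $\chi$ vanishes outside the closed polydisc with centre $0$ and radii $t_2$, and $\chi\ge c$ on the open polydisc with centre $0$ and radii $t_1$. We write $\chi(x,\xi)=\chi(x+i\xi)$. Let $\phi(x)=\pi^{-d/4}e^{-|x|^2/2}$ and $$V_\phi^*F(x)=\iint_{\mathbf R^{2d}}F(y,\eta)\,\phi(x-y)\,e^{i\langle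 x,\eta\rangle}\,dy\,d\eta ,$$ the adjoint of the short-time Fourier transform $V_\phi f(x,\xi)=\int f(t)\phi(t-x)e^{-i\langle t,\xi\rangle}dt$. For $\theta\in\mathbf R$, a class $\mathcal A$ of power series as above and $\chi\in\mathcal R^\infty(\mathbf C^d)$, say that $f$ is *$(\theta,\chi)$-represented by $\mathcal A$* if $f=V_\phi^*F$ for some essentially bounded and compactly supported $F$ on $\mathbf R^{2d}$ such that $$F(x,\xi)=F_0(x-i\xi)\,e^{-i\theta\langle x,\xi\rangle}\,\chi(x,\xi)\quad\text{for some }F_0\in\mathcal A .$$ Equalities between functions are understood almost everywhere. **Proposition.** Let $\chi\in\mathcal R^\infty(\mathbf C^d)$ and let $f$ be a function on $\mathbf R^d$. 1. Let $\sigma\in(\frac12,1)$, $\sigma_0=\frac{\sigma}{2\sigma-1}$ and $\theta\in\{1,\frac12\}$. Then $f\in\mathcal H_{\flat_\sigma}$ (resp. $f\in\mathcal H_{0,\flat_\sigma}$) if and only if $f$ is $(\theta,\chi)$-represented by $\mathcal A'_{0,\flat_{\sigma_0}}$ (resp. $\mathcal A'_{\flat_{\sigma_0}}$). 2. For $\theta\in\{1,\frac12\}$,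 $f\in\mathcal H_{\flat_{1/2}}$ if and only if $f$ is $(\theta,\chi)$-represented by $\mathcal A'_{0,1/2}$. Moreover, $f\in\mathcal H_{0,\flat_{1/2}}$ if and only if $f$ is $(\frac12,\chi)$-represented by $\mathcal A_{0,1/2}$. 3. Let $\sigma\in(0,\frac12)$ and $\sigma_0=\frac{\sigma}{1-2\sigma}$. Then $f\in\mathcal H_{\flat_\sigma}$ (resp. $f\in\mathcal H_{0,\flat_\sigma}$) if and only if $f$ is $(\frac12,\chi)$-represented by $\mathcal A_{\flat_{\sigma_0}}$ (resp. $\mathcal A_{0,\flat_{\sigma_0}}$). 4. Let $s\in(0,\frac12)$. Then $f\in\mathcal H_s$ (resp. $f\in\mathcal H_{0,s}$) if and only if $f$ is $(\frac12,\chi)$-represented by $\mathcal A_s$ (resp. $\mathcal A_{0,s}$). -/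

import Mathlib

open MeasureTheory
open scoped ENNReal

noncomputable section

namespace Pilipovic

/-! ### Orders and weights on multi-indices -/

/-- The extended set of orders: `real s` is the order `s ∈ ℝ₊`, and `flat σ` is the order `♭_σ`. -/
inductive Order : Type where
  | real (s : ℝ) : Order
  | flat (σ : ℝ) : Order

/-- `r ∈ ℝ₊ᵈ`. -/
def Pos {d : ℕ} (r : Fin d → ℝ) : Prop := ∀ j, 0 < r j

/-- `α! = α₁! ⋯ α_d!`. -/
def multiFactorial {d : ℕ} (α : Fin d → ℕ) : ℕ := ∏ j, (α j).factorial

/-- The weight `ϑ_{r,s}(α)`. -/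
def weight {d : ℕ} (r : Fin d → ℝ) : Order → (Fin d → ℕ) → ℝ
  | .real s, α =>
      if s = 1 / 2 then ∏ j, r j ^ α j
      else Real.exp (-∑ j, (1 / r j) * (α j : ℝ) ^ (1 / (2 * s)))
  | .flat σ, α => (∏ j, r j ^ α j) * (multiFactorial α : ℝ) ^ (-(1 / (2 * σ)))

/-- The weight `ϑ'_{r,s}(α)`. -/
def dualWeight {d : ℕ} (r : Fin d → ℝ) : Order → (Fin d → ℕ) → ℝ
  | .real s, α =>
      if s = 1 / 2 then ∏ j, r j ^ α j
      else Real.exp (∑ j, (1 / r j) * (α j : ℝ) ^ (1 / (2 * s)))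
  | .flat σ, α => (∏ j, r j ^ α j) * (multiFactorial α : ℝ) ^ (1 / (2 * σ))

/-- `|c(α)| ≲ ϑ(α)`: the estimate holds up to a multiplicative constant independent of `α`. -/
def DominatedBy {d : ℕ} (c : (Fin d → ℕ) → ℂ) (ϑ : (Fin d → ℕ) → ℝ) : Prop :=
  ∃ C : ℝ, ∀ α, ‖c α‖ ≤ C * ϑ α

/-! ### Hermite functions and Pilipović spaces -/

/-- The one-dimensional Hermite function
`h_n(t) = π^{-1/4} (-1)^n (2^n n!)^{-1/2} e^{t²/2} (d/dt)^n e^{-t²}`. -/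
def hermiteFun (n : ℕ) (t : ℝ) : ℝ :=
  Real.pi ^ (-(1 / 4) : ℝ) * (-1) ^ n * ((2 : ℝ) ^ n * (n.factorial : ℝ)) ^ (-(1 / 2) : ℝ)
    * Real.exp (t ^ 2 / 2) * iteratedDeriv n (fun u : ℝ => Real.exp (-u ^ 2)) t

/-- The Hermite function `h_α` on `ℝᵈ`. Since `e^{-|x|²}` is a product of functions of the
separate coordinates, `∂^α` factorizes and `h_α(x) = h_{α₁}(x₁) ⋯ h_{α_d}(x_d)`. -/
def hermite {d : ℕ} (α : Fin d → ℕ) (x : Fin d → ℝ) : ℝ := ∏ j, hermiteFun (α j) (x j)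

/-- The Hermite coefficient `c_h(f, α) = (f, h_α)_{L²(ℝᵈ)}`. -/
def hermiteCoeff {d : ℕ} (f : (Fin d → ℝ) → ℂ) (α : Fin d → ℕ) : ℂ :=
  ∫ x, f x * (hermite α x : ℂ)

/-- The Pilipović space `𝓗_s(ℝᵈ)` of Roumieu type. -/
def H (d : ℕ) (s : Order) : Set ((Fin d → ℝ) → ℂ) :=
  {f | MemLp f 2 volume ∧ ∃ r : Fin d → ℝ, Pos r ∧ DominatedBy (hermiteCoeff f) (weight r s)}

/-- The Pilipović space `𝓗_{0,s}(ℝᵈ)` of Beurling type. -/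
def H₀ (d : ℕ) (s : Order) : Set ((Fin d → ℝ) → ℂ) :=
  {f | MemLp f 2 volume ∧ ∀ r : Fin d → ℝ, Pos r → DominatedBy (hermiteCoeff f) (weight r s)}

/-! ### Spaces of power series expansions

A formal power series `∑ c(α) e_α`, `e_α(z) = z^α / √α!`, on `ℂᵈ` is identified with its family
of coefficients `c`. -/

/-- The normalized monomial `e_α(z) = z^α / √α!`. -/
def monomial {d : ℕ} (α : Fin d → ℕ) (z : Fin d → ℂ) : ℂ :=
  (∏ j, z j ^ α j) / (Real.sqrt (multiFactorial α) : ℂ)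

/-- The formal power series with coefficients `c` converges (unconditionally) on all of `ℂᵈ`,
and its sum is the function `F`. -/
def IsSum {d : ℕ} (c : (Fin d → ℕ) → ℂ) (F : (Fin d → ℂ) → ℂ) : Prop :=
  ∀ z, HasSum (fun α => c α * monomial α z) (F z)

/-- `𝓐_s(ℂᵈ)`. -/
def A (d : ℕ) (s : Order) : Set ((Fin d → ℕ) → ℂ) :=
  {c | ∃ r : Fin d → ℝ, Pos r ∧ DominatedBy c (weight r s)}

/-- `𝓐_{0,s}(ℂᵈ)`. -/
def A₀ (d : ℕ) (s : Order) : Set ((Fin d → ℕ) → ℂ) :=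
  {c | ∀ r : Fin d → ℝ, Pos r → DominatedBy c (weight r s)}

/-- `𝓐'_s(ℂᵈ)`. -/
def ADual (d : ℕ) (s : Order) : Set ((Fin d → ℕ) → ℂ) :=
  {c | ∀ r : Fin d → ℝ, Pos r → DominatedBy c (dualWeight r s)}

/-- `𝓐'_{0,s}(ℂᵈ)`. -/
def A₀Dual (d : ℕ) (s : Order) : Set ((Fin d → ℕ) → ℂ) :=
  {c | ∃ r : Fin d → ℝ, Pos r ∧ DominatedBy c (dualWeight r s)}

/-! ### The class `𝓡^∞` -/

/-- The class `𝓡^∞_{t₁,t₂}(ℂᵈ)`; elements of `L^∞` are represented by functions, so all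
conditions are imposed almost everywhere. -/
def RClassWith {d : ℕ} (t₁ t₂ : Fin d → ℝ) : Set ((Fin d → ℂ) → ℝ) :=
  {χ | MemLp χ ∞ volume ∧
    (∀ᵐ z, 0 ≤ χ z) ∧
    (∀ᵐ z : Fin d → ℂ, ¬ (∀ j, ‖z j‖ ≤ t₂ j) → χ z = 0) ∧
    (∃ χ₀ : (Fin d → ℝ) → ℝ, ∀ᵐ z, χ z = χ₀ (fun j => ‖z j‖)) ∧
    ∃ c : ℝ, 0 < c ∧ ∀ᵐ z : Fin d → ℂ, (∀ j, ‖z j‖ < t₁ j) → c ≤ χ z}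

/-- The class `𝓡^∞(ℂᵈ)`. -/
def RClass (d : ℕ) : Set ((Fin d → ℂ) → ℝ) :=
  {χ | ∃ t₁ t₂ : Fin d → ℝ, Pos t₁ ∧ Pos t₂ ∧ t₁ ≤ t₂ ∧ χ ∈ RClassWith t₁ t₂}

/-! ### The adjoint of the short-time Fourier transform -/

/-- `⟨x, ξ⟩` on `ℝᵈ`. -/
def dot {d : ℕ} (x ξ : Fin d → ℝ) : ℝ := ∑ j, x j * ξ j

/-- The Gaussian window `φ(x) = π^{-d/4} e^{-|x|²/2}`. -/
def gaussian {d : ℕ} (x : Fin d → ℝ) : ℝ :=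
  Real.pi ^ (-(d : ℝ) / 4) * Real.exp (-(dot x x) / 2)

/-- `V_φ f(x, ξ) = ∫ f(t) φ(t - x) e^{-i⟨t, ξ⟩} dt`. -/
def stft {d : ℕ} (f : (Fin d → ℝ) → ℂ) (p : (Fin d → ℝ) × (Fin d → ℝ)) : ℂ :=
  ∫ t, f t * (gaussian (t - p.1) : ℂ) * Complex.exp (-(Complex.I * (dot t p.2 : ℂ)))

/-- `V_φ^* F(x) = ∬ F(y, η) φ(x - y) e^{i⟨x, η⟩} dy dη`. -/
def stftAdjoint {d : ℕ} (F : (Fin d → ℝ) × (Fin d → ℝ) → ℂ) (x : Fin d → ℝ) : ℂ :=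
  ∫ p : (Fin d → ℝ) × (Fin d → ℝ),
    F p * (gaussian (x - p.1) : ℂ) * Complex.exp (Complex.I * (dot x p.2 : ℂ))

/-- `F ∈ L^∞(ℝ²ᵈ) ∩ 𝓔'(ℝ²ᵈ)`: essentially bounded, and zero almost everywhere outside some
compact set. -/
def IsBoundedCompact {d : ℕ} (F : (Fin d → ℝ) × (Fin d → ℝ) → ℂ) : Prop :=
  MemLp F ∞ volume ∧
    ∃ K : Set ((Fin d → ℝ) × (Fin d → ℝ)), IsCompact K ∧ ∀ᵐ p, p ∉ K → F p = 0

/-- The function `(x, ξ) ↦ F₀(x - iξ) e^{-iθ⟨x, ξ⟩} χ(x, ξ)` on `ℝ²ᵈ ≃ ℂᵈ`. -/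
def cutoff {d : ℕ} (θ : ℝ) (χ : (Fin d → ℂ) → ℝ) (F₀ : (Fin d → ℂ) → ℂ)
    (p : (Fin d → ℝ) × (Fin d → ℝ)) : ℂ :=
  F₀ (fun j => (p.1 j : ℂ) - Complex.I * (p.2 j : ℂ))
    * Complex.exp (-(Complex.I * (θ : ℂ) * (dot p.1 p.2 : ℂ)))
    * (χ (fun j => (p.1 j : ℂ) + Complex.I * (p.2 j : ℂ)) : ℂ)

/-- `f = V_φ^* F` for some `F ∈ L^∞(ℝ²ᵈ) ∩ 𝓔'(ℝ²ᵈ)` of the form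
`F(x, ξ) = F₀(x - iξ) e^{-iθ⟨x, ξ⟩} χ(x, ξ)`, with `F₀` in the space `S` of power series. -/
def HasRepresentation {d : ℕ} (θ : ℝ) (χ : (Fin d → ℂ) → ℝ) (S : Set ((Fin d → ℕ) → ℂ))
    (f : (Fin d → ℝ) → ℂ) : Prop :=
  ∃ F : (Fin d → ℝ) × (Fin d → ℝ) → ℂ, IsBoundedCompact F ∧
    (∃ c ∈ S, ∃ F₀ : (Fin d → ℂ) → ℂ, IsSum c F₀ ∧ F =ᵐ[volume] cutoff θ χ F₀) ∧
    f =ᵐ[volume] stftAdjoint F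

/-- `stftAdjoint` is the `L²`-adjoint of `stft`: `(V_φ h, F) = (h, V_φ^* F)`. -/
theorem stft_adjoint {d : ℕ} (h : (Fin d → ℝ) → ℂ) (F : (Fin d → ℝ) × (Fin d → ℝ) → ℂ)
    (hh : Integrable h) (hF : Integrable F) :
    ∫ p, stft h p * star (F p) = ∫ x, h x * star (stftAdjoint F x) := by
  have hg : ∀ x : Fin d → ℝ, ‖(gaussian x : ℂ)‖ ≤ Real.pi ^ (-(d : ℝ) / 4) := by
    intro x
    have h0 : 0 ≤ dot x x := Finset.sum_nonneg fun j _ => mul_self_nonneg _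
    have hp : (0 : ℝ) ≤ Real.pi ^ (-(d : ℝ) / 4) := Real.rpow_nonneg Real.pi_pos.le _
    rw [Complex.norm_real, Real.norm_eq_abs, gaussian, abs_of_nonneg (by positivity)]
    exact mul_le_of_le_one_right hp (Real.exp_le_one_iff.2 (by linarith))
  set k : (Fin d → ℝ) → (Fin d → ℝ) × (Fin d → ℝ) → ℂ := fun t p =>
    (gaussian (t - p.1) : ℂ) * Complex.exp (-(Complex.I * (dot t p.2 : ℂ))) with hk
  have hkn : ∀ t p, ‖k t p‖ ≤ Real.pi ^ (-(d : ℝ) / 4) := by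
    intro t p
    have : ‖Complex.exp (-(Complex.I * (dot t p.2 : ℂ)))‖ = 1 := by
      rw [Complex.norm_exp]; simp
    simp only [hk, norm_mul, this, mul_one]
    exact hg _
  have hkc : Continuous fun q : ((Fin d → ℝ) × (Fin d → ℝ)) × (Fin d → ℝ) => k q.2 q.1 := by
    simp only [hk, gaussian, dot]
    fun_prop
  have hint : Integrable (fun q : ((Fin d → ℝ) × (Fin d → ℝ)) × (Fin d → ℝ) =>
      (star (F q.1) * h q.2) * k q.2 q.1) (volume.prod volume) := by
    refine Integrable.mul_bdd (c := Real.pi ^ (-(d : ℝ) / 4)) ?_ hkc.aestronglyMeasurable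
      (Filter.Eventually.of_forall fun q => hkn _ _)
    have hF' : Integrable (fun p => star (F p)) := by
      simpa using (Complex.conjCLE.toContinuousLinearMap.integrable_comp hF)
    exact hF'.mul_prod hh
  calc ∫ p, stft h p * star (F p)
      = ∫ p, ∫ t, (star (F p) * h t) * k t p := by
        congr 1; ext p
        rw [stft, ← integral_mul_const]
        congr 1; ext t; simp only [hk]; ring
    _ = ∫ t, ∫ p, (star (F p) * h t) * k t p := integral_integral_swap hint
    _ = ∫ x, h x * star (stftAdjoint F x) := by
        congr 1; ext t
        simp only [stftAdjoint, Complex.star_def]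
        rw [← integral_conj, ← integral_const_mul]
        congr 1; ext p
        simp only [hk, map_mul, Complex.conj_ofReal, ← Complex.exp_conj, Complex.conj_I]
        ring_nf

end Pilipovic

end

/-! Write `z = y + iη`. Up to the factor `e^{i⟨y,η⟩/2 - |z|²/4}`, the kernel `φ(x-y) e^{i⟨x,η⟩}` of
`V_φ^*` is the generating function `∑ h_α(x) w^α/√α!` at `w = z/√2` (`gaussian_mul_character`).
Pairing it with `h_α` produces a monomial, so `√(2^{|α|} α!) c_h(V_φ^*F, α)` is the integral of
`F(z) e^{i⟨y,η⟩/2 - |z|²/4} z^α` (`hermiteCoeff_stftAdjoint`).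

Insert `F = F₀(z̄) e^{-iθ⟨y,η⟩} χ`, where `F₀ = ∑ a(α) z^α`. For `θ = 1/2` the phases cancel and the
weight `χ e^{-|z|²/4}` is polyradial. Monomials are orthogonal for such a weight, so the scaled
Hermite coefficients are `a(α) m(α)`, with `m(α)` the moment of `|z^α|²`
(`hermiteCoeff_cutoff_half`). The moments lie between two geometric sequences, by the support of `χ`
and its lower bound near `0`. Multiplication by `m` is therefore a bijection of every class of
sequences that is stable under geometric factors.

For `θ = 1` the remaining phase is `e^{-i⟨y,η⟩/2} = e^{⟨z̄,z̄⟩/8} e^{-⟨z,z⟩/8}`. The first factor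
multiplies `F₀` before the moments are taken; the second acts afterwards by the transpose `coshift`
of multiplication by a Gaussian (`hermiteCoeff_cutoff_one`). Both operations are invertible on
classes that contain the Gaussian coefficients, which have size `α!^{-1/2}`.

It remains to compare weights. With `κ = 1/(2σ) - 1/2`, the order `♭_σ` for Hermite coefficients and
the stated order for power series both become domination by `r^α α!^{-κ}`, once `√(2^{|α|} α!)` and
`1/√α!` are absorbed. For real `s < 1/2` the weights decay faster than any inverse power of `R^α
α!`, so these normalizations do not change the class. Completeness of the Hermite functions finally
recovers `f` from its coefficients (`hasRepresentation_iff`). -/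

noncomputable section

namespace Pilipovic

/-! ### Multi-index powers and sums of products -/

/-- The multi-index power `x^α = ∏ x_j^{α_j}`. -/
def mpow {d : ℕ} {R : Type*} [CommMonoid R] (x : Fin d → R) (α : Fin d → ℕ) : R :=
  ∏ j, x j ^ α j

section mpow

variable {d : ℕ}

theorem mpow_add {R : Type*} [CommMonoid R] (x : Fin d → R) (α β : Fin d → ℕ) :
    mpow x (α + β) = mpow x α * mpow x β := by
  simp [mpow, pow_add, Finset.prod_mul_distrib]

theorem mul_mpow {R : Type*} [CommMonoid R] (x y : Fin d → R) (α : Fin d → ℕ) :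
    mpow (x * y) α = mpow x α * mpow y α := by
  simp [mpow, mul_pow, Finset.prod_mul_distrib]

theorem norm_mpow (x : Fin d → ℂ) (α : Fin d → ℕ) : ‖mpow x α‖ = mpow (fun j => ‖x j‖) α := by
  simp [mpow, norm_prod, norm_pow]

theorem mpow_ofReal (x : Fin d → ℝ) (α : Fin d → ℕ) :
    mpow (fun j => (x j : ℂ)) α = ((mpow x α : ℝ) : ℂ) := by
  simp [mpow]

theorem mpow_pos {x : Fin d → ℝ} (hx : Pos x) (α : Fin d → ℕ) : 0 < mpow x α :=
  Finset.prod_pos fun j _ => pow_pos (hx j) _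

theorem mpow_le_mpow {x y : Fin d → ℝ} (hx : ∀ j, 0 ≤ x j) (h : ∀ j, x j ≤ y j)
    (α : Fin d → ℕ) : mpow x α ≤ mpow y α :=
  Finset.prod_le_prod (fun j _ => pow_nonneg (hx j) _)
    fun j _ => pow_le_pow_left₀ (hx j) (h j) _

theorem Pos.mul {x y : Fin d → ℝ} (hx : Pos x) (hy : Pos y) : Pos (x * y) :=
  fun j => mul_pos (hx j) (hy j)

theorem Pos.const {a : ℝ} (ha : 0 < a) : Pos (fun _ : Fin d => a) := fun _ => ha

theorem Pos.inv {x : Fin d → ℝ} (hx : Pos x) : Pos (fun j => (x j)⁻¹) :=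
  fun j => inv_pos.2 (hx j)

theorem multiFactorial_pos (α : Fin d → ℕ) : (0 : ℝ) < multiFactorial α := by
  unfold multiFactorial
  exact_mod_cast Finset.prod_pos fun j _ => Nat.factorial_pos _

theorem multiFactorial_rpow (α : Fin d → ℕ) (p : ℝ) :
    (multiFactorial α : ℝ) ^ p = ∏ j, ((α j).factorial : ℝ) ^ p := by
  rw [Real.finsetProd_rpow _ _ fun j _ => by positivity, multiFactorial]
  push_cast
  rfl

theorem multiFactorial_le_add (α β : Fin d → ℕ) :
    (multiFactorial α : ℝ) ≤ multiFactorial (α + β) := by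
  unfold multiFactorial
  exact_mod_cast Finset.prod_le_prod (fun _ _ => Nat.zero_le _)
    fun j _ => Nat.factorial_le (Nat.le_add_right _ _)

theorem multiFactorial_add_le (α β : Fin d → ℕ) :
    (multiFactorial (α + β) : ℝ) ≤
      mpow (fun _ => 2) (α + β) * (multiFactorial α * multiFactorial β) := by
  unfold multiFactorial mpow
  push_cast
  rw [← Finset.prod_mul_distrib, ← Finset.prod_mul_distrib]
  refine Finset.prod_le_prod (fun _ _ => by positivity) fun j _ => ?_
  have h := Nat.add_choose_mul_factorial_mul_factorial (α j) (β j)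
  have h2 := Nat.choose_le_two_pow (α j + β j) (β j)
  have h3 : (α j + β j).factorial ≤ 2 ^ (α j + β j) * ((α j).factorial * (β j).factorial) := by
    rw [← h, mul_assoc]
    exact Nat.mul_le_mul_right _ h2
  exact_mod_cast h3

theorem hasSum_mul_prod {ι κ 𝕜 : Type*} [RCLike 𝕜] {f : ι → 𝕜} {g : κ → 𝕜} {a b : 𝕜}
    (hf : HasSum f a) (hg : HasSum g b) :
    HasSum (fun p : ι × κ => f p.1 * g p.2) (a * b) :=
  hf.mul hg (summable_mul_of_summable_norm hf.summable.norm hg.summable.norm)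

/-- Splits off the first coordinate and inducts on the dimension. Expansions in several variables
are reduced to one variable through this lemma. -/
theorem hasSum_pi_prod {𝕜 : Type*} [RCLike 𝕜] : ∀ {d : ℕ} {f : Fin d → ℕ → 𝕜} {S : Fin d → 𝕜},
    (∀ j, HasSum (f j) (S j)) →
    HasSum (fun α : Fin d → ℕ => ∏ j, f j (α j)) (∏ j, S j) := by
  intro d
  induction d with
  | zero =>
    intro f S _
    simp
  | succ d ih =>
    intro f S h
    have h1 := ih (f := fun j => f j.succ) (S := fun j => S j.succ) fun j => h j.succ
    have h2 := hasSum_mul_prod (h 0) h1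
    rw [Fin.prod_univ_succ, ← (Fin.consEquiv fun _ => ℕ).hasSum_iff]
    convert h2 using 2 with p
    simp [Fin.prod_univ_succ]

end mpow

/-! ### Estimates for factorial weights -/

section weights

variable {d : ℕ}

/-- The weight `r^α α!^{-κ}`. -/
def factorialWeight (κ : ℝ) (r : Fin d → ℝ) (α : Fin d → ℕ) : ℝ :=
  mpow r α * (multiFactorial α : ℝ) ^ (-κ)

theorem factorialWeight_pos (κ : ℝ) {r : Fin d → ℝ} (hr : Pos r) (α : Fin d → ℕ) :
    0 < factorialWeight κ r α :=
  mul_pos (mpow_pos hr α) (Real.rpow_pos_of_pos (multiFactorial_pos α) _)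

theorem factorialWeight_mul (κ : ℝ) (R r : Fin d → ℝ) (α : Fin d → ℕ) :
    factorialWeight κ (R * r) α = mpow R α * factorialWeight κ r α := by
  rw [factorialWeight, mul_mpow, mul_assoc, factorialWeight]

theorem factorialWeight_mono (κ : ℝ) {r R : Fin d → ℝ} (hr : Pos r) (h : ∀ j, r j ≤ R j)
    (α : Fin d → ℕ) : factorialWeight κ r α ≤ factorialWeight κ R α :=
  mul_le_mul_of_nonneg_right (mpow_le_mpow (fun j => (hr j).le) h α)
    (Real.rpow_nonneg (multiFactorial_pos α).le _)

/-- This is the `κ`-th power of `yⁿ/n! ≤ e^y` at `y = x^{1/κ}`. -/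
theorem pow_mul_factorial_rpow_le {κ : ℝ} (hκ : 0 < κ) {x : ℝ} (hx : 0 ≤ x) (n : ℕ) :
    x ^ n * (n.factorial : ℝ) ^ (-κ) ≤ Real.exp (κ * x ^ κ⁻¹) := by
  have hn : (0 : ℝ) < n.factorial := by exact_mod_cast n.factorial_pos
  have h1 := Real.pow_div_factorial_le_exp (x ^ κ⁻¹) (Real.rpow_nonneg hx _) n
  have h2 := Real.rpow_le_rpow (by positivity) h1 hκ.le
  rw [Real.div_rpow (by positivity) hn.le, ← Real.exp_mul, ← Real.rpow_natCast, ← Real.rpow_mul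
    (by positivity), mul_comm (n : ℝ) κ, Real.rpow_mul (by positivity), ← Real.rpow_mul hx,
    inv_mul_cancel₀ hκ.ne', Real.rpow_one, Real.rpow_natCast, div_eq_mul_inv,
    ← Real.rpow_neg hn.le] at h2
  rwa [mul_comm κ]

theorem exists_factorialWeight_le {κ : ℝ} (hκ : 0 < κ) {r : Fin d → ℝ} (hr : Pos r) :
    ∃ C, ∀ α, factorialWeight κ r α ≤ C := by
  refine ⟨∏ j, Real.exp (κ * r j ^ κ⁻¹), fun α => ?_⟩
  rw [factorialWeight, multiFactorial_rpow, mpow, ← Finset.prod_mul_distrib]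
  exact Finset.prod_le_prod
    (fun j _ => mul_nonneg (pow_nonneg (hr j).le _) (Real.rpow_nonneg (by positivity) _))
    fun j _ => pow_mul_factorial_rpow_le hκ (hr j).le _

theorem summable_mpow_half : Summable fun α : Fin d → ℕ => mpow (fun _ => (1 / 2 : ℝ)) α :=
  (hasSum_pi_prod (𝕜 := ℝ) (d := d) fun _ =>
    (summable_geometric_two).hasSum).summable

theorem mpow_half_mul_two (r : Fin d → ℝ) (α : Fin d → ℕ) :
    mpow r α = mpow (fun _ => (1 / 2 : ℝ)) α * mpow (fun j => 2 * r j) α := by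
  rw [← mul_mpow]
  congr 1
  ext j
  simp

theorem summable_factorialWeight {κ : ℝ} (hκ : 0 < κ) {r : Fin d → ℝ} (hr : Pos r) :
    Summable (factorialWeight κ r) := by
  -- The weight with `2r` is still bounded, which leaves the summable factor `2^{-|α|}`.
  obtain ⟨C, hC⟩ := exists_factorialWeight_le hκ (r := fun j => 2 * r j)
    fun j => mul_pos two_pos (hr j)
  refine Summable.of_nonneg_of_le (fun α => (factorialWeight_pos κ hr α).le) (fun α => ?_)
    (summable_mpow_half.mul_right C)
  rw [factorialWeight, mpow_half_mul_two, mul_assoc]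
  exact mul_le_mul_of_nonneg_left (hC α) (mpow_pos (Pos.const (by norm_num)) α).le

/-- Only `α! ≤ (α+β)!` is used: the factorial decay is kept in `α` and given up in `β`. -/
theorem factorialWeight_add_le {κ : ℝ} (hκ : 0 ≤ κ) {r : Fin d → ℝ} (hr : Pos r)
    (α β : Fin d → ℕ) :
    factorialWeight κ r (α + β) ≤ factorialWeight κ r α * mpow r β := by
  rw [factorialWeight, factorialWeight, mpow_add]
  have h := Real.rpow_le_rpow_of_nonpos (multiFactorial_pos α) (multiFactorial_le_add α β)
    (neg_nonpos.2 hκ)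
  have h1 := mpow_pos hr α
  have h2 := mpow_pos hr β
  calc _ ≤ mpow r α * mpow r β * (multiFactorial α : ℝ) ^ (-κ) := by gcongr
    _ = _ := by ring

/-- Binomial coefficients are at most `2^{|α+β|}`. The assumption `κ ≤ 1` only serves to bound their
`κ`-th power by the same quantity. -/
theorem factorialWeight_mul_le_add {κ : ℝ} (hκ : 0 ≤ κ) (hκ1 : κ ≤ 1) {r : Fin d → ℝ}
    (hr : Pos r) (α β : Fin d → ℕ) :
    factorialWeight κ r α * factorialWeight κ r β ≤
      factorialWeight κ (fun j => 2 * r j) (α + β) := by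
  have ha := multiFactorial_pos α
  have hb := multiFactorial_pos β
  have hab := multiFactorial_pos (α + β)
  have h2 : (1 : ℝ) ≤ mpow (fun _ : Fin d => (2 : ℝ)) (α + β) := by
    unfold mpow
    exact Finset.one_le_prod fun j _ => one_le_pow₀ one_le_two
  have h2p : (0 : ℝ) < mpow (fun _ : Fin d => (2 : ℝ)) (α + β) := one_pos.trans_le h2
  have key : ((multiFactorial α : ℝ) * multiFactorial β) ^ (-κ) ≤
      mpow (fun _ => 2) (α + β) * (multiFactorial (α + β) : ℝ) ^ (-κ) := by
    rw [Real.rpow_neg (by positivity), Real.rpow_neg hab.le, ← div_eq_mul_inv, inv_eq_one_div,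
      div_le_div_iff₀ (by positivity) (by positivity), one_mul]
    calc (multiFactorial (α + β) : ℝ) ^ κ
        ≤ (mpow (fun _ => 2) (α + β) * (multiFactorial α * multiFactorial β)) ^ κ :=
          Real.rpow_le_rpow hab.le (multiFactorial_add_le α β) hκ
      _ = mpow (fun _ => 2) (α + β) ^ κ * ((multiFactorial α : ℝ) * multiFactorial β) ^ κ :=
          Real.mul_rpow h2p.le (by positivity)
      _ ≤ _ := by
          gcongr
          exact (Real.rpow_le_rpow_of_exponent_le h2 hκ1).trans_eq (Real.rpow_one _)
  have e : (fun j => 2 * r j) = (fun _ => (2 : ℝ)) * r := rfl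
  have hr1 := mpow_pos hr (α + β)
  rw [factorialWeight, factorialWeight, factorialWeight, e, mul_mpow]
  calc _ = mpow r (α + β) * ((multiFactorial α : ℝ) * multiFactorial β) ^ (-κ) := by
        rw [mpow_add, Real.mul_rpow ha.le hb.le]; ring
    _ ≤ mpow r (α + β) * (mpow (fun _ => 2) (α + β) * (multiFactorial (α + β) : ℝ) ^ (-κ)) := by
        gcongr
    _ = _ := by ring

end weights

/-! ### Cauchy products and their transposes -/

section cauchy

variable {d : ℕ}

instance instHasAntidiagonalFinNat : Finset.HasAntidiagonal (Fin d → ℕ) :=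
  Finset.HasAntidiagonal.antidiagonalOfLocallyFinite

theorem hasSum_sum_antidiagonal {A : Type*} [AddCommMonoid A] [Finset.HasAntidiagonal A]
    {F : A × A → ℂ} {S : ℂ} (h : HasSum F S) :
    HasSum (fun n => ∑ p ∈ Finset.HasAntidiagonal.antidiagonal n, F p) S := by
  have h1 := Finset.HasAntidiagonal.sigmaAntidiagonalEquivProd.hasSum_iff.2 h
  refine h1.sigma fun n => ?_
  have h2 := hasSum_fintype fun p : Finset.HasAntidiagonal.antidiagonal n => F p
  rwa [Finset.sum_coe_sort (Finset.HasAntidiagonal.antidiagonal n) F] at h2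

theorem summable_mul_prod_of_nonneg {ι κ : Type*} {f : ι → ℝ} {g : κ → ℝ} (hf : Summable f)
    (hg : Summable g) (hf0 : ∀ i, 0 ≤ f i) (hg0 : ∀ i, 0 ≤ g i) :
    Summable fun p : ι × κ => f p.1 * g p.2 :=
  hf.mul_of_nonneg hg hf0 hg0

/-- The coefficients of the product of two power series. -/
def cauchyProd (a b : (Fin d → ℕ) → ℂ) (α : Fin d → ℕ) : ℂ :=
  ∑ p ∈ Finset.HasAntidiagonal.antidiagonal α, a p.1 * b p.2

/-- The transpose of the Cauchy product by `e`. -/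
def coshift (e v : (Fin d → ℕ) → ℂ) (β : Fin d → ℕ) : ℂ := ∑' δ, e δ * v (β + δ)

/-- A decomposition of `α` is determined by its first part, which lies below `α`; there are `∏ (α_j
+ 1) ≤ 2^{|α|}` choices. -/
theorem card_antidiagonal_le (α : Fin d → ℕ) :
    ((Finset.HasAntidiagonal.antidiagonal α).card : ℝ) ≤ mpow (fun _ => 2) α := by
  have h1 : (Finset.HasAntidiagonal.antidiagonal α).card ≤ (Finset.Iic α).card := by
    refine Finset.card_le_card_of_injOn Prod.fst (fun p hp => ?_) fun p hp q hq h => ?_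
    · have hp' : p.1 + p.2 = α := by simpa using hp
      exact Finset.mem_coe.2 (Finset.mem_Iic.2 (hp' ▸ le_self_add))
    · have hp' : p.1 + p.2 = α := by simpa using hp
      have hq' : q.1 + q.2 = α := by simpa using hq
      refine Prod.ext h ?_
      rw [← hq', h] at hp'
      exact add_left_cancel hp'
  have h2 : (Finset.Iic α).card ≤ ∏ j, 2 ^ α j := by
    rw [Pi.card_Iic]
    refine Finset.prod_le_prod (fun _ _ => Nat.zero_le _) fun j _ => ?_
    rw [Nat.card_Iic]
    exact Nat.lt_two_pow_self
  have h3 := h1.trans h2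
  simp only [mpow]
  exact_mod_cast h3

/-- The factor 4 is a 2 from the binomial coefficients times a 2 from the number of terms. -/
theorem norm_cauchyProd_le {κ : ℝ} (hκ : 0 ≤ κ) (hκ1 : κ ≤ 1) {r : Fin d → ℝ} (hr : Pos r)
    {a b : (Fin d → ℕ) → ℂ} {A B : ℝ} (ha : ∀ α, ‖a α‖ ≤ A * factorialWeight κ r α)
    (hb : ∀ α, ‖b α‖ ≤ B * factorialWeight κ r α) (α : Fin d → ℕ) :
    ‖cauchyProd a b α‖ ≤ A * B * factorialWeight κ (fun j => 4 * r j) α := by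
  have hw := factorialWeight_pos κ hr 0
  have hA : 0 ≤ A := nonneg_of_mul_nonneg_left ((norm_nonneg _).trans (ha 0)) hw
  have hB : 0 ≤ B := nonneg_of_mul_nonneg_left ((norm_nonneg _).trans (hb 0)) hw
  have hterm : ∀ p ∈ Finset.HasAntidiagonal.antidiagonal α, ‖a p.1 * b p.2‖ ≤
      A * B * factorialWeight κ (fun j => 2 * r j) α := by
    intro p hp
    rw [← Finset.HasAntidiagonal.mem_antidiagonal.1 hp, norm_mul]
    calc ‖a p.1‖ * ‖b p.2‖
        ≤ (A * factorialWeight κ r p.1) * (B * factorialWeight κ r p.2) :=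
          mul_le_mul (ha _) (hb _) (norm_nonneg _) ((norm_nonneg _).trans (ha _))
      _ = A * B * (factorialWeight κ r p.1 * factorialWeight κ r p.2) := by ring
      _ ≤ _ := mul_le_mul_of_nonneg_left (factorialWeight_mul_le_add hκ hκ1 hr _ _)
          (mul_nonneg hA hB)
  have e : (fun j => 4 * r j) = (fun _ => (2 : ℝ)) * fun j => 2 * r j := by
    ext j; simp only [Pi.mul_apply]; ring
  have h2 := factorialWeight_pos κ (r := fun j => 2 * r j) (fun j => mul_pos two_pos (hr j)) α
  calc ‖cauchyProd a b α‖
      ≤ ∑ p ∈ Finset.HasAntidiagonal.antidiagonal α, A * B * factorialWeight κ (fun j => 2 * r j) α :=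
        norm_sum_le_of_le _ hterm
    _ = (Finset.HasAntidiagonal.antidiagonal α).card * (A * B * factorialWeight κ (fun j => 2 * r j) α) := by
        rw [Finset.sum_const, nsmul_eq_mul]
    _ ≤ mpow (fun _ => 2) α * (A * B * factorialWeight κ (fun j => 2 * r j) α) :=
        mul_le_mul_of_nonneg_right (card_antidiagonal_le α) (by positivity)
    _ = _ := by rw [e, factorialWeight_mul]; ring

theorem hasSum_cauchyProd {a b : (Fin d → ℕ) → ℂ} {z : Fin d → ℂ} {A B : ℂ}
    (ha : HasSum (fun α => a α * mpow z α) A) (hb : HasSum (fun α => b α * mpow z α) B) :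
    HasSum (fun α => cauchyProd a b α * mpow z α) (A * B) := by
  have e : ∀ α, cauchyProd a b α * mpow z α =
      ∑ p ∈ Finset.HasAntidiagonal.antidiagonal α, (a p.1 * mpow z p.1) * (b p.2 * mpow z p.2) := by
    intro α
    rw [cauchyProd, Finset.sum_mul]
    refine Finset.sum_congr rfl fun p hp => ?_
    rw [← Finset.HasAntidiagonal.mem_antidiagonal.1 hp, mpow_add]
    ring
  simp_rw [e]
  have h := hasSum_mul_prod ha hb
  exact hasSum_sum_antidiagonal
    (F := fun p : (Fin d → ℕ) × (Fin d → ℕ) => (a p.1 * mpow z p.1) * (b p.2 * mpow z p.2)) h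

/-- The decay of `v` is spent on `β`. Convergence in `δ` comes from the factorial decay of `e`,
which beats the leftover `r^δ`. -/
theorem coshift_bound {κ K E V : ℝ} (hκ : 0 ≤ κ) {r : Fin d → ℝ} (hr : Pos r)
    {e v : (Fin d → ℕ) → ℂ} (he : ∀ δ, ‖e δ‖ ≤ E * factorialWeight K (fun _ => 1) δ)
    (hv : ∀ α, ‖v α‖ ≤ V * factorialWeight κ r α) (β δ : Fin d → ℕ) :
    ‖e δ * v (β + δ)‖ ≤ E * V * factorialWeight κ r β * factorialWeight K r δ := by
  have hw := factorialWeight_pos κ hr 0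
  have hV : 0 ≤ V := nonneg_of_mul_nonneg_left ((norm_nonneg _).trans (hv 0)) hw
  have hw' := factorialWeight_pos K (Pos.const (d := d) one_pos)
  have hE : 0 ≤ E := nonneg_of_mul_nonneg_left ((norm_nonneg _).trans (he 0)) (hw' 0)
  have e1 : factorialWeight K r δ = mpow r δ * factorialWeight K (fun _ => 1) δ := by
    rw [← factorialWeight_mul]
    congr 1
    ext j
    simp
  have hw2 := hw' δ
  rw [norm_mul]
  calc ‖e δ‖ * ‖v (β + δ)‖
      ≤ (E * factorialWeight K (fun _ => 1) δ) * (V * factorialWeight κ r (β + δ)) :=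
        mul_le_mul (he _) (hv _) (norm_nonneg _) ((norm_nonneg _).trans (he _))
    _ ≤ (E * factorialWeight K (fun _ => 1) δ) * (V * (factorialWeight κ r β * mpow r δ)) := by
        gcongr
        exact factorialWeight_add_le hκ hr β δ
    _ = _ := by rw [e1]; ring

theorem summable_coshift {κ K E V : ℝ} (hκ : 0 ≤ κ) (hK : 0 < K) {r : Fin d → ℝ} (hr : Pos r)
    {e v : (Fin d → ℕ) → ℂ} (he : ∀ δ, ‖e δ‖ ≤ E * factorialWeight K (fun _ => 1) δ)
    (hv : ∀ α, ‖v α‖ ≤ V * factorialWeight κ r α) (β : Fin d → ℕ) :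
    Summable fun δ => ‖e δ * v (β + δ)‖ :=
  Summable.of_nonneg_of_le (fun _ => norm_nonneg _) (coshift_bound hκ hr he hv β)
    ((summable_factorialWeight hK hr).mul_left _)

theorem norm_coshift_le {κ K E V : ℝ} (hκ : 0 ≤ κ) (hK : 0 < K) {r : Fin d → ℝ} (hr : Pos r)
    {e v : (Fin d → ℕ) → ℂ} (he : ∀ δ, ‖e δ‖ ≤ E * factorialWeight K (fun _ => 1) δ)
    (hv : ∀ α, ‖v α‖ ≤ V * factorialWeight κ r α) (β : Fin d → ℕ) :
    ‖coshift e v β‖ ≤ E * V * (∑' δ, factorialWeight K r δ) * factorialWeight κ r β := by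
  have h1 := summable_coshift hκ hK hr he hv β
  refine (norm_tsum_le_tsum_norm h1).trans ?_
  refine (h1.tsum_le_tsum (coshift_bound hκ hr he hv β)
    ((summable_factorialWeight hK hr).mul_left _)).trans_eq ?_
  rw [tsum_mul_left]
  ring

/-- Transposes compose to the transpose of the product. Regrouping the double sum by `δ + δ'` turns
the pair `e, e'` into their Cauchy product, which is the unit. -/
theorem coshift_coshift {κ K E E' V : ℝ} (hκ : 0 ≤ κ) (hK : 0 < K) {r : Fin d → ℝ} (hr : Pos r)
    {e e' v : (Fin d → ℕ) → ℂ} (he : ∀ δ, ‖e δ‖ ≤ E * factorialWeight K (fun _ => 1) δ)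
    (he' : ∀ δ, ‖e' δ‖ ≤ E' * factorialWeight K (fun _ => 1) δ)
    (hv : ∀ α, ‖v α‖ ≤ V * factorialWeight κ r α)
    (hee : ∀ α, cauchyProd e e' α = if α = 0 then 1 else 0) :
    coshift e (coshift e' v) = v := by
  ext β
  -- Absolute convergence of the double series justifies the regrouping: `δ` is summed by the decay
  -- of `e` against `r^δ`, and `δ'` by that of `e'`.
  have hs : Summable fun p : (Fin d → ℕ) × (Fin d → ℕ) => e p.1 * e' p.2 * v (β + p.1 + p.2) := by
    refine Summable.of_norm_bounded (g := fun p : (Fin d → ℕ) × (Fin d → ℕ) =>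
      (‖e p.1‖ * mpow r p.1) * (E' * V * factorialWeight κ r β * factorialWeight K r p.2)) ?_ ?_
    · refine summable_mul_prod_of_nonneg (f := fun δ => ‖e δ‖ * mpow r δ)
        (g := fun δ => E' * V * factorialWeight κ r β * factorialWeight K r δ) ?_ ((summable_factorialWeight hK hr).mul_left _)
        (fun δ => mul_nonneg (norm_nonneg _) (mpow_pos hr _).le) fun δ => ?_
      · refine Summable.of_nonneg_of_le (fun δ => mul_nonneg (norm_nonneg _) (mpow_pos hr _).le)
          (fun δ => ?_) ((summable_factorialWeight hK hr).mul_left E)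
        have e1 : factorialWeight K r δ = factorialWeight K (fun _ => 1) δ * mpow r δ := by
          rw [mul_comm, ← factorialWeight_mul]
          congr 1
          ext j
          simp
        rw [e1, ← mul_assoc]
        exact mul_le_mul_of_nonneg_right (he δ) (mpow_pos hr _).le
      · exact (norm_nonneg _).trans (coshift_bound hκ hr he' hv β δ)
    · intro p
      have h1 := coshift_bound hκ hr he' hv (β + p.1) p.2
      have h0 := coshift_bound hκ hr he' hv 0 0
      have hE'V : 0 ≤ E' * V := by
        have hp := mul_pos (factorialWeight_pos κ hr 0) (factorialWeight_pos K hr 0)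
        rw [mul_assoc] at h0
        exact nonneg_of_mul_nonneg_left ((norm_nonneg _).trans h0) hp
      have hp := factorialWeight_pos K hr p.2
      rw [mul_assoc, norm_mul]
      calc ‖e p.1‖ * ‖e' p.2 * v (β + p.1 + p.2)‖
          ≤ ‖e p.1‖ * (E' * V * factorialWeight κ r (β + p.1) * factorialWeight K r p.2) := by
            gcongr
        _ ≤ ‖e p.1‖ * (E' * V * (factorialWeight κ r β * mpow r p.1) *
              factorialWeight K r p.2) := by
            gcongr
            exact factorialWeight_add_le hκ hr _ _
        _ = _ := by ring
  have h1 : coshift e (coshift e' v) β =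
      ∑' p : (Fin d → ℕ) × (Fin d → ℕ), e p.1 * e' p.2 * v (β + p.1 + p.2) := by
    rw [hs.tsum_prod]
    simp only [coshift, mul_assoc, tsum_mul_left]
  have h2 : ∀ α : Fin d → ℕ, ∑ p ∈ Finset.HasAntidiagonal.antidiagonal α,
      e p.1 * e' p.2 * v (β + p.1 + p.2) = if α = 0 then v β else 0 := by
    intro α
    have h3 : ∑ p ∈ Finset.HasAntidiagonal.antidiagonal α, e p.1 * e' p.2 * v (β + p.1 + p.2) =
        cauchyProd e e' α * v (β + α) := by
      rw [cauchyProd, Finset.sum_mul]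
      refine Finset.sum_congr rfl fun p hp => ?_
      rw [add_assoc, Finset.HasAntidiagonal.mem_antidiagonal.1 hp]
    rw [h3, hee]
    split_ifs with h
    · simp [h]
    · simp
  have h4 := hasSum_sum_antidiagonal
    (F := fun p : (Fin d → ℕ) × (Fin d → ℕ) => e p.1 * e' p.2 * v (β + p.1 + p.2)) hs.hasSum
  simp only [h2] at h4
  rw [h1, ← h4.tsum_eq, tsum_ite_eq]

end cauchy

/-! ### The Taylor coefficients of `e^{ε⟨z, z⟩}` -/

section quad

variable {d : ℕ}

/-- The Taylor coefficients of `e^{ε z²}` in one variable. -/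
def quadCoeffOne (ε : ℂ) (n : ℕ) : ℂ := if Even n then ε ^ (n / 2) / (n / 2).factorial else 0

/-- The Taylor coefficients of `e^{ε⟨z, z⟩}`. -/
def quadCoeff (ε : ℂ) (α : Fin d → ℕ) : ℂ := ∏ j, quadCoeffOne ε (α j)

theorem hasSum_quadCoeffOne (ε z : ℂ) :
    HasSum (fun n => quadCoeffOne ε n * z ^ n) (Complex.exp (ε * z ^ 2)) := by
  -- Only even indices contribute, so the series is pulled back along `k ↦ 2k` to the exponential
  -- series.
  have hinj : Function.Injective fun k : ℕ => 2 * k := fun a b h => by simpa using h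
  rw [← hinj.hasSum_iff]
  · have h := NormedSpace.expSeries_div_hasSum_exp (ε * z ^ 2)
    rw [← Complex.exp_eq_exp_ℂ] at h
    refine (congrArg (HasSum · _) (funext fun k => ?_)).mpr h
    simp only [quadCoeffOne, Function.comp_apply, even_two_mul, if_true, mul_pow, pow_mul,
      Nat.mul_div_cancel_left k two_pos]
    ring
  · intro n hn
    have : ¬ Even n := fun ⟨k, hk⟩ => hn ⟨k, by simp [hk, two_mul]⟩
    simp [quadCoeffOne, this]

theorem hasSum_quadCoeff (ε : ℂ) (z : Fin d → ℂ) :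
    HasSum (fun α => quadCoeff ε α * mpow z α) (Complex.exp (ε * ∑ j, z j ^ 2)) := by
  rw [Finset.mul_sum, Complex.exp_sum]
  have h := hasSum_pi_prod fun j => hasSum_quadCoeffOne ε (z j)
  simp only [Finset.prod_mul_distrib] at h
  exact h

/-- From `(2k)! ≤ 4^k (k!)²` one gets `√(2k)!/k! ≤ 2^k`, and `‖ε‖ ≤ 1/2` cancels the `2^k`. -/
theorem norm_quadCoeffOne_le {ε : ℂ} (hε : ‖ε‖ ≤ 1 / 2) (n : ℕ) :
    ‖quadCoeffOne ε n‖ ≤ (n.factorial : ℝ) ^ (-(1 / 2) : ℝ) := by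
  unfold quadCoeffOne
  split_ifs with h
  · obtain ⟨k, rfl⟩ := h
    have hk : (0 : ℝ) < k.factorial := by exact_mod_cast k.factorial_pos
    have hkk : (0 : ℝ) < (k + k).factorial := by exact_mod_cast (k + k).factorial_pos
    have e : (k + k) / 2 = k := by omega
    rw [e, norm_div, norm_pow, Complex.norm_natCast, Real.rpow_neg hkk.le, ← Real.sqrt_eq_rpow,
      inv_eq_one_div, div_le_div_iff₀ hk (Real.sqrt_pos.2 hkk), one_mul]
    have h1 : ((k + k).factorial : ℝ) ≤ (2 ^ k * k.factorial) ^ 2 := by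
      have h := Nat.add_choose_mul_factorial_mul_factorial k k
      have h2 := Nat.choose_le_two_pow (k + k) k
      have h3 : (k + k).factorial ≤ 2 ^ (k + k) * (k.factorial * k.factorial) := by
        rw [← h, mul_assoc]
        exact Nat.mul_le_mul_right _ h2
      calc ((k + k).factorial : ℝ) ≤ 2 ^ (k + k) * (k.factorial * k.factorial) := by
            exact_mod_cast h3
        _ = _ := by rw [pow_add]; ring
    calc ‖ε‖ ^ k * √((k + k).factorial : ℝ)
        ≤ (1 / 2) ^ k * (2 ^ k * k.factorial) := by
          gcongr
          exact Real.sqrt_le_iff.2 ⟨by positivity, h1⟩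
      _ = k.factorial := by rw [← mul_assoc, ← mul_pow]; norm_num
  · rw [norm_zero]
    positivity

theorem norm_quadCoeff_le {ε : ℂ} (hε : ‖ε‖ ≤ 1 / 2) (α : Fin d → ℕ) :
    ‖quadCoeff ε α‖ ≤ 1 * factorialWeight (1 / 2) (fun _ => 1) α := by
  rw [quadCoeff, norm_prod, factorialWeight, multiFactorial_rpow]
  simp only [mpow, one_pow, Finset.prod_const_one, one_mul]
  exact Finset.prod_le_prod (fun _ _ => norm_nonneg _) fun j _ => norm_quadCoeffOne_le hε _

end quad

/-! ### Generating function and bounds of the Hermite functions -/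

/-- The generating function `∑ h_n(t) w^n / √n!` of the Hermite functions in one variable. -/
def hermiteGenOne (w : ℂ) (t : ℝ) : ℂ :=
  ((Real.pi ^ (-(1 / 4) : ℝ) : ℝ) : ℂ) *
    Complex.exp (-(t : ℂ) ^ 2 / 2 + (√2 : ℝ) * t * w - w ^ 2 / 2)

theorem differentiable_cexp_neg_sq : Differentiable ℂ fun z : ℂ => Complex.exp (-z ^ 2) := by
  fun_prop

/-- Allows Cauchy estimates and Taylor series of the entire function `e^{-z²}` to be used for the
real derivatives in `hermiteFun`. -/
theorem ofReal_iteratedDeriv_gaussian (n : ℕ) (t : ℝ) :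
    ((iteratedDeriv n (fun u : ℝ => Real.exp (-u ^ 2)) t : ℝ) : ℂ) =
      iteratedDeriv n (fun z : ℂ => Complex.exp (-z ^ 2)) t := by
  induction n generalizing t with
  | zero => simp
  | succ n ih =>
    rw [iteratedDeriv_succ, iteratedDeriv_succ]
    have h1 : Differentiable ℂ (iteratedDeriv n fun z : ℂ => Complex.exp (-z ^ 2)) :=
      (differentiable_cexp_neg_sq.contDiff (n := n + 1)).differentiable_iteratedDeriv n
        (by exact_mod_cast n.lt_succ_self)
    have h2 : ContDiff ℝ (n + 1) (fun u : ℝ => Real.exp (-u ^ 2)) := by fun_prop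
    have h3 : Differentiable ℝ (iteratedDeriv n fun u : ℝ => Real.exp (-u ^ 2)) :=
      h2.differentiable_iteratedDeriv n (by exact_mod_cast n.lt_succ_self)
    have h4 := (h1 (t : ℂ)).hasDerivAt.comp_ofReal
    have h5 := (h3 t).hasDerivAt.ofReal_comp
    have e : (fun y : ℝ => iteratedDeriv n (fun z : ℂ => Complex.exp (-z ^ 2)) y) =
        fun y : ℝ => ((iteratedDeriv n (fun u : ℝ => Real.exp (-u ^ 2)) y : ℝ) : ℂ) :=
      funext fun y => (ih y).symm
    rw [e] at h4
    exact h5.unique h4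

/-- Cauchy's estimate on the circle of radius `ρ` about `t`. -/
theorem norm_iteratedDeriv_gaussian_le (n : ℕ) (t : ℝ) {ρ : ℝ} (hρ : 0 < ρ) :
    ‖iteratedDeriv n (fun z : ℂ => Complex.exp (-z ^ 2)) t‖ ≤
      n.factorial * Real.exp (-t ^ 2 + 2 * ρ * |t| + ρ ^ 2) / ρ ^ n := by
  refine Complex.norm_iteratedDeriv_le_of_forall_mem_sphere_norm_le n hρ
    differentiable_cexp_neg_sq.diffContOnCl fun z hz => ?_
  rw [Complex.norm_exp]
  refine Real.exp_le_exp.2 ?_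
  obtain ⟨u, rfl⟩ : ∃ u, z = t + u := ⟨z - t, by ring⟩
  have hu : ‖u‖ = ρ := by simpa using hz
  have h1 : (-((t : ℂ) + u) ^ 2).re = -t ^ 2 - 2 * t * u.re + (-u ^ 2).re := by
    simp [pow_two]
    ring
  have h2 : (-u ^ 2).re ≤ ρ ^ 2 := by
    refine (Complex.re_le_norm _).trans ?_
    rw [norm_neg, norm_pow, hu]
  have h3 : -(t * u.re) ≤ ρ * |t| := by
    refine (neg_le_abs _).trans ?_
    rw [abs_mul, mul_comm]
    exact mul_le_mul_of_nonneg_right (hu ▸ Complex.abs_re_le_norm u) (abs_nonneg _)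
  rw [h1]
  linarith

theorem two_pow_mul_rpow_neg_half (n : ℕ) (x : ℝ) (hx : 0 ≤ x) :
    ((2 : ℝ) ^ n * x) ^ (-(1 / 2) : ℝ) = ((√2) ^ n)⁻¹ * (√x)⁻¹ := by
  rw [Real.rpow_neg (by positivity), ← Real.sqrt_eq_rpow, Real.sqrt_mul (by positivity), mul_inv]
  congr 2
  rw [Real.sqrt_eq_iff_mul_self_eq (by positivity) (by positivity), ← mul_pow,
    Real.mul_self_sqrt zero_le_two]

theorem continuous_hermiteFun (n : ℕ) : Continuous (hermiteFun n) := by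
  have h2 : ContDiff ℝ ⊤ (fun u : ℝ => Real.exp (-u ^ 2)) := by fun_prop
  have h3 : Continuous (iteratedDeriv n fun u : ℝ => Real.exp (-u ^ 2)) :=
    h2.continuous_iteratedDeriv n (by exact_mod_cast le_top)
  unfold hermiteFun
  fun_prop

/-- Cauchy's estimate for Hermite functions. -/
theorem abs_hermiteFun_div_sqrt_le (n : ℕ) (t : ℝ) {R : ℝ} (hR : 0 < R) :
    |hermiteFun n t| / √n.factorial ≤ (R⁻¹) ^ n *
      (Real.pi ^ (-(1 / 4) : ℝ) * Real.exp (-t ^ 2 / 2 + √2 * R * |t| + R ^ 2 / 2)) := by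
  have h2 : (0 : ℝ) < √2 := by positivity
  have hsq : √2 * √2 = (2 : ℝ) := Real.mul_self_sqrt zero_le_two
  -- With radius `R/√2`, the factor `√2ⁿ` in `ρ⁻ⁿ` cancels the normalization `2^{-n/2}` of
  -- `hermiteFun`.
  have h := norm_iteratedDeriv_gaussian_le n t (div_pos hR h2)
  rw [← ofReal_iteratedDeriv_gaussian, Complex.norm_real, Real.norm_eq_abs] at h
  have hn : (0 : ℝ) < n.factorial := by exact_mod_cast n.factorial_pos
  have hpi : (0 : ℝ) < Real.pi ^ (-(1 / 4) : ℝ) := Real.rpow_pos_of_pos Real.pi_pos _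
  rw [hermiteFun, two_pow_mul_rpow_neg_half n _ hn.le, abs_mul, abs_mul, abs_mul, abs_mul,
    abs_pow, abs_neg, abs_one, one_pow, abs_of_pos hpi, abs_of_pos (Real.exp_pos _),
    abs_of_pos (by positivity)]
  have e1 : -t ^ 2 + 2 * (R / √2) * |t| + (R / √2) ^ 2 =
      -t ^ 2 / 2 + √2 * R * |t| + R ^ 2 / 2 - t ^ 2 / 2 := by
    have e2 : 2 * (R / √2) = √2 * R := by
      field_simp
      linear_combination (-1) * hsq
    rw [e2, div_pow, Real.sq_sqrt zero_le_two]
    ring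
  rw [e1, Real.exp_sub] at h
  have hs : √(n.factorial : ℝ) * √(n.factorial : ℝ) = n.factorial := Real.mul_self_sqrt hn.le
  have hs0 : 0 < √(n.factorial : ℝ) := Real.sqrt_pos.2 hn
  calc _ = Real.pi ^ (-(1 / 4) : ℝ) * ((√2 ^ n)⁻¹ * (√(n.factorial : ℝ))⁻¹) *
        Real.exp (t ^ 2 / 2) / √(n.factorial : ℝ) *
        |iteratedDeriv n (fun u => Real.exp (-u ^ 2)) t| := by ring
    _ ≤ Real.pi ^ (-(1 / 4) : ℝ) * ((√2 ^ n)⁻¹ * (√(n.factorial : ℝ))⁻¹) *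
        Real.exp (t ^ 2 / 2) / √(n.factorial : ℝ) * (n.factorial *
        (Real.exp (-t ^ 2 / 2 + √2 * R * |t| + R ^ 2 / 2) / Real.exp (t ^ 2 / 2)) /
          (R / √2) ^ n) := by gcongr
    _ = _ := by
        rw [div_pow, inv_pow]
        have := Real.exp_pos (t ^ 2 / 2)
        field_simp
        rw [Real.sq_sqrt hn.le]

/-- Taylor expansion of `e^{-z²}` about `t`, evaluated at `t - w/√2` and multiplied by `π^{-1/4}
e^{t²/2}`. -/
theorem hasSum_hermiteFun (w : ℂ) (t : ℝ) :
    HasSum (fun n => (hermiteFun n t : ℂ) * (w ^ n / (√n.factorial : ℝ))) (hermiteGenOne w t) := by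
  have h := Complex.hasSum_taylorSeries_of_entire differentiable_cexp_neg_sq (t : ℂ)
    (t - w / (√2 : ℝ))
  have h2 : ((√2 : ℝ) : ℂ) * (√2 : ℝ) = 2 := by
    rw [← Complex.ofReal_mul, Real.mul_self_sqrt zero_le_two]; norm_num
  have h20 : ((√2 : ℝ) : ℂ) ≠ 0 := by
    rw [Complex.ofReal_ne_zero]; positivity
  have h' := h.mul_left (((Real.pi ^ (-(1 / 4) : ℝ) : ℝ) : ℂ) * Complex.exp (t ^ 2 / 2))
  have e : ((Real.pi ^ (-(1 / 4) : ℝ) : ℝ) : ℂ) * Complex.exp (t ^ 2 / 2) *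
      Complex.exp (-(t - w / (√2 : ℝ)) ^ 2) = hermiteGenOne w t := by
    have e1 : w / (√2 : ℝ) = (√2 : ℝ) * w / 2 := by
      field_simp
      linear_combination (-w) * h2
    rw [hermiteGenOne, mul_assoc, ← Complex.exp_add, e1]
    congr 2
    linear_combination (-(w ^ 2 / 4)) * h2
  rw [e] at h'
  refine (congrArg (HasSum · _) (funext fun n => ?_)).mpr h'
  have hn : (0 : ℝ) < n.factorial := by exact_mod_cast n.factorial_pos
  have hs0 : ((√(n.factorial : ℝ) : ℝ) : ℂ) ≠ 0 := by
    rw [Complex.ofReal_ne_zero]; positivity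
  have hs : ((√(n.factorial : ℝ) : ℝ) : ℂ) * (√(n.factorial : ℝ) : ℝ) = n.factorial := by
    rw [← Complex.ofReal_mul, Real.mul_self_sqrt hn.le]; simp
  rw [hermiteFun, two_pow_mul_rpow_neg_half n _ hn.le]
  push_cast
  rw [ofReal_iteratedDeriv_gaussian, ← hs]
  simp only [smul_eq_mul, sub_sub_cancel_left]
  rw [neg_pow (w / _), div_pow]
  field_simp

/-! ### Integrals of Hermite functions against the generating function -/

theorem integrable_exp_neg_sq_add_abs {b : ℝ} (hb : 0 < b) (c : ℝ) :
    Integrable fun t : ℝ => Real.exp (-b * t ^ 2 + c * |t|) := by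
  refine ((integrable_exp_neg_mul_sq (half_pos hb)).mul_const (Real.exp (c ^ 2 / (2 * b)))).mono'
    (by fun_prop) (Filter.Eventually.of_forall fun t => ?_)
  rw [Real.norm_eq_abs, abs_of_pos (Real.exp_pos _), ← Real.exp_add]
  refine Real.exp_le_exp.2 ?_
  have h : 0 ≤ (b * |t| - c) ^ 2 / (2 * b) := by positivity
  have e : (b * |t| - c) ^ 2 / (2 * b) = b / 2 * t ^ 2 - c * |t| + c ^ 2 / (2 * b) := by
    rw [← sq_abs t]
    field_simp
    ring
  rw [e] at h
  linarith

/-- Orthonormality of the Hermite functions in generating form. Integration by parts moves the `n`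
derivatives of `e^{-t²}` onto `e^{√2 w t}`, each giving `-√2 w`, and a Gaussian integral remains. -/
theorem integral_hermiteFun_mul_gen (n : ℕ) (w : ℂ) :
    ∫ t, (hermiteFun n t : ℂ) * hermiteGenOne w t = w ^ n / (√n.factorial : ℝ) := by
  have h2 : ((√2 : ℝ) : ℂ) * (√2 : ℝ) = 2 := by
    rw [← Complex.ofReal_mul, Real.mul_self_sqrt zero_le_two]; norm_num
  have h20 : ((√2 : ℝ) : ℂ) ≠ 0 := by
    rw [Complex.ofReal_ne_zero]; positivity
  set D : ℕ → ℝ → ℂ := fun n t => iteratedDeriv n (fun z : ℂ => Complex.exp (-z ^ 2)) t with hD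
  set u : ℝ → ℂ := fun t => Complex.exp ((√2 : ℝ) * w * t) with hu
  have hd : ∀ n, Differentiable ℂ (iteratedDeriv n fun z : ℂ => Complex.exp (-z ^ 2)) := fun n =>
    (differentiable_cexp_neg_sq.contDiff (n := n + 1)).differentiable_iteratedDeriv n
      (by exact_mod_cast n.lt_succ_self)
  have hD' : ∀ n t, HasDerivAt (D n) (D (n + 1) t) t := fun n t => by
    have h := (hd n (t : ℂ)).hasDerivAt.comp_ofReal
    rwa [← iteratedDeriv_succ] at h
  have hu' : ∀ t : ℝ, HasDerivAt u ((√2 : ℝ) * w * u t) t := fun t => by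
    have h : HasDerivAt (fun z : ℂ => Complex.exp ((√2 : ℝ) * w * z))
        (Complex.exp ((√2 : ℝ) * w * t) * ((√2 : ℝ) * w)) (t : ℂ) := by
      simpa using ((hasDerivAt_id (t : ℂ)).const_mul (((√2 : ℝ) : ℂ) * w)).cexp
    rw [mul_comm (((√2 : ℝ) : ℂ) * w)]
    exact h.comp_ofReal
  have hint : ∀ n, Integrable (u * D n) := fun n => by
    -- The linear rate combines Cauchy's estimate with radius 1 and the growth of `u`.
    have hg := integrable_exp_neg_sq_add_abs one_pos (2 * 1 + √2 * ‖w‖)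
    refine (hg.const_mul (n.factorial * Real.exp 1)).mono' ?_
      (Filter.Eventually.of_forall fun t => ?_)
    · refine Continuous.aestronglyMeasurable (Continuous.mul (by fun_prop) ?_)
      exact (hd n).continuous.comp Complex.continuous_ofReal
    · have h1 : ‖D n t‖ ≤ n.factorial * Real.exp (-t ^ 2 + 2 * 1 * |t| + 1 ^ 2) / 1 ^ n :=
        norm_iteratedDeriv_gaussian_le n t one_pos
      have h3 : ‖u t‖ ≤ Real.exp (√2 * ‖w‖ * |t|) := by
        rw [hu, Complex.norm_exp]
        refine Real.exp_le_exp.2 ((Complex.re_le_norm _).trans_eq ?_)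
        simp [abs_of_nonneg (Real.sqrt_nonneg 2)]
      rw [Pi.mul_apply, norm_mul]
      refine (mul_le_mul h3 h1 (norm_nonneg _) (Real.exp_pos _).le).trans_eq ?_
      rw [one_pow, one_pow, div_one, mul_left_comm, ← Real.exp_add,
        mul_assoc (n.factorial : ℝ) (Real.exp 1), ← Real.exp_add]
      ring_nf
  have hI : ∀ n, ∫ t, u t * D n t = (-((√2 : ℝ) * w)) ^ n * ∫ t, u t * D 0 t := by
    intro n
    induction n with
    | zero => simp
    | succ n ih =>
      have h := integral_mul_deriv_eq_deriv_mul_of_integrable (u := u) (v := D n)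
        (u' := fun t => (√2 : ℝ) * w * u t) (v' := D (n + 1))
        (fun t _ => hu' t) (fun t _ => hD' n t) (hint (n + 1))
        (by
          have := (hint n).const_mul ((√2 : ℝ) * w)
          refine this.congr (Filter.Eventually.of_forall fun t => ?_)
          simp only [Pi.mul_apply]; ring) (hint n)
      rw [h]
      simp_rw [mul_assoc]
      rw [integral_const_mul, integral_const_mul, ih]
      ring
  have hI0 : ∫ t, u t * D 0 t = (√Real.pi : ℝ) * Complex.exp (w ^ 2 / 2) := by
    have h := integral_cexp_quadratic (b := -1) (by simp) ((√2 : ℝ) * w) 0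
    have e : ∀ t : ℝ, u t * D 0 t =
        Complex.exp (-1 * (t : ℂ) ^ 2 + (√2 : ℝ) * w * t + 0) := fun t => by
      simp only [hu, hD, iteratedDeriv_zero, ← Complex.exp_add]
      ring_nf
    simp_rw [e]
    rw [h]
    congr 1
    · rw [Real.sqrt_eq_rpow, Complex.ofReal_cpow Real.pi_pos.le]
      norm_num
    · congr 1
      linear_combination (w ^ 2 / 4) * h2
  have hn : (0 : ℝ) < n.factorial := by exact_mod_cast n.factorial_pos
  have hs0 : ((√(n.factorial : ℝ) : ℝ) : ℂ) ≠ 0 := by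
    rw [Complex.ofReal_ne_zero]; positivity
  set K : ℂ := ((Real.pi ^ (-(1 / 4) : ℝ) : ℝ) : ℂ) * ((Real.pi ^ (-(1 / 4) : ℝ) : ℝ) : ℂ) *
    (-1) ^ n * (((√2 : ℝ) : ℂ) ^ n)⁻¹ * ((√(n.factorial : ℝ) : ℝ) : ℂ)⁻¹ *
      Complex.exp (-w ^ 2 / 2) with hK
  have key : ∀ t : ℝ, (hermiteFun n t : ℂ) * hermiteGenOne w t = K * (u t * D n t) := by
    intro t
    rw [hermiteFun, two_pow_mul_rpow_neg_half n _ hn.le, hermiteGenOne, hK]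
    push_cast
    rw [ofReal_iteratedDeriv_gaussian]
    have e : Complex.exp ((t : ℂ) ^ 2 / 2) *
        Complex.exp (-(t : ℂ) ^ 2 / 2 + (√2 : ℝ) * t * w - w ^ 2 / 2) =
        Complex.exp (-w ^ 2 / 2) * u t := by
      rw [hu, ← Complex.exp_add, ← Complex.exp_add]
      ring_nf
    simp only [hD]
    linear_combination ((Real.pi ^ (-(1 / 4) : ℝ) : ℝ) : ℂ) * ((Real.pi ^ (-(1 / 4) : ℝ) : ℝ) : ℂ) *
      (-1) ^ n * (((√2 : ℝ) : ℂ) ^ n)⁻¹ * ((√(n.factorial : ℝ) : ℝ) : ℂ)⁻¹ *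
      iteratedDeriv n (fun z : ℂ => Complex.exp (-z ^ 2)) t * e
  simp_rw [key]
  rw [integral_const_mul, hI, hI0, hK]
  have hpi : ((Real.pi ^ (-(1 / 4) : ℝ) : ℝ) : ℂ) * ((Real.pi ^ (-(1 / 4) : ℝ) : ℝ) : ℂ) *
      (√Real.pi : ℝ) = 1 := by
    rw [← Complex.ofReal_mul, ← Complex.ofReal_mul, Real.sqrt_eq_rpow,
      ← Real.rpow_add Real.pi_pos, ← Real.rpow_add Real.pi_pos]
    norm_num
  have hexp : Complex.exp (-w ^ 2 / 2) * Complex.exp (w ^ 2 / 2) = 1 := by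
    rw [← Complex.exp_add, ← Complex.exp_zero]
    ring_nf
  have hneg : (-1 : ℂ) ^ n * (-((√2 : ℝ) * w)) ^ n = ((√2 : ℝ) : ℂ) ^ n * w ^ n := by
    rw [← mul_pow, ← mul_pow]
    ring_nf
  calc _ = (((Real.pi ^ (-(1 / 4) : ℝ) : ℝ) : ℂ) * ((Real.pi ^ (-(1 / 4) : ℝ) : ℝ) : ℂ) *
      (√Real.pi : ℝ)) * (Complex.exp (-w ^ 2 / 2) * Complex.exp (w ^ 2 / 2)) *
      ((-1 : ℂ) ^ n * (-((√2 : ℝ) * w)) ^ n) * (((√2 : ℝ) : ℂ) ^ n)⁻¹ *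
      ((√(n.factorial : ℝ) : ℝ) : ℂ)⁻¹ := by ring
    _ = _ := by
      rw [hpi, hexp, hneg]
      field_simp

/-! ### Hermite functions in several variables -/

section hermite

variable {d : ℕ}

/-- The generating function `∑ h_α(x) w^α / √α!` of the Hermite functions. -/
def hermiteGen (w : Fin d → ℂ) (x : Fin d → ℝ) : ℂ := ∏ j, hermiteGenOne (w j) (x j)

theorem sqrt_multiFactorial (α : Fin d → ℕ) :
    √(multiFactorial α : ℝ) = ∏ j, √((α j).factorial : ℝ) := by
  simp only [Real.sqrt_eq_rpow]
  exact multiFactorial_rpow α _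

theorem sqrt_multiFactorial_pos (α : Fin d → ℕ) : 0 < √(multiFactorial α : ℝ) :=
  Real.sqrt_pos.2 (multiFactorial_pos α)

theorem hasSum_hermite (w : Fin d → ℂ) (x : Fin d → ℝ) :
    HasSum (fun α => (hermite α x : ℂ) * (mpow w α / (√(multiFactorial α : ℝ) : ℝ)))
      (hermiteGen w x) := by
  have h := hasSum_pi_prod fun j => hasSum_hermiteFun (w j) (x j)
  simp only [Finset.prod_mul_distrib, Finset.prod_div_distrib] at h
  refine (congrArg (HasSum · _) (funext fun α => ?_)).mpr h
  rw [sqrt_multiFactorial, hermite, mpow]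
  push_cast
  rfl

theorem integral_hermite_mul_gen (α : Fin d → ℕ) (w : Fin d → ℂ) :
    ∫ x, (hermite α x : ℂ) * hermiteGen w x = mpow w α / (√(multiFactorial α : ℝ) : ℝ) := by
  have e : ∀ x : Fin d → ℝ, (hermite α x : ℂ) * hermiteGen w x =
      ∏ j, ((hermiteFun (α j) (x j) : ℂ) * hermiteGenOne (w j) (x j)) := fun x => by
    rw [hermite, hermiteGen, Finset.prod_mul_distrib]
    push_cast
    rfl
  simp_rw [e]
  rw [integral_fintype_prod_volume_eq_prod
    fun j (t : ℝ) => (hermiteFun (α j) t : ℂ) * hermiteGenOne (w j) t]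
  simp_rw [integral_hermiteFun_mul_gen]
  rw [Finset.prod_div_distrib, sqrt_multiFactorial, mpow]
  push_cast
  rfl

theorem continuous_hermite (α : Fin d → ℕ) : Continuous (hermite α) :=
  continuous_finsetProd _ fun j _ => (continuous_hermiteFun (α j)).comp (continuous_apply j)

/-- A Gaussian type majorant of the normalized Hermite functions. -/
def hermiteMajorant (R : Fin d → ℝ) (x : Fin d → ℝ) : ℝ :=
  ∏ j, (Real.pi ^ (-(1 / 4) : ℝ) *
    Real.exp (-x j ^ 2 / 2 + √2 * R j * |x j| + R j ^ 2 / 2))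

theorem hermiteMajorant_nonneg (R x : Fin d → ℝ) : 0 ≤ hermiteMajorant R x :=
  Finset.prod_nonneg fun _ _ => mul_nonneg (Real.rpow_nonneg Real.pi_pos.le _) (Real.exp_pos _).le

theorem continuous_hermiteMajorant (R : Fin d → ℝ) : Continuous (hermiteMajorant R) := by
  unfold hermiteMajorant
  fun_prop

theorem abs_hermite_div_sqrt_le (α : Fin d → ℕ) (x : Fin d → ℝ) {R : Fin d → ℝ} (hR : Pos R) :
    |hermite α x| / √(multiFactorial α : ℝ) ≤
      mpow (fun j => (R j)⁻¹) α * hermiteMajorant R x := by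
  rw [hermite, Finset.abs_prod, sqrt_multiFactorial, ← Finset.prod_div_distrib, mpow,
    hermiteMajorant, ← Finset.prod_mul_distrib]
  exact Finset.prod_le_prod (fun _ _ => by positivity)
    fun j _ => abs_hermiteFun_div_sqrt_le (α j) (x j) (hR j)

theorem integrable_hermiteMajorant (R : Fin d → ℝ) : Integrable (hermiteMajorant R) := by
  refine Integrable.fintype_prod (f := fun j (t : ℝ) => Real.pi ^ (-(1 / 4) : ℝ) *
    Real.exp (-t ^ 2 / 2 + √2 * R j * |t| + R j ^ 2 / 2)) fun j => ?_
  refine Integrable.const_mul ?_ _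
  refine ((integrable_exp_neg_sq_add_abs (b := 1 / 2) (by norm_num) (√2 * R j)).mul_const
    (Real.exp (R j ^ 2 / 2))).congr (Filter.Eventually.of_forall fun t => ?_)
  simp only [← Real.exp_add]
  ring_nf

theorem memLp_hermiteMajorant (R : Fin d → ℝ) : MemLp (hermiteMajorant R) 2 := by
  rw [memLp_two_iff_integrable_sq (continuous_hermiteMajorant R).aestronglyMeasurable]
  have e : ∀ x : Fin d → ℝ, hermiteMajorant R x ^ 2 =
      ∏ j, (Real.pi ^ (-(1 / 4) : ℝ) *
        Real.exp (-x j ^ 2 / 2 + √2 * R j * |x j| + R j ^ 2 / 2)) ^ 2 := fun x => by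
    rw [hermiteMajorant, Finset.prod_pow]
  simp_rw [e]
  refine Integrable.fintype_prod (f := fun j (t : ℝ) => (Real.pi ^ (-(1 / 4) : ℝ) *
    Real.exp (-t ^ 2 / 2 + √2 * R j * |t| + R j ^ 2 / 2)) ^ 2) fun j => ?_
  refine ((integrable_exp_neg_sq_add_abs (b := 1) one_pos (2 * √2 * R j)).const_mul
    ((Real.pi ^ (-(1 / 4) : ℝ)) ^ 2 * Real.exp (R j ^ 2))).congr
      (Filter.Eventually.of_forall fun t => ?_)
  simp only
  rw [mul_pow, mul_assoc, ← Real.exp_add, ← Real.exp_nat_mul]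
  push_cast
  ring_nf

theorem abs_hermite_le (α : Fin d → ℕ) (x : Fin d → ℝ) :
    |hermite α x| ≤ √(multiFactorial α : ℝ) * hermiteMajorant (fun _ => 1) x := by
  have h := abs_hermite_div_sqrt_le α x (Pos.const (d := d) one_pos)
  rw [div_le_iff₀ (sqrt_multiFactorial_pos α)] at h
  simpa [mpow, mul_comm] using h

theorem integrable_hermite (α : Fin d → ℕ) : Integrable (hermite α) :=
  ((integrable_hermiteMajorant fun _ => 1).const_mul √(multiFactorial α : ℝ)).mono'
    (continuous_hermite α).aestronglyMeasurable
    (Filter.Eventually.of_forall fun x => abs_hermite_le α x)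

theorem integrable_mul_hermite {f : (Fin d → ℝ) → ℂ} (hf : MemLp f 2) (α : Fin d → ℕ) :
    Integrable fun x => f x * (hermite α x : ℂ) := by
  have h : MemLp (fun x => (hermite α x : ℂ)) 2 :=
    ((memLp_hermiteMajorant fun _ => 1).const_mul √(multiFactorial α : ℝ)).mono'
      (Complex.continuous_ofReal.comp (continuous_hermite α)).aestronglyMeasurable
      (Filter.Eventually.of_forall fun x => by
        rw [Complex.norm_real]
        exact abs_hermite_le α x)
  exact hf.integrable_mul h

theorem hermiteCoeff_sub {f g : (Fin d → ℝ) → ℂ} (hf : MemLp f 2) (hg : MemLp g 2)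
    (α : Fin d → ℕ) : hermiteCoeff (f - g) α = hermiteCoeff f α - hermiteCoeff g α := by
  simp only [hermiteCoeff, Pi.sub_apply, sub_mul]
  exact integral_sub (integrable_mul_hermite hf α) (integrable_mul_hermite hg α)

theorem hermiteCoeff_congr {f g : (Fin d → ℝ) → ℂ} (h : f =ᵐ[volume] g) :
    hermiteCoeff f = hermiteCoeff g :=
  funext fun α => integral_congr_ae (h.mono fun x hx => by simp only [hx])

/-- Vanishing Hermite coefficients force the integrals against all `hermiteGen w` to vanish; this is
how completeness is reached. -/
theorem hasSum_hermiteCoeff {f : (Fin d → ℝ) → ℂ} (hf : MemLp f 2) (w : Fin d → ℂ) :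
    HasSum (fun α => hermiteCoeff f α * (mpow w α / (√(multiFactorial α : ℝ) : ℝ)))
      (∫ x, f x * hermiteGen w x) := by
  -- This radius makes `‖w_j‖/R_j ≤ 1/2`, so the terms have a summable geometric majorant.
  set R : Fin d → ℝ := fun j => 2 * ‖w j‖ + 1 with hR
  have hRp : Pos R := fun j => by positivity
  have hb : ∀ (α : Fin d → ℕ) (x : Fin d → ℝ),
      ‖f x * ((hermite α x : ℂ) * (mpow w α / (√(multiFactorial α : ℝ) : ℝ)))‖ ≤
        mpow (fun _ => (1 / 2 : ℝ)) α * (‖f x‖ * hermiteMajorant R x) := by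
    intro α x
    have h1 := abs_hermite_div_sqrt_le α x hRp
    have h2 : mpow (fun j => (R j)⁻¹) α * mpow (fun j => ‖w j‖) α ≤
        mpow (fun _ => (1 / 2 : ℝ)) α := by
      rw [← mul_mpow]
      refine mpow_le_mpow (fun j => mul_nonneg (inv_nonneg.2 (hRp j).le) (norm_nonneg _))
        (fun j => ?_) α
      change (R j)⁻¹ * ‖w j‖ ≤ 1 / 2
      rw [inv_mul_le_iff₀ (hRp j), hR]
      linarith [norm_nonneg (w j)]
    have h3 := hermiteMajorant_nonneg R x
    have h4 : 0 ≤ mpow (fun j => ‖w j‖) α :=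
      Finset.prod_nonneg fun j _ => pow_nonneg (norm_nonneg _) _
    rw [norm_mul, norm_mul, norm_div, Complex.norm_real, Complex.norm_real, norm_mpow,
      Real.norm_eq_abs, Real.norm_eq_abs, abs_of_pos (sqrt_multiFactorial_pos α)]
    calc _ = ‖f x‖ * (|hermite α x| / √(multiFactorial α : ℝ) * mpow (fun j => ‖w j‖) α) := by ring
      _ ≤ ‖f x‖ * ((mpow (fun j => (R j)⁻¹) α * hermiteMajorant R x) *
            mpow (fun j => ‖w j‖) α) := by gcongr
      _ = ‖f x‖ * hermiteMajorant R x *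
            (mpow (fun j => (R j)⁻¹) α * mpow (fun j => ‖w j‖) α) := by ring
      _ ≤ ‖f x‖ * hermiteMajorant R x * mpow (fun _ => (1 / 2 : ℝ)) α := by gcongr
      _ = _ := by ring
  have h := hasSum_integral_of_dominated_convergence (μ := volume)
    (F := fun (α : Fin d → ℕ) x =>
      f x * ((hermite α x : ℂ) * (mpow w α / (√(multiFactorial α : ℝ) : ℝ))))
    (f := fun x => f x * hermiteGen w x)
    (fun α x => mpow (fun _ => (1 / 2 : ℝ)) α * (‖f x‖ * hermiteMajorant R x))
    (fun α => hf.aestronglyMeasurable.mul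
      ((Complex.continuous_ofReal.comp (continuous_hermite α)).mul
        continuous_const).aestronglyMeasurable)
    (fun α => Filter.Eventually.of_forall (hb α))
    (Filter.Eventually.of_forall fun x => summable_mpow_half.mul_right _)
    (by
      simp_rw [tsum_mul_right]
      exact (hf.norm.integrable_mul (memLp_hermiteMajorant R)).const_mul _)
    (Filter.Eventually.of_forall fun x => (hasSum_hermite w x).mul_left _)
  refine (congrArg (HasSum · _) (funext fun α => ?_)).mpr h
  rw [hermiteCoeff, ← integral_mul_const]
  simp_rw [mul_assoc]

end hermite

/-! ### Uniqueness of Fourier transforms and completeness of the Hermite functions -/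

section fourier

variable {d : ℕ}

theorem dot_eq_of_strongDual (L : StrongDual ℝ (Fin d → ℝ)) (v : Fin d → ℝ) :
    L v = dot v fun j => L (Pi.single j 1) := by
  have h := LinearMap.pi_apply_eq_sum_univ L.toLinearMap v
  simp only [smul_eq_mul] at h
  rw [dot, ← ContinuousLinearMap.coe_coe, h]
  refine Finset.sum_congr rfl fun j _ => ?_
  congr 2
  ext i
  simp [Pi.single_apply, eq_comm]

theorem norm_cexp_I_mul_ofReal (a : ℝ) : ‖Complex.exp (Complex.I * a)‖ = 1 := by
  rw [mul_comm]
  exact Complex.norm_exp_ofReal_mul_I a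

theorem continuous_dot_left (ξ : Fin d → ℝ) : Continuous fun x : Fin d → ℝ => dot x ξ := by
  unfold dot
  fun_prop

theorem integrable_mul_character {h : (Fin d → ℝ) → ℂ} (hh : Integrable h) (ξ : Fin d → ℝ) :
    Integrable fun x => h x * Complex.exp (Complex.I * (dot x ξ : ℂ)) := by
  refine hh.mul_bdd (c := 1) ?_ (Filter.Eventually.of_forall fun x => ?_)
  · have := continuous_dot_left ξ
    exact Continuous.aestronglyMeasurable (by fun_prop)
  · exact (norm_cexp_I_mul_ofReal _).le

/-- The positive and negative parts of `u` are densities of finite measures with the same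
characteristic function, hence of the same measure. -/
theorem ae_eq_zero_of_real_fourier_eq_zero {u : (Fin d → ℝ) → ℝ} (hu : Integrable u)
    (h : ∀ ξ : Fin d → ℝ, ∫ x, (u x : ℂ) * Complex.exp (Complex.I * (dot x ξ : ℂ)) = 0) :
    u =ᵐ[volume] 0 := by
  set μ : Measure (Fin d → ℝ) := volume.withDensity fun x => ENNReal.ofReal (u x)
  set ν : Measure (Fin d → ℝ) := volume.withDensity fun x => ENNReal.ofReal ((-u) x)
  have : IsFiniteMeasure μ := isFiniteMeasure_withDensity_ofReal hu.2
  have : IsFiniteMeasure ν := isFiniteMeasure_withDensity_ofReal hu.neg.2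
  have hchar : ∀ (w : (Fin d → ℝ) → ℝ), Integrable w → ∀ L : StrongDual ℝ (Fin d → ℝ),
      charFunDual (volume.withDensity fun x => ENNReal.ofReal (w x)) L =
        ∫ x, ((max (w x) 0 : ℝ) : ℂ) *
          Complex.exp (Complex.I * (dot x fun j => L (Pi.single j 1) : ℝ)) := by
    intro w hw L
    rw [charFunDual_apply, integral_withDensity_eq_integral_toReal_smul₀
      hw.aestronglyMeasurable.aemeasurable.ennreal_ofReal
      (Filter.Eventually.of_forall fun x => ENNReal.ofReal_lt_top)]
    refine integral_congr_ae (Filter.Eventually.of_forall fun x => ?_)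
    simp only [ENNReal.toReal_ofReal', Complex.real_smul]
    rw [dot_eq_of_strongDual L x, mul_comm Complex.I]
  have hμν : μ = ν := by
    refine Measure.ext_of_charFunDual (funext fun L => ?_)
    have hp : ∀ w : (Fin d → ℝ) → ℝ, Integrable w →
        Integrable fun x => ((max (w x) 0 : ℝ) : ℂ) := fun w hw => hw.pos_part.ofReal
    have hs := integral_sub (integrable_mul_character (hp u hu) fun j => L (Pi.single j 1))
      (integrable_mul_character (hp (-u) hu.neg) fun j => L (Pi.single j 1))
    rw [hchar u hu L, hchar (-u) hu.neg L, ← sub_eq_zero, ← hs]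
    refine Eq.trans (integral_congr_ae (Filter.Eventually.of_forall fun x => ?_))
      (h fun j => L (Pi.single j 1))
    simp only [Pi.neg_apply]
    rw [← sub_mul, ← Complex.ofReal_sub]
    congr 2
    rcases le_total (u x) 0 with h0 | h0
    · rw [max_eq_right h0, max_eq_left (neg_nonneg.2 h0)]; ring
    · rw [max_eq_left h0, max_eq_right (neg_nonpos.2 h0)]; ring
  have hae := (withDensity_eq_iff hu.aestronglyMeasurable.aemeasurable.ennreal_ofReal
    hu.neg.aestronglyMeasurable.aemeasurable.ennreal_ofReal
    hu.lintegral_lt_top.ne).1 hμν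
  filter_upwards [hae] with x hx
  simp only [Pi.neg_apply] at hx
  rcases le_total (u x) 0 with h0 | h0
  · rw [ENNReal.ofReal_of_nonpos h0] at hx
    have := ENNReal.ofReal_eq_zero.1 hx.symm
    exact le_antisymm h0 (neg_nonpos.1 this)
  · rw [ENNReal.ofReal_of_nonpos (neg_nonpos.2 h0)] at hx
    exact le_antisymm (ENNReal.ofReal_eq_zero.1 hx) h0

/-- The transform of the conjugate of `h` is the conjugate of that of `h` at `-ξ`, so it vanishes
too, and so does that of the real part. -/
theorem re_ae_eq_zero_of_fourier_eq_zero {h : (Fin d → ℝ) → ℂ} (hh : Integrable h)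
    (h0 : ∀ ξ : Fin d → ℝ, ∫ x, h x * Complex.exp (Complex.I * (dot x ξ : ℂ)) = 0) :
    (fun x => (h x).re) =ᵐ[volume] 0 := by
  refine ae_eq_zero_of_real_fourier_eq_zero hh.re fun ξ => ?_
  have hc : ∫ x, (starRingEnd ℂ) (h x) * Complex.exp (Complex.I * (dot x ξ : ℂ)) = 0 := by
    rw [← map_zero (starRingEnd ℂ), ← h0 (-ξ), ← integral_conj]
    refine integral_congr_ae (Filter.Eventually.of_forall fun x => ?_)
    have e : dot x (-ξ) = -dot x ξ := by simp [dot]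
    simp only [map_mul, ← Complex.exp_conj, Complex.conj_I, Complex.conj_ofReal, e]
    push_cast
    ring_nf
  have hci : Integrable fun x => (starRingEnd ℂ) (h x) :=
    Complex.conjCLE.toContinuousLinearMap.integrable_comp hh
  have hs := integral_add (integrable_mul_character hh ξ) (integrable_mul_character hci ξ)
  rw [h0, hc, add_zero] at hs
  have e : ∀ x, h x * Complex.exp (Complex.I * (dot x ξ : ℂ)) +
      (starRingEnd ℂ) (h x) * Complex.exp (Complex.I * (dot x ξ : ℂ)) =
      2 * (((h x).re : ℂ) * Complex.exp (Complex.I * (dot x ξ : ℂ))) := fun x => by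
    rw [← add_mul, Complex.add_conj]
    push_cast
    ring
  simp_rw [e] at hs
  rw [integral_const_mul] at hs
  exact (mul_eq_zero.1 hs).resolve_left two_ne_zero

theorem ae_eq_zero_of_fourier_eq_zero {h : (Fin d → ℝ) → ℂ} (hh : Integrable h)
    (h0 : ∀ ξ : Fin d → ℝ, ∫ x, h x * Complex.exp (Complex.I * (dot x ξ : ℂ)) = 0) :
    h =ᵐ[volume] 0 := by
  have h1 := re_ae_eq_zero_of_fourier_eq_zero hh h0
  -- The real part of `-ih` is the imaginary part of `h`.
  have h2 := re_ae_eq_zero_of_fourier_eq_zero (hh.const_mul (-Complex.I)) fun ξ => by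
    simp_rw [mul_assoc]
    rw [integral_const_mul, h0, mul_zero]
  filter_upwards [h1, h2] with x hx1 hx2
  refine Complex.ext hx1 ?_
  simpa using hx2

theorem continuous_gaussian : Continuous (gaussian (d := d)) := by
  unfold gaussian dot
  fun_prop

theorem gaussian_eq_prod (x : Fin d → ℝ) :
    gaussian x = ∏ j, (Real.pi ^ (-(1 / 4) : ℝ) * Real.exp (-x j ^ 2 / 2)) := by
  rw [Finset.prod_mul_distrib, ← Real.exp_sum, Finset.prod_const, Finset.card_univ,
    Fintype.card_fin, ← Real.rpow_natCast, ← Real.rpow_mul Real.pi_pos.le, gaussian, dot]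
  congr 2
  · ring
  · rw [← Finset.sum_neg_distrib, Finset.sum_div]
    exact Finset.sum_congr rfl fun j _ => by ring

/-- The kernel of `V_φ^*` in terms of the generating function of the Hermite functions. -/
theorem gaussian_mul_character (x y η : Fin d → ℝ) :
    (gaussian (x - y) : ℂ) * Complex.exp (Complex.I * (dot x η : ℂ)) =
      hermiteGen (fun j => ((y j : ℂ) + Complex.I * η j) / (√2 : ℝ)) x *
        Complex.exp (Complex.I * (dot y η : ℂ) / 2 - ∑ j, ((y j : ℂ) ^ 2 + (η j : ℂ) ^ 2) / 4) := by
  have h2 : ((√2 : ℝ) : ℂ) * (√2 : ℝ) = 2 := by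
    rw [← Complex.ofReal_mul, Real.mul_self_sqrt zero_le_two]; norm_num
  have h20 : ((√2 : ℝ) : ℂ) ≠ 0 := by
    rw [Complex.ofReal_ne_zero]; positivity
  rw [gaussian_eq_prod, dot, dot, hermiteGen]
  push_cast
  rw [Finset.mul_sum, Finset.mul_sum, Finset.sum_div, ← Finset.sum_sub_distrib, Complex.exp_sum,
    Complex.exp_sum, ← Finset.prod_mul_distrib, ← Finset.prod_mul_distrib]
  refine Finset.prod_congr rfl fun j _ => ?_
  rw [hermiteGenOne, mul_assoc, mul_assoc, ← Complex.exp_add, ← Complex.exp_add]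
  congr 2
  set z : ℂ := (y j : ℂ) + Complex.I * η j with hz
  have e1 : ((√2 : ℝ) : ℂ) * x j * (z / (√2 : ℝ)) = x j * z := by field_simp
  have e2 : (z / ((√2 : ℝ) : ℂ)) ^ 2 = z ^ 2 / 2 := by rw [div_pow, pow_two ((√2 : ℝ) : ℂ), h2]
  rw [e1, e2, hz]
  push_cast [Pi.sub_apply]
  linear_combination ((η j : ℂ) ^ 2 / 4) * Complex.I_sq

theorem gaussian_nonneg (x : Fin d → ℝ) : 0 ≤ gaussian x :=
  mul_nonneg (Real.rpow_nonneg Real.pi_pos.le _) (Real.exp_pos _).le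

theorem gaussian_le (x : Fin d → ℝ) : gaussian x ≤ Real.pi ^ (-(d : ℝ) / 4) := by
  have h0 : 0 ≤ dot x x := Finset.sum_nonneg fun j _ => mul_self_nonneg _
  exact mul_le_of_le_one_right (Real.rpow_nonneg Real.pi_pos.le _)
    (Real.exp_le_one_iff.2 (by linarith))

theorem gaussian_eq_hermiteMajorant (x : Fin d → ℝ) : gaussian x = hermiteMajorant 0 x := by
  rw [gaussian_eq_prod, hermiteMajorant]
  simp

/-- Completeness of the Hermite functions. -/
theorem ae_eq_zero_of_hermiteCoeff_eq_zero {f : (Fin d → ℝ) → ℂ} (hf : MemLp f 2)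
    (h : hermiteCoeff f = 0) : f =ᵐ[volume] 0 := by
  have hgen : ∀ w : Fin d → ℂ, ∫ x, f x * hermiteGen w x = 0 := fun w => by
    have h1 := hasSum_hermiteCoeff hf w
    simp only [h, Pi.zero_apply, zero_mul] at h1
    exact h1.unique hasSum_zero
  have hg : MemLp (fun x : Fin d → ℝ => (gaussian x : ℂ)) 2 := by
    have : MemLp (gaussian (d := d)) 2 := by
      rw [funext gaussian_eq_hermiteMajorant]
      exact memLp_hermiteMajorant 0
    exact this.ofReal
  -- At `y = 0` the generating function is a constant multiple of a Gaussian times a character, so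
  -- the Fourier transform of `f φ` vanishes; `φ` has no zeros.
  have h0 := ae_eq_zero_of_fourier_eq_zero (hf.integrable_mul hg) fun ξ => by
    have h1 := hgen fun j => (((0 : Fin d → ℝ) j : ℂ) + Complex.I * ξ j) / (√2 : ℝ)
    have h2 := fun x => gaussian_mul_character x 0 ξ
    have h3 := congrArg (· * Complex.exp (Complex.I * (dot 0 ξ : ℂ) / 2 -
      ∑ j, (((0 : Fin d → ℝ) j : ℂ) ^ 2 + (ξ j : ℂ) ^ 2) / 4)) h1
    simp only [zero_mul] at h3
    rw [← integral_mul_const] at h3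
    refine Eq.trans (integral_congr_ae (Filter.Eventually.of_forall fun x => ?_)) h3
    have h4 := h2 x
    rw [sub_zero] at h4
    simp only [Pi.mul_apply]
    rw [mul_assoc, h4, mul_assoc]
  filter_upwards [h0] with x hx
  have hx' : f x * (gaussian x : ℂ) = 0 := hx
  refine (mul_eq_zero.1 hx').resolve_right ?_
  refine Complex.ofReal_ne_zero.2 ?_
  exact (mul_pos (Real.rpow_pos_of_pos Real.pi_pos _) (Real.exp_pos _)).ne'

end fourier

/-! ### The adjoint of the short-time Fourier transform -/

section stft

variable {d : ℕ}

/-- The factor `√(2^{|α|} α!)`. -/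
def hermiteScale (α : Fin d → ℕ) : ℝ := mpow (fun _ => √2) α * √(multiFactorial α : ℝ)

theorem hermiteScale_pos (α : Fin d → ℕ) : 0 < hermiteScale α :=
  mul_pos (mpow_pos (Pos.const (by positivity)) α) (sqrt_multiFactorial_pos α)

theorem aestronglyMeasurable_stftAdjoint_kernel {F : (Fin d → ℝ) × (Fin d → ℝ) → ℂ}
    (hF : AEStronglyMeasurable F volume) :
    AEStronglyMeasurable (fun q : ((Fin d → ℝ) × (Fin d → ℝ)) × (Fin d → ℝ) =>
      F q.1 * (gaussian (q.2 - q.1.1) : ℂ) * Complex.exp (Complex.I * (dot q.2 q.1.2 : ℂ)))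
      (volume.prod volume) := by
  have h1 : Continuous fun q : ((Fin d → ℝ) × (Fin d → ℝ)) × (Fin d → ℝ) =>
      (gaussian (q.2 - q.1.1) : ℂ) := by
    have := continuous_gaussian (d := d)
    fun_prop
  have h2 : Continuous fun q : ((Fin d → ℝ) × (Fin d → ℝ)) × (Fin d → ℝ) =>
      Complex.exp (Complex.I * (dot q.2 q.1.2 : ℂ)) := by
    unfold dot
    fun_prop
  exact (hF.comp_fst.mul h1.aestronglyMeasurable).mul h2.aestronglyMeasurable

/-- By Fubini the function is integrable, and it is bounded by `π^{-d/4} ‖F‖₁`; an integrable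
bounded function is square integrable. -/
theorem memLp_stftAdjoint {F : (Fin d → ℝ) × (Fin d → ℝ) → ℂ} (hF : Integrable F) :
    MemLp (stftAdjoint F) 2 := by
  have hn : ∀ (x : Fin d → ℝ) (p : (Fin d → ℝ) × (Fin d → ℝ)),
      ‖F p * (gaussian (x - p.1) : ℂ) * Complex.exp (Complex.I * (dot x p.2 : ℂ))‖ =
        ‖F p‖ * gaussian (x - p.1) := fun x p => by
    rw [norm_mul, norm_mul, norm_cexp_I_mul_ofReal, mul_one, Complex.norm_real, Real.norm_eq_abs,
      abs_of_nonneg (gaussian_nonneg _)]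
  have hg : Integrable (gaussian (d := d)) := by
    rw [funext gaussian_eq_hermiteMajorant]
    exact integrable_hermiteMajorant 0
  have hj : Integrable (fun q : ((Fin d → ℝ) × (Fin d → ℝ)) × (Fin d → ℝ) =>
      F q.1 * (gaussian (q.2 - q.1.1) : ℂ) * Complex.exp (Complex.I * (dot q.2 q.1.2 : ℂ)))
      (volume.prod volume) := by
    have hm := aestronglyMeasurable_stftAdjoint_kernel hF.1
    rw [integrable_prod_iff hm]
    constructor
    · have hm' : ∀ p : (Fin d → ℝ) × (Fin d → ℝ), AEStronglyMeasurable (fun x : Fin d → ℝ =>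
          F p * (gaussian (x - p.1) : ℂ) * Complex.exp (Complex.I * (dot x p.2 : ℂ))) volume := by
        intro p
        have := continuous_gaussian (d := d)
        have := continuous_dot_left p.2
        exact Continuous.aestronglyMeasurable (by fun_prop)
      refine Filter.Eventually.of_forall fun p => ?_
      refine (integrable_norm_iff (hm' p)).1 ?_
      simp only [hn]
      exact (hg.comp_sub_right p.1).const_mul _
    · simp only [hn]
      simp_rw [integral_const_mul]
      have e : ∀ p : (Fin d → ℝ) × (Fin d → ℝ), ∫ x, gaussian (x - p.1) = ∫ x, gaussian (d := d) x :=
        fun p => integral_sub_right_eq_self gaussian p.1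
      simp_rw [e]
      exact hF.norm.mul_const _
  have hi : Integrable (stftAdjoint F) := hj.integral_prod_right
  rw [memLp_two_iff_integrable_sq_norm hi.1]
  refine (hi.norm.const_mul ((∫ p, ‖F p‖) * Real.pi ^ (-(d : ℝ) / 4))).mono' (hi.1.norm.pow 2)
    (Filter.Eventually.of_forall fun x => ?_)
  rw [Real.norm_eq_abs, abs_of_nonneg (sq_nonneg _), pow_two]
  refine mul_le_mul_of_nonneg_right ?_ (norm_nonneg _)
  rw [← integral_mul_const]
  refine norm_integral_le_of_norm_le (hF.norm.mul_const _) (Filter.Eventually.of_forall fun p => ?_)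
  rw [hn]
  exact mul_le_mul_of_nonneg_left (gaussian_le _) (norm_nonneg _)

/-- After Fubini, the inner integral pairs `h_α` with the generating function at `z/√2` and equals
`(z/√2)^α/√α!`; `hermiteScale` clears exactly these constants. -/
theorem hermiteCoeff_stftAdjoint {F : (Fin d → ℝ) × (Fin d → ℝ) → ℂ} (hF : Integrable F)
    (α : Fin d → ℕ) :
    hermiteScale α * hermiteCoeff (stftAdjoint F) α =
      ∫ p, F p * Complex.exp (Complex.I * (dot p.1 p.2 : ℂ) / 2 -
        ∑ j, ((p.1 j : ℂ) ^ 2 + (p.2 j : ℂ) ^ 2) / 4) *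
        mpow (fun j => (p.1 j : ℂ) + Complex.I * p.2 j) α := by
  have hint : Integrable (fun q : ((Fin d → ℝ) × (Fin d → ℝ)) × (Fin d → ℝ) =>
      (F q.1 * (hermite α q.2 : ℂ)) *
        ((gaussian (q.2 - q.1.1) : ℂ) * Complex.exp (Complex.I * (dot q.2 q.1.2 : ℂ))))
      (volume.prod volume) := by
    refine Integrable.mul_bdd (c := Real.pi ^ (-(d : ℝ) / 4)) ?_ ?_
      (Filter.Eventually.of_forall fun q => ?_)
    · exact hF.mul_prod (integrable_hermite α).ofReal
    · have := continuous_gaussian (d := d)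
      refine Continuous.aestronglyMeasurable ?_
      unfold dot
      fun_prop
    · rw [norm_mul, norm_cexp_I_mul_ofReal, mul_one, Complex.norm_real, Real.norm_eq_abs,
        abs_of_nonneg (gaussian_nonneg _)]
      exact gaussian_le _
  have h1 : hermiteCoeff (stftAdjoint F) α = ∫ x, ∫ p, (F p * (hermite α x : ℂ)) *
      ((gaussian (x - p.1) : ℂ) * Complex.exp (Complex.I * (dot x p.2 : ℂ))) := by
    rw [hermiteCoeff]
    refine integral_congr_ae (Filter.Eventually.of_forall fun x => ?_)
    simp only [stftAdjoint]
    rw [← integral_mul_const]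
    refine integral_congr_ae (Filter.Eventually.of_forall fun p => ?_)
    simp only
    ring
  rw [h1, ← integral_integral_swap hint, ← integral_const_mul]
  refine integral_congr_ae (Filter.Eventually.of_forall fun p => ?_)
  have e : ∀ x : Fin d → ℝ, (F p * (hermite α x : ℂ)) *
      ((gaussian (x - p.1) : ℂ) * Complex.exp (Complex.I * (dot x p.2 : ℂ))) =
      (F p * Complex.exp (Complex.I * (dot p.1 p.2 : ℂ) / 2 -
        ∑ j, ((p.1 j : ℂ) ^ 2 + (p.2 j : ℂ) ^ 2) / 4)) * ((hermite α x : ℂ) *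
        hermiteGen (fun j => ((p.1 j : ℂ) + Complex.I * p.2 j) / (√2 : ℝ)) x) := fun x => by
    rw [gaussian_mul_character]
    ring
  simp only [e]
  rw [integral_const_mul, integral_hermite_mul_gen, mul_left_comm]
  congr 1
  have h20 : (√2 : ℝ) ≠ 0 := by positivity
  have e2 : mpow (fun j => (p.1 j : ℂ) + Complex.I * p.2 j) α = mpow (fun _ => ((√2 : ℝ) : ℂ)) α *
      mpow (fun j => ((p.1 j : ℂ) + Complex.I * p.2 j) / (√2 : ℝ)) α := by
    rw [← mul_mpow]
    congr 1
    ext j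
    rw [Pi.mul_apply, mul_div_cancel₀]
    exact_mod_cast h20
  have hs : ((√(multiFactorial α : ℝ) : ℝ) : ℂ) ≠ 0 := by
    exact_mod_cast (sqrt_multiFactorial_pos α).ne'
  rw [e2, hermiteScale, Complex.ofReal_mul, ← mpow_ofReal]
  field_simp

end stft

/-! ### Measure theoretic preliminaries on `ℂᵈ` -/

section prelim

variable {d : ℕ}

theorem integrable_of_memLp_top {X E : Type*} [MeasurableSpace X] [NormedAddCommGroup E]
    {μ : Measure X} {f : X → E} (hf : MemLp f ∞ μ) {s : Set X}
    (hμ : μ s ≠ ∞) (h0 : ∀ᵐ x ∂μ, x ∉ s → f x = 0) : Integrable f μ := by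
  have : IsFiniteMeasure (μ.restrict s) := ⟨by simpa using hμ.lt_top⟩
  have h1 : IntegrableOn f s μ :=
    memLp_one_iff_integrable.1 ((hf.mono_measure Measure.restrict_le_self).mono_exponent le_top)
  exact h1.integrable_of_ae_notMem_eq_zero h0

theorem IsBoundedCompact.integrable {F : (Fin d → ℝ) × (Fin d → ℝ) → ℂ}
    (hF : IsBoundedCompact F) : Integrable F := by
  obtain ⟨h1, K, hK, h2⟩ := hF
  exact integrable_of_memLp_top h1 hK.measure_lt_top.ne h2

/-- The identification of `ℝᵈ × ℝᵈ` with `ℂᵈ`. -/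
def complexEquiv (d : ℕ) : (Fin d → ℝ) × (Fin d → ℝ) ≃ᵐ (Fin d → ℂ) :=
  (MeasurableEquiv.arrowProdEquivProdArrow ℝ ℝ (Fin d)).symm.trans
    (MeasurableEquiv.piCongrRight fun _ => Complex.measurableEquivRealProd.symm)

theorem complexEquiv_apply (p : (Fin d → ℝ) × (Fin d → ℝ)) (j : Fin d) :
    complexEquiv d p j = (p.1 j : ℂ) + Complex.I * p.2 j := by
  have h : complexEquiv d p j = ⟨p.1 j, p.2 j⟩ := rfl
  rw [h]
  refine Complex.ext ?_ ?_ <;> simp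

theorem measurePreserving_complexEquiv : MeasurePreserving (complexEquiv d) :=
  (volume_preserving_pi fun _ => Complex.volume_preserving_equiv_real_prod.symm).comp
    (volume_measurePreserving_arrowProdEquivProdArrow ℝ ℝ (Fin d)).symm

theorem integral_comp_complexEquiv (G : (Fin d → ℂ) → ℂ) :
    ∫ p, G (complexEquiv d p) = ∫ z, G z :=
  measurePreserving_complexEquiv.integral_comp (complexEquiv d).measurableEmbedding G

theorem measurePreserving_mul_circle (u : Fin d → Circle) :
    MeasurePreserving fun (z : Fin d → ℂ) j => (u j : ℂ) * z j :=
  volume_preserving_pi fun j => (rotation (u j)).measurePreserving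

theorem measurable_of_hasSum {a : (Fin d → ℕ) → ℂ} {A : (Fin d → ℂ) → ℂ}
    (hA : ∀ z, HasSum (fun α => a α * mpow z α) (A z)) : Measurable A := by
  refine measurable_of_tendsto_metrizable' Filter.atTop
    (f := fun (s : Finset (Fin d → ℕ)) z => ∑ α ∈ s, a α * mpow z α) (fun s => ?_)
    (tendsto_pi_nhds.2 hA)
  unfold mpow
  fun_prop

theorem measurable_mpow (α : Fin d → ℕ) : Measurable fun z : Fin d → ℂ => mpow z α := by
  unfold mpow
  fun_prop

theorem norm_mpow_le {t : Fin d → ℝ} {z : Fin d → ℂ} (hz : ∀ j, ‖z j‖ ≤ t j) (α : Fin d → ℕ) :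
    ‖mpow z α‖ ≤ mpow t α := by
  rw [norm_mpow]
  exact mpow_le_mpow (fun _ => norm_nonneg _) hz α

theorem summable_norm_mul_mpow {a : (Fin d → ℕ) → ℂ} {A : (Fin d → ℂ) → ℂ}
    (hA : ∀ z, HasSum (fun α => a α * mpow z α) (A z)) {t : Fin d → ℝ} (ht : Pos t) :
    Summable fun α => ‖a α‖ * mpow t α := by
  refine (hA fun j => (t j : ℂ)).summable.norm.congr fun α => ?_
  rw [norm_mul, norm_mpow]
  congr 2
  ext j
  rw [Complex.norm_real, Real.norm_eq_abs, abs_of_pos (ht j)]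

theorem norm_le_of_hasSum {a : (Fin d → ℕ) → ℂ} {A : (Fin d → ℂ) → ℂ}
    (hA : ∀ z, HasSum (fun α => a α * mpow z α) (A z)) {t : Fin d → ℝ} (ht : Pos t)
    {z : Fin d → ℂ} (hz : ∀ j, ‖z j‖ ≤ t j) : ‖A z‖ ≤ ∑' α, ‖a α‖ * mpow t α := by
  rw [← (hA z).tsum_eq]
  refine tsum_of_norm_bounded (summable_norm_mul_mpow hA ht).hasSum fun α => ?_
  rw [norm_mul]
  exact mul_le_mul_of_nonneg_left (norm_mpow_le hz α) (norm_nonneg _)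

/-- Coordinatewise complex conjugation. -/
def conjVec (z : Fin d → ℂ) (j : Fin d) : ℂ := (starRingEnd ℂ) (z j)

theorem norm_conjVec (z : Fin d → ℂ) (j : Fin d) : ‖conjVec z j‖ = ‖z j‖ := by
  simp [conjVec]

theorem measurable_conjVec : Measurable (conjVec (d := d)) := by
  refine Continuous.measurable ?_
  unfold conjVec
  fun_prop

theorem mpow_conjVec_mul_self (z : Fin d → ℂ) (α : Fin d → ℕ) :
    mpow (conjVec z) α * mpow z α = ((mpow (fun j => ‖z j‖ ^ 2) α : ℝ) : ℂ) := by
  rw [← mul_mpow, ← mpow_ofReal]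
  congr 1
  ext j
  simp only [Pi.mul_apply, conjVec]
  rw [Complex.conj_mul']
  push_cast
  rfl

end prelim

/-! ### Moments of polyradial weights -/

section moments

variable {d : ℕ}

/-- Integrable polyradial functions supported in a polydisc. -/
structure IsPolyradial (ω : (Fin d → ℂ) → ℝ) (t : Fin d → ℝ) : Prop where
  pos : Pos t
  integrable : Integrable ω
  support : ∀ᵐ z : Fin d → ℂ, ¬ (∀ j, ‖z j‖ ≤ t j) → ω z = 0
  radial : ∃ ω₀ : (Fin d → ℝ) → ℝ, ∀ᵐ z, ω z = ω₀ (fun j => ‖z j‖)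

/-- The moment `∫ |z^α|² ω(z) dz`. -/
def radialMoment (ω : (Fin d → ℂ) → ℝ) (α : Fin d → ℕ) : ℝ :=
  ∫ z, ω z * mpow (fun j => ‖z j‖ ^ 2) α

/-- Rotating one coordinate in which `α` and `β` differ preserves Lebesgue measure and `ω` but
reverses the sign of the integrand. -/
theorem IsPolyradial.integral_mpow_of_ne {ω : (Fin d → ℂ) → ℝ} {t : Fin d → ℝ}
    (hω : IsPolyradial ω t) {α β : Fin d → ℕ} (h : α ≠ β) :
    ∫ z, (ω z : ℂ) * (mpow (conjVec z) α * mpow z β) = 0 := by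
  obtain ⟨j, hj⟩ := Function.ne_iff.1 h
  obtain ⟨ω₀, hω₀⟩ := hω.radial
  -- The angle is chosen so that `e^{ix(β_j - α_j)} = -1`.
  set x : ℝ := Real.pi / ((β j : ℝ) - α j) with hx
  set u : Fin d → Circle := fun i => if i = j then Circle.exp x else 1 with hu
  set k : (Fin d → ℂ) → ℂ := fun z => (ω z : ℂ) * (mpow (conjVec z) α * mpow z β) with hk
  have hmp := measurePreserving_mul_circle u
  have hemb : MeasurableEmbedding fun (z : Fin d → ℂ) i => (u i : ℂ) * z i :=
    (MeasurableEquiv.piCongrRight fun i =>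
      (rotation (u i)).toHomeomorph.toMeasurableEquiv).measurableEmbedding
  have h1 : ∫ z : Fin d → ℂ, k (fun i => (u i : ℂ) * z i) = ∫ z, k z :=
    hmp.integral_comp hemb k
  have hne : (β j : ℂ) - α j ≠ 0 := by
    rw [sub_ne_zero]
    exact_mod_cast hj.symm
  have hfac : mpow (conjVec fun i => (u i : ℂ)) α * mpow (fun i => (u i : ℂ)) β = -1 := by
    rw [mpow, mpow, ← Finset.prod_mul_distrib, Finset.prod_eq_single j]
    · simp only [hu, conjVec, if_true, Circle.coe_exp, ← Complex.exp_conj, ← Complex.exp_nat_mul,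
        ← Complex.exp_add]
      rw [← Complex.exp_pi_mul_I]
      congr 1
      simp only [map_mul, Complex.conj_I, Complex.conj_ofReal, hx]
      push_cast
      field_simp
      ring
    · intro i _ hi
      simp [hu, conjVec, hi]
    · simp
  have hrot : ∀ᵐ z : Fin d → ℂ, k (fun i => (u i : ℂ) * z i) = -k z := by
    filter_upwards [hω₀, hmp.quasiMeasurePreserving.ae hω₀] with z hz1 hz2
    have e1 : ω (fun i => (u i : ℂ) * z i) = ω z := by
      rw [hz1, hz2]
      simp only [norm_mul, Circle.norm_coe, one_mul]
    have e2 : conjVec (fun i => (u i : ℂ) * z i) = conjVec (fun i => (u i : ℂ)) * conjVec z := by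
      ext i
      simp [conjVec]
    have e3 : (fun i => (u i : ℂ) * z i) = (fun i => (u i : ℂ)) * z := rfl
    simp only [hk]
    rw [e1, e2, e3, mul_mpow, mul_mpow]
    linear_combination (ω z : ℂ) * (mpow (conjVec z) α * mpow z β) * hfac
  rw [integral_congr_ae hrot, integral_neg] at h1
  have h2 : (2 : ℂ) * ∫ z, k z = 0 := by linear_combination -h1
  exact (mul_eq_zero.1 h2).resolve_left two_ne_zero

theorem integral_mpow_self (ω : (Fin d → ℂ) → ℝ) (α : Fin d → ℕ) :
    ∫ z, (ω z : ℂ) * (mpow (conjVec z) α * mpow z α) = radialMoment ω α := by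
  rw [radialMoment, ← integral_complex_ofReal]
  refine integral_congr_ae (Filter.Eventually.of_forall fun z => ?_)
  simp only [mpow_conjVec_mul_self, Complex.ofReal_mul]

theorem IsPolyradial.hasSum_integral_mul {ω : (Fin d → ℂ) → ℝ} {t : Fin d → ℝ}
    (hω : IsPolyradial ω t) {ι : Type*} [Countable ι] {f : ι → (Fin d → ℂ) → ℂ}
    {g : (Fin d → ℂ) → ℂ} (hf : ∀ i, Measurable (f i)) {b : ι → ℝ} (hb : Summable b)
    (hfb : ∀ i z, (∀ j, ‖z j‖ ≤ t j) → ‖f i z‖ ≤ b i) (hg : ∀ z, HasSum (fun i => f i z) (g z)) :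
    HasSum (fun i => ∫ z, (ω z : ℂ) * f i z) (∫ z, (ω z : ℂ) * g z) := by
  refine hasSum_integral_of_dominated_convergence (fun i z => b i * ‖ω z‖)
    (fun i => hω.integrable.ofReal.1.mul (hf i).aestronglyMeasurable) (fun i => ?_)
    (Filter.Eventually.of_forall fun z => hb.mul_right _) ?_
    (Filter.Eventually.of_forall fun z => (hg z).mul_left _)
  · filter_upwards [hω.support] with z hz
    by_cases h : ∀ j, ‖z j‖ ≤ t j
    · rw [norm_mul, Complex.norm_real, mul_comm]
      exact mul_le_mul_of_nonneg_right (hfb i z h) (norm_nonneg _)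
    · simp [hz h]
  · simp_rw [tsum_mul_right]
    exact hω.integrable.norm.const_mul _

/-- The moments of `A(z̄)` with respect to a polyradial weight are multiples of the Taylor
coefficients of `A`. -/
theorem IsPolyradial.integral_series {ω : (Fin d → ℂ) → ℝ} {t : Fin d → ℝ}
    (hω : IsPolyradial ω t) {a : (Fin d → ℕ) → ℂ} {A : (Fin d → ℂ) → ℂ}
    (hA : ∀ z, HasSum (fun α => a α * mpow z α) (A z)) (β : Fin d → ℕ) :
    ∫ z, (ω z : ℂ) * (A (conjVec z) * mpow z β) = a β * radialMoment ω β := by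
  have h := hω.hasSum_integral_mul (f := fun α z => a α * mpow (conjVec z) α * mpow z β)
    (g := fun z => A (conjVec z) * mpow z β)
    (fun α => (((measurable_mpow α).comp measurable_conjVec).const_mul _).mul (measurable_mpow β))
    ((summable_norm_mul_mpow hA hω.pos).mul_right (mpow t β))
    (fun α z hz => by
      have h1 := norm_mpow_le hz β
      have h2 := norm_mpow_le (z := conjVec z) (fun j => (norm_conjVec z j).trans_le (hz j)) α
      have h3 := mpow_pos hω.pos α
      rw [norm_mul, norm_mul]
      gcongr)
    (fun z => (hA (conjVec z)).mul_right _)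
  have e : ∀ α, ∫ z, (ω z : ℂ) * (a α * mpow (conjVec z) α * mpow z β) =
      a α * ∫ z, (ω z : ℂ) * (mpow (conjVec z) α * mpow z β) := fun α => by
    rw [← integral_const_mul]
    refine integral_congr_ae (Filter.Eventually.of_forall fun z => ?_)
    simp only
    ring
  simp only [e] at h
  rw [← integral_mpow_self]
  refine h.unique (hasSum_single β fun α hα => ?_)
  rw [hω.integral_mpow_of_ne hα, mul_zero]

/-- Only `E` is expanded; each term is then a moment of `A(z̄)` at `β + δ`, and this shift is what
produces the transpose. -/
theorem IsPolyradial.integral_series_mul {ω : (Fin d → ℂ) → ℝ} {t : Fin d → ℝ}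
    (hω : IsPolyradial ω t) {a e : (Fin d → ℕ) → ℂ} {A E : (Fin d → ℂ) → ℂ}
    (hA : ∀ z, HasSum (fun α => a α * mpow z α) (A z))
    (hE : ∀ z, HasSum (fun α => e α * mpow z α) (E z)) (β : Fin d → ℕ) :
    ∫ z, (ω z : ℂ) * (A (conjVec z) * (E z * mpow z β)) =
      coshift e (fun α => a α * radialMoment ω α) β := by
  set M : ℝ := ∑' α, ‖a α‖ * mpow t α with hM
  have hAm : Measurable fun z => A (conjVec z) := (measurable_of_hasSum hA).comp measurable_conjVec
  have h := hω.hasSum_integral_mul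
    (f := fun δ z => A (conjVec z) * (e δ * mpow z δ * mpow z β))
    (g := fun z => A (conjVec z) * (E z * mpow z β))
    (fun δ => hAm.mul (((measurable_mpow δ).const_mul _).mul (measurable_mpow β)))
    (((summable_norm_mul_mpow hE hω.pos).mul_right (mpow t β)).mul_left M)
    (fun δ z hz => by
      have h1 := norm_mpow_le hz β
      have h2 := norm_mpow_le hz δ
      have h3 := mpow_pos hω.pos δ
      have h4 := norm_le_of_hasSum hA hω.pos (z := conjVec z)
        (fun j => (norm_conjVec z j).trans_le (hz j))
      have h5 : 0 ≤ M := (norm_nonneg _).trans h4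
      rw [norm_mul, norm_mul, norm_mul]
      gcongr)
    (fun z => ((hE z).mul_right _).mul_left _)
  rw [← h.tsum_eq, coshift]
  refine tsum_congr fun δ => ?_
  rw [← hω.integral_series hA (β + δ), ← integral_const_mul]
  refine integral_congr_ae (Filter.Eventually.of_forall fun z => ?_)
  simp only [mpow_add]
  ring

theorem IsPolyradial.norm_radialMoment_le {ω : (Fin d → ℂ) → ℝ} {t : Fin d → ℝ}
    (hω : IsPolyradial ω t) (α : Fin d → ℕ) :
    ‖radialMoment ω α‖ ≤ (∫ z, ‖ω z‖) * mpow (t * t) α := by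
  rw [← integral_mul_const]
  refine norm_integral_le_of_norm_le (hω.integrable.norm.mul_const _) ?_
  filter_upwards [hω.support] with z hz
  by_cases h : ∀ j, ‖z j‖ ≤ t j
  · have h1 : mpow (fun j => ‖z j‖ ^ 2) α ≤ mpow (t * t) α :=
      mpow_le_mpow (fun j => sq_nonneg _) (fun j => by
        rw [pow_two]
        exact mul_self_le_mul_self (norm_nonneg _) (h j)) α
    have h0 : 0 ≤ mpow (fun j => ‖z j‖ ^ 2) α := Finset.prod_nonneg fun j _ => by positivity
    rw [norm_mul, Real.norm_eq_abs (mpow _ _), abs_of_nonneg h0]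
    exact mul_le_mul_of_nonneg_left h1 (norm_nonneg _)
  · simp [hz h]

theorem IsPolyradial.integrable_mul_mpow {ω : (Fin d → ℂ) → ℝ} {t : Fin d → ℝ}
    (hω : IsPolyradial ω t) (α : Fin d → ℕ) :
    Integrable fun z => ω z * mpow (fun j => ‖z j‖ ^ 2) α := by
  refine (hω.integrable.norm.mul_const (mpow (t * t) α)).mono'
    (hω.integrable.1.mul (Continuous.aestronglyMeasurable ?_)) ?_
  · unfold mpow
    fun_prop
  filter_upwards [hω.support] with z hz
  by_cases h : ∀ j, ‖z j‖ ≤ t j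
  · have h1 : mpow (fun j => ‖z j‖ ^ 2) α ≤ mpow (t * t) α :=
      mpow_le_mpow (fun j => sq_nonneg _) (fun j => by
        rw [pow_two]
        exact mul_self_le_mul_self (norm_nonneg _) (h j)) α
    have h0 : 0 ≤ mpow (fun j => ‖z j‖ ^ 2) α := Finset.prod_nonneg fun j _ => by positivity
    rw [norm_mul, Real.norm_eq_abs (mpow _ _), abs_of_nonneg h0]
    exact mul_le_mul_of_nonneg_left h1 (norm_nonneg _)
  · simp [hz h]

/-- The part of the integral over the shell `t₁/2 < |z_j| < t₁` already suffices. With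
`norm_radialMoment_le` this places the moments between two geometric sequences. -/
theorem IsPolyradial.exists_le_radialMoment {ω : (Fin d → ℂ) → ℝ} {t t₁ : Fin d → ℝ}
    (hω : IsPolyradial ω t) (h0 : ∀ᵐ z, 0 ≤ ω z) (ht₁ : Pos t₁) {c : ℝ} (hc : 0 < c)
    (hωc : ∀ᵐ z : Fin d → ℂ, (∀ j, ‖z j‖ < t₁ j) → c ≤ ω z) :
    ∃ C : ℝ, 0 < C ∧ ∀ α, C * mpow (fun j => (t₁ j / 2) ^ 2) α ≤ radialMoment ω α := by
  set S : Set (Fin d → ℂ) := Set.univ.pi fun j => {w : ℂ | t₁ j / 2 < ‖w‖ ∧ ‖w‖ < t₁ j} with hS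
  have hopen : IsOpen S := isOpen_set_pi Set.finite_univ fun j _ =>
    (isOpen_lt continuous_const continuous_norm).inter (isOpen_lt continuous_norm continuous_const)
  have hne : S.Nonempty := ⟨fun j => ((3 / 4 * t₁ j : ℝ) : ℂ), fun j _ => by
    have := ht₁ j
    rw [Set.mem_ofPred_eq, Complex.norm_real, Real.norm_eq_abs, abs_of_pos (by positivity)]
    constructor <;> linarith⟩
  have hsub : S ⊆ Set.univ.pi fun j => Metric.closedBall (0 : ℂ) (t₁ j) := fun z hz j hj => by
    have := (hz j hj).2
    simpa using this.le
  have hfin : volume S ≠ ∞ :=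
    ((measure_mono hsub).trans_lt
      (isCompact_univ_pi fun j => isCompact_closedBall (0 : ℂ) (t₁ j)).measure_lt_top).ne
  have hpos : 0 < volume.real S := ENNReal.toReal_pos (hopen.measure_pos volume hne).ne' hfin
  refine ⟨c * volume.real S, mul_pos hc hpos, fun α => ?_⟩
  have h1 : ∫ z, S.indicator (fun _ => c * mpow (fun j => (t₁ j / 2) ^ 2) α) z ≤
      radialMoment ω α := by
    refine integral_mono_ae ?_ (hω.integrable_mul_mpow α) ?_
    · exact (integrable_indicator_iff hopen.measurableSet).2 (integrableOn_const hfin)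
    · filter_upwards [h0, hωc] with z hz0 hzc
      have hm : 0 ≤ mpow (fun j => ‖z j‖ ^ 2) α := Finset.prod_nonneg fun j _ => by positivity
      by_cases hz : z ∈ S
      · rw [Set.indicator_of_mem hz]
        have hz' : ∀ j, t₁ j / 2 < ‖z j‖ ∧ ‖z j‖ < t₁ j := fun j => hz j (Set.mem_univ j)
        refine mul_le_mul (hzc fun j => (hz' j).2) ?_ ?_ hz0
        · refine mpow_le_mpow (fun j => by positivity) (fun j => ?_) α
          have := ht₁ j
          have h2 := (hz' j).1.le
          gcongr
        · exact Finset.prod_nonneg fun j _ => by positivity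
      · rw [Set.indicator_of_notMem hz]
        exact mul_nonneg hz0 hm
  rw [integral_indicator hopen.measurableSet, setIntegral_const, smul_eq_mul] at h1
  linarith

end moments

/-! ### Uniqueness of Taylor coefficients -/

section uniqueness

variable {d : ℕ}

/-- Integrating `A(z̄) z^β` over the unit polydisc gives the `β`-th coefficient times a nonzero
moment. -/
theorem coeff_unique {a b : (Fin d → ℕ) → ℂ} {A : (Fin d → ℂ) → ℂ}
    (ha : ∀ z, HasSum (fun α => a α * mpow z α) (A z))
    (hb : ∀ z, HasSum (fun α => b α * mpow z α) (A z)) : a = b := by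
  classical
  set S : Set (Fin d → ℂ) := Set.univ.pi fun _ => Metric.closedBall (0 : ℂ) 1 with hS
  have hSm : ∀ z : Fin d → ℂ, z ∈ S ↔ ∀ j, ‖z j‖ ≤ 1 := fun z => by simp [hS]
  have hSc : IsCompact S := isCompact_univ_pi fun _ => isCompact_closedBall (0 : ℂ) 1
  set ω : (Fin d → ℂ) → ℝ := S.indicator fun _ => 1 with hω
  have hpr : IsPolyradial ω fun _ => 1 := by
    refine ⟨Pos.const one_pos, ?_, ?_, fun r => if ∀ j, r j ≤ 1 then 1 else 0, ?_⟩
    · exact (integrable_indicator_iff hSc.measurableSet).2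
        (integrableOn_const hSc.measure_lt_top.ne)
    · exact Filter.Eventually.of_forall fun z hz =>
        Set.indicator_of_notMem (fun h => hz ((hSm z).1 h)) _
    · refine Filter.Eventually.of_forall fun z => ?_
      simp only [hω, Set.indicator_apply, hSm]
  obtain ⟨C, hC, hle⟩ := hpr.exists_le_radialMoment
    (Filter.Eventually.of_forall fun z => Set.indicator_nonneg (fun _ _ => zero_le_one) z)
    (Pos.const one_pos) one_pos
    (Filter.Eventually.of_forall fun z hz => by
      simp only [hω]
      rw [Set.indicator_of_mem ((hSm z).2 fun j => (hz j).le)])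
  ext β
  have h := (hpr.integral_series ha β).symm.trans (hpr.integral_series hb β)
  have hne : (radialMoment ω β : ℂ) ≠ 0 := by
    refine Complex.ofReal_ne_zero.2 ((mul_pos hC ?_).trans_le (hle β)).ne'
    exact mpow_pos (fun j => by norm_num) β
  exact mul_right_cancel₀ hne h

theorem hasSum_one (z : Fin d → ℂ) :
    HasSum (fun α => (if α = 0 then 1 else 0 : ℂ) * mpow z α) 1 := by
  have h := hasSum_single (f := fun α => (if α = 0 then 1 else 0 : ℂ) * mpow z α) 0
    fun α hα => by simp [hα]
  simpa [mpow] using h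

theorem cexp_mul_cexp_neg (ε x : ℂ) : Complex.exp (ε * x) * Complex.exp (-ε * x) = 1 := by
  rw [← Complex.exp_add, neg_mul, add_neg_cancel, Complex.exp_zero]

/-- The identity `e^{ε⟨z,z⟩} e^{-ε⟨z,z⟩} = 1` is read off on Taylor coefficients. -/
theorem cauchyProd_quadCoeff_neg (ε : ℂ) (α : Fin d → ℕ) :
    cauchyProd (quadCoeff ε) (quadCoeff (-ε)) α = if α = 0 then 1 else 0 := by
  have h : ∀ z : Fin d → ℂ, HasSum
      (fun α => cauchyProd (quadCoeff ε) (quadCoeff (-ε)) α * mpow z α) 1 := fun z => by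
    have h1 := hasSum_cauchyProd (hasSum_quadCoeff ε z) (hasSum_quadCoeff (-ε) z)
    rwa [cexp_mul_cexp_neg] at h1
  exact congrFun (coeff_unique (A := fun _ => 1) h hasSum_one) α

theorem cauchyProd_cauchyProd_quadCoeff {a : (Fin d → ℕ) → ℂ} {A : (Fin d → ℂ) → ℂ}
    (ha : ∀ z, HasSum (fun α => a α * mpow z α) (A z)) (ε : ℂ) :
    cauchyProd (cauchyProd a (quadCoeff ε)) (quadCoeff (-ε)) = a := by
  refine coeff_unique (A := A) (fun z => ?_) ha
  have h := hasSum_cauchyProd (hasSum_cauchyProd (ha z) (hasSum_quadCoeff ε z))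
    (hasSum_quadCoeff (-ε) z)
  rwa [mul_assoc, cexp_mul_cexp_neg, mul_one] at h

end uniqueness

/-! ### The functions `V_φ^* F` -/

section representation

variable {d : ℕ} {χ : (Fin d → ℂ) → ℝ} {t₁ t₂ : Fin d → ℝ}

/-- The weight `χ(z) e^{-|z|²/4}`. -/
def gaussianCutoff (χ : (Fin d → ℂ) → ℝ) (z : Fin d → ℂ) : ℝ :=
  χ z * Real.exp (-∑ j, ‖z j‖ ^ 2 / 4)

theorem measure_polydisc_ne_top (t : Fin d → ℝ) :
    volume {z : Fin d → ℂ | ∀ j, ‖z j‖ ≤ t j} ≠ ∞ := by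
  have h : {z : Fin d → ℂ | ∀ j, ‖z j‖ ≤ t j} =
      Set.univ.pi fun j => Metric.closedBall (0 : ℂ) (t j) := by
    ext z
    simp
  rw [h]
  exact (isCompact_univ_pi fun j => isCompact_closedBall (0 : ℂ) (t j)).measure_lt_top.ne

theorem isPolyradial_gaussianCutoff (hχ : χ ∈ RClassWith t₁ t₂) (ht₂ : Pos t₂) :
    IsPolyradial (gaussianCutoff χ) t₂ := by
  obtain ⟨h1, -, h3, ⟨χ₀, h4⟩, -⟩ := hχ
  refine ⟨ht₂, ?_, ?_, fun r => χ₀ r * Real.exp (-∑ j, r j ^ 2 / 4), ?_⟩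
  · have hi : Integrable χ := integrable_of_memLp_top h1 (measure_polydisc_ne_top t₂) h3
    refine hi.mul_bdd (c := 1) (Continuous.aestronglyMeasurable (by fun_prop))
      (Filter.Eventually.of_forall fun z => ?_)
    rw [Real.norm_eq_abs, abs_of_pos (Real.exp_pos _)]
    exact Real.exp_le_one_iff.2 (neg_nonpos.2 (Finset.sum_nonneg fun j _ => by positivity))
  · filter_upwards [h3] with z hz h
    rw [gaussianCutoff, hz h, zero_mul]
  · filter_upwards [h4] with z hz
    rw [gaussianCutoff, hz]

theorem exists_le_radialMoment_gaussianCutoff (hχ : χ ∈ RClassWith t₁ t₂) (ht₁ : Pos t₁)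
    (ht₂ : Pos t₂) : ∃ C : ℝ, 0 < C ∧
      ∀ α, C * mpow (fun j => (t₁ j / 2) ^ 2) α ≤ radialMoment (gaussianCutoff χ) α := by
  have h := isPolyradial_gaussianCutoff hχ ht₂
  obtain ⟨-, h2, -, -, c, hc, h5⟩ := hχ
  refine h.exists_le_radialMoment ?_ ht₁ (c := c * Real.exp (-∑ j, t₁ j ^ 2 / 4))
    (mul_pos hc (Real.exp_pos _)) ?_
  · filter_upwards [h2] with z hz
    exact mul_nonneg hz (Real.exp_pos _).le
  · filter_upwards [h5] with z hz hlt
    refine mul_le_mul (hz hlt) (Real.exp_le_exp.2 (neg_le_neg ?_)) (Real.exp_pos _).le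
      (hc.le.trans (hz hlt))
    refine Finset.sum_le_sum fun j _ => ?_
    have := (hlt j).le
    gcongr

theorem cutoff_eq (θ : ℝ) (χ : (Fin d → ℂ) → ℝ) (A : (Fin d → ℂ) → ℂ)
    (p : (Fin d → ℝ) × (Fin d → ℝ)) :
    cutoff θ χ A p = A (conjVec (complexEquiv d p)) *
      Complex.exp (-(Complex.I * (θ : ℂ) * (dot p.1 p.2 : ℂ))) * (χ (complexEquiv d p) : ℂ) := by
  have e1 : conjVec (complexEquiv d p) = fun j => (p.1 j : ℂ) - Complex.I * p.2 j := by
    ext j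
    rw [conjVec, complexEquiv_apply]
    simp [sub_eq_add_neg]
  have e2 : complexEquiv d p = fun j => (p.1 j : ℂ) + Complex.I * p.2 j :=
    funext fun j => complexEquiv_apply p j
  rw [cutoff, e1, e2]

theorem isBoundedCompact_cutoff (hχ : χ ∈ RClassWith t₁ t₂) (ht₂ : Pos t₂) (θ : ℝ)
    {a : (Fin d → ℕ) → ℂ} {A : (Fin d → ℂ) → ℂ}
    (hA : ∀ z, HasSum (fun α => a α * mpow z α) (A z)) : IsBoundedCompact (cutoff θ χ A) := by
  obtain ⟨h1, -, h3, -, -⟩ := hχ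
  have hq := (measurePreserving_complexEquiv (d := d)).quasiMeasurePreserving
  have h3' := hq.ae h3
  have hnorm : ∀ p : (Fin d → ℝ) × (Fin d → ℝ),
      ‖Complex.exp (-(Complex.I * (θ : ℂ) * (dot p.1 p.2 : ℂ)))‖ = 1 := fun p => by
    rw [Complex.norm_exp]
    simp
  constructor
  · have hA' : Measurable fun p => A (conjVec (complexEquiv d p)) :=
      (measurable_of_hasSum hA).comp (measurable_conjVec.comp (complexEquiv d).measurable)
    have hE : Continuous fun p : (Fin d → ℝ) × (Fin d → ℝ) =>
        Complex.exp (-(Complex.I * (θ : ℂ) * (dot p.1 p.2 : ℂ))) := by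
      unfold dot
      fun_prop
    have hχ' : AEStronglyMeasurable (fun p => (χ (complexEquiv d p) : ℂ)) volume :=
      Complex.continuous_ofReal.comp_aestronglyMeasurable (h1.1.comp_quasiMeasurePreserving hq)
    have hb := hq.ae (ae_le_eLpNormEssSup (f := χ) (μ := volume))
    have hfin : eLpNormEssSup χ volume ≠ ∞ := by
      have := h1.2.ne
      rwa [eLpNorm_exponent_top] at this
    refine memLp_top_of_bound ?_ ((∑' α, ‖a α‖ * mpow t₂ α) * (eLpNormEssSup χ volume).toReal) ?_
    · rw [funext fun p => cutoff_eq θ χ A p]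
      exact (hA'.aestronglyMeasurable.mul hE.aestronglyMeasurable).mul hχ'
    · filter_upwards [h3', hb] with p hp hpb
      have hpos : 0 ≤ ∑' α, ‖a α‖ * mpow t₂ α :=
        tsum_nonneg fun α => mul_nonneg (norm_nonneg _) (mpow_pos ht₂ α).le
      rw [cutoff_eq, norm_mul, norm_mul, hnorm, mul_one, Complex.norm_real]
      by_cases h : ∀ j, ‖complexEquiv d p j‖ ≤ t₂ j
      · refine mul_le_mul (norm_le_of_hasSum hA ht₂ fun j => (norm_conjVec _ j).trans_le (h j)) ?_
          (norm_nonneg _) hpos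
        rw [← toReal_enorm]
        exact ENNReal.toReal_mono hfin hpb
      · rw [hp h, norm_zero, mul_zero]
        exact mul_nonneg hpos ENNReal.toReal_nonneg
  · refine ⟨(Set.univ.pi fun j => Metric.closedBall (0 : ℝ) (t₂ j)) ×ˢ
      (Set.univ.pi fun j => Metric.closedBall (0 : ℝ) (t₂ j)),
      (isCompact_univ_pi fun j => isCompact_closedBall _ _).prod
        (isCompact_univ_pi fun j => isCompact_closedBall _ _), ?_⟩
    filter_upwards [h3'] with p hp hK
    rw [cutoff_eq, hp fun h => hK ?_, Complex.ofReal_zero, mul_zero]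
    constructor
    · intro j _
      have h2 := (Complex.abs_re_le_norm _).trans (h j)
      rw [complexEquiv_apply] at h2
      simpa using h2
    · intro j _
      have h2 := (Complex.abs_im_le_norm _).trans (h j)
      rw [complexEquiv_apply] at h2
      simpa using h2

theorem ofReal_gaussianCutoff (p : (Fin d → ℝ) × (Fin d → ℝ)) :
    (gaussianCutoff χ (complexEquiv d p) : ℂ) = (χ (complexEquiv d p) : ℂ) *
      Complex.exp (-∑ j, ((p.1 j : ℂ) ^ 2 + (p.2 j : ℂ) ^ 2) / 4) := by
  have e : ∀ j, ‖complexEquiv d p j‖ ^ 2 = p.1 j ^ 2 + p.2 j ^ 2 := fun j => by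
    rw [complexEquiv_apply, ← Complex.normSq_eq_norm_sq, Complex.normSq_apply]
    simp
    ring
  simp only [gaussianCutoff, e]
  push_cast
  rfl

/-- The value `θ = 1/2` cancels the phase `e^{i⟨y,η⟩/2}` of the kernel, so the weight is polyradial
and the map on coefficients is diagonal. -/
theorem hermiteCoeff_cutoff_half (hχ : χ ∈ RClassWith t₁ t₂) (ht₂ : Pos t₂)
    {a : (Fin d → ℕ) → ℂ} {A : (Fin d → ℂ) → ℂ}
    (hA : ∀ z, HasSum (fun α => a α * mpow z α) (A z)) (β : Fin d → ℕ) :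
    hermiteScale β * hermiteCoeff (stftAdjoint (cutoff (1 / 2) χ A)) β =
      a β * radialMoment (gaussianCutoff χ) β := by
  rw [hermiteCoeff_stftAdjoint (isBoundedCompact_cutoff hχ ht₂ _ hA).integrable,
    ← (isPolyradial_gaussianCutoff hχ ht₂).integral_series hA β, ← integral_comp_complexEquiv]
  refine integral_congr_ae (Filter.Eventually.of_forall fun p => ?_)
  simp only
  rw [cutoff_eq, ofReal_gaussianCutoff, sub_eq_add_neg, Complex.exp_add,
    ← funext fun j => complexEquiv_apply p j]
  have h : Complex.exp (-(Complex.I * ((1 / 2 : ℝ) : ℂ) * (dot p.1 p.2 : ℂ))) *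
      Complex.exp (Complex.I * (dot p.1 p.2 : ℂ) / 2) = 1 := by
    rw [← Complex.exp_add, ← Complex.exp_zero]
    congr 1
    push_cast
    ring
  linear_combination A (conjVec (complexEquiv d p)) * (χ (complexEquiv d p) : ℂ) *
    Complex.exp (-∑ j, ((p.1 j : ℂ) ^ 2 + (p.2 j : ℂ) ^ 2) / 4) *
    mpow (complexEquiv d p) β * h

/-- Since `⟨z̄,z̄⟩ - ⟨z,z⟩ = -4i⟨y,η⟩`, the remaining phase `e^{-i⟨y,η⟩/2}` splits into
`e^{⟨z̄,z̄⟩/8}`, which multiplies `A(z̄)`, and `e^{-⟨z,z⟩/8}`, which acts through `coshift`. -/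
theorem hermiteCoeff_cutoff_one (hχ : χ ∈ RClassWith t₁ t₂) (ht₂ : Pos t₂)
    {a : (Fin d → ℕ) → ℂ} {A : (Fin d → ℂ) → ℂ}
    (hA : ∀ z, HasSum (fun α => a α * mpow z α) (A z)) (β : Fin d → ℕ) :
    hermiteScale β * hermiteCoeff (stftAdjoint (cutoff 1 χ A)) β =
      coshift (quadCoeff (-(1 / 8))) (fun α => cauchyProd a (quadCoeff (1 / 8)) α *
        radialMoment (gaussianCutoff χ) α) β := by
  rw [hermiteCoeff_stftAdjoint (isBoundedCompact_cutoff hχ ht₂ _ hA).integrable,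
    ← (isPolyradial_gaussianCutoff hχ ht₂).integral_series_mul
      (fun z => hasSum_cauchyProd (hA z) (hasSum_quadCoeff (1 / 8) z))
      (hasSum_quadCoeff (-(1 / 8))) β, ← integral_comp_complexEquiv]
  refine integral_congr_ae (Filter.Eventually.of_forall fun p => ?_)
  simp only
  rw [cutoff_eq, ofReal_gaussianCutoff, sub_eq_add_neg, Complex.exp_add,
    ← funext fun j => complexEquiv_apply p j]
  have h : Complex.exp (-(Complex.I * ((1 : ℝ) : ℂ) * (dot p.1 p.2 : ℂ))) *
      Complex.exp (Complex.I * (dot p.1 p.2 : ℂ) / 2) =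
      Complex.exp (1 / 8 * ∑ j, conjVec (complexEquiv d p) j ^ 2) *
        Complex.exp (-(1 / 8) * ∑ j, complexEquiv d p j ^ 2) := by
    rw [← Complex.exp_add, ← Complex.exp_add]
    congr 1
    rw [dot]
    push_cast
    simp only [Finset.mul_sum, Finset.sum_div, ← Finset.sum_neg_distrib, ← Finset.sum_add_distrib]
    refine Finset.sum_congr rfl fun j _ => ?_
    rw [conjVec, complexEquiv_apply]
    simp only [map_add, map_mul, Complex.conj_I, Complex.conj_ofReal]
    ring
  linear_combination A (conjVec (complexEquiv d p)) * (χ (complexEquiv d p) : ℂ) *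
    Complex.exp (-∑ j, ((p.1 j : ℂ) ^ 2 + (p.2 j : ℂ) ^ 2) / 4) *
    mpow (complexEquiv d p) β * h

theorem stftAdjoint_congr {F G : (Fin d → ℝ) × (Fin d → ℝ) → ℂ} (h : F =ᵐ[volume] G) :
    stftAdjoint F = stftAdjoint G :=
  funext fun x => integral_congr_ae (h.mono fun p hp => by simp only [hp])

/-- Multiplication of the coefficients by a positive weight. -/
def scaled (m : (Fin d → ℕ) → ℝ) (c : (Fin d → ℕ) → ℂ) (α : Fin d → ℕ) : ℂ := (m α : ℂ) * c α

/-- The coefficients with respect to `z^α` of the power series `∑ c(α) z^α / √α!`. -/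
def taylorCoeff (c : (Fin d → ℕ) → ℂ) : (Fin d → ℕ) → ℂ :=
  scaled (fun α => (√(multiFactorial α : ℝ))⁻¹) c

theorem mul_monomial (c : (Fin d → ℕ) → ℂ) (z : Fin d → ℂ) (α : Fin d → ℕ) :
    c α * monomial α z = taylorCoeff c α * mpow z α := by
  rw [monomial, taylorCoeff, scaled, mpow]
  push_cast
  ring

/-- Sets of coefficient sequences of entire functions that are stable under multiplication by
geometric sequences. -/
structure IsEntireClass (S : Set ((Fin d → ℕ) → ℂ)) : Prop where
  summable : ∀ v ∈ S, ∀ ρ, Pos ρ → Summable fun α => ‖v α‖ * mpow ρ α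
  mul_mem : ∀ v ∈ S, ∀ (m : (Fin d → ℕ) → ℂ) (C : ℝ) (R : Fin d → ℝ), Pos R →
    (∀ α, ‖m α‖ ≤ C * mpow R α) → (fun α => v α * m α) ∈ S

theorem IsEntireClass.hasSum {S : Set ((Fin d → ℕ) → ℂ)} (hS : IsEntireClass S)
    {v : (Fin d → ℕ) → ℂ} (hv : v ∈ S) (z : Fin d → ℂ) :
    HasSum (fun α => v α * mpow z α) (∑' α, v α * mpow z α) := by
  refine Summable.hasSum ?_
  refine Summable.of_norm_bounded (hS.summable v hv (fun j => ‖z j‖ + 1)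
    fun j => by positivity) fun α => ?_
  rw [norm_mul]
  exact mul_le_mul_of_nonneg_left (norm_mpow_le (fun j => by linarith) α) (norm_nonneg _)

/-- Reduces the proposition to sequences: `Φ` sends Taylor coefficients of `F₀` to scaled Hermite
coefficients, and the equivalence holds as soon as `Φ` maps `S` onto itself. -/
theorem hasRepresentation_iff (hχ : χ ∈ RClassWith t₁ t₂) (ht₂ : Pos t₂) (θ : ℝ)
    {S : Set ((Fin d → ℕ) → ℂ)} (hS : IsEntireClass S)
    {Φ : ((Fin d → ℕ) → ℂ) → (Fin d → ℕ) → ℂ}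
    (hΦ : ∀ a A, (∀ z, HasSum (fun α => a α * mpow z α) (A z)) →
      scaled hermiteScale (hermiteCoeff (stftAdjoint (cutoff θ χ A))) = Φ a)
    (hmaps : ∀ a ∈ S, Φ a ∈ S) (hsurj : ∀ v ∈ S, ∃ a ∈ S, Φ a = v) (f : (Fin d → ℝ) → ℂ) :
    (MemLp f 2 ∧ scaled hermiteScale (hermiteCoeff f) ∈ S) ↔
      HasRepresentation θ χ {c | taylorCoeff c ∈ S} f := by
  constructor
  · rintro ⟨hf, hfS⟩
    obtain ⟨a, haS, ha⟩ := hsurj _ hfS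
    have hA := hS.hasSum haS
    set A : (Fin d → ℂ) → ℂ := fun z => ∑' α, a α * mpow z α with hAdef
    have hbc := isBoundedCompact_cutoff hχ ht₂ θ hA
    have hc : taylorCoeff (scaled (fun α => √(multiFactorial α : ℝ)) a) = a := by
      ext α
      have : ((√(multiFactorial α : ℝ) : ℝ) : ℂ) ≠ 0 :=
        Complex.ofReal_ne_zero.2 (sqrt_multiFactorial_pos α).ne'
      simp only [taylorCoeff, scaled]
      push_cast
      field_simp
    refine ⟨cutoff θ χ A, hbc, ⟨scaled (fun α => √(multiFactorial α : ℝ)) a, ?_, A, ?_,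
      Filter.EventuallyEq.rfl⟩, ?_⟩
    · rwa [Set.mem_ofPred_eq, hc]
    · intro z
      simp only [mul_monomial, hc]
      exact hA z
    · have hg := memLp_stftAdjoint hbc.integrable
      -- Both functions are square integrable with the same Hermite coefficients, so completeness
      -- identifies them.
      have h0 : hermiteCoeff (f - stftAdjoint (cutoff θ χ A)) = 0 := by
        ext α
        have h1 := congrFun ((hΦ a A hA).trans ha) α
        have h2 : (hermiteScale α : ℂ) ≠ 0 := Complex.ofReal_ne_zero.2 (hermiteScale_pos α).ne'
        rw [hermiteCoeff_sub hf hg, Pi.zero_apply, sub_eq_zero]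
        exact (mul_left_cancel₀ h2 h1).symm
      filter_upwards [ae_eq_zero_of_hermiteCoeff_eq_zero (hf.sub hg) h0] with x hx
      exact sub_eq_zero.1 hx
  · rintro ⟨F, -, ⟨c, hc, A, hA, hF⟩, hf⟩
    have hA' : ∀ z, HasSum (fun α => taylorCoeff c α * mpow z α) (A z) := fun z => by
      have h := hA z
      simp only [mul_monomial] at h
      exact h
    have hbc := isBoundedCompact_cutoff hχ ht₂ θ hA'
    rw [stftAdjoint_congr hF] at hf
    refine ⟨(memLp_stftAdjoint hbc.integrable).ae_eq hf.symm, ?_⟩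
    rw [hermiteCoeff_congr hf, hΦ _ A hA']
    exact hmaps _ hc

/-- Sets of coefficient sequences that are stable under multiplication of the corresponding power
series by `e^{ε⟨z, z⟩}` and under the transpose of this operation. -/
structure IsGaussianClass (S : Set ((Fin d → ℕ) → ℂ)) : Prop extends IsEntireClass S where
  cauchyProd_mem : ∀ v ∈ S, ∀ ε : ℂ, ‖ε‖ ≤ 1 / 2 → cauchyProd v (quadCoeff ε) ∈ S
  coshift_mem : ∀ v ∈ S, ∀ ε : ℂ, ‖ε‖ ≤ 1 / 2 → coshift (quadCoeff ε) v ∈ S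
  coshift_coshift : ∀ v ∈ S, ∀ ε : ℂ, ‖ε‖ ≤ 1 / 2 →
    coshift (quadCoeff (-ε)) (coshift (quadCoeff ε) v) = v

theorem mul_radialMoment_mem (hχ : χ ∈ RClassWith t₁ t₂) (ht₂ : Pos t₂)
    {S : Set ((Fin d → ℕ) → ℂ)} (hS : IsEntireClass S) {v : (Fin d → ℕ) → ℂ} (hv : v ∈ S) :
    (fun α => v α * radialMoment (gaussianCutoff χ) α) ∈ S := by
  refine hS.mul_mem v hv _ (∫ z, ‖gaussianCutoff χ z‖) _ (ht₂.mul ht₂) fun α => ?_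
  rw [Complex.norm_real]
  exact (isPolyradial_gaussianCutoff hχ ht₂).norm_radialMoment_le α

/-- The geometric lower bound for the moments makes their inverses an admissible multiplier. -/
theorem exists_mul_radialMoment_eq (hχ : χ ∈ RClassWith t₁ t₂) (ht₁ : Pos t₁) (ht₂ : Pos t₂)
    {S : Set ((Fin d → ℕ) → ℂ)} (hS : IsEntireClass S) {v : (Fin d → ℕ) → ℂ} (hv : v ∈ S) :
    ∃ a ∈ S, (fun α => a α * (radialMoment (gaussianCutoff χ) α : ℂ)) = v := by
  obtain ⟨C, hC, hle⟩ := exists_le_radialMoment_gaussianCutoff hχ ht₁ ht₂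
  have hp : Pos fun j => (t₁ j / 2) ^ 2 := fun j => pow_pos (half_pos (ht₁ j)) 2
  have hpos : ∀ α, 0 < radialMoment (gaussianCutoff χ) α := fun α =>
    (mul_pos hC (mpow_pos hp α)).trans_le (hle α)
  refine ⟨fun α => v α * (radialMoment (gaussianCutoff χ) α : ℂ)⁻¹,
    hS.mul_mem v hv _ C⁻¹ _ hp.inv fun α => ?_, funext fun α => ?_⟩
  · rw [norm_inv, Complex.norm_real, Real.norm_eq_abs, abs_of_pos (hpos α)]
    have e : mpow (fun j => ((t₁ j / 2) ^ 2)⁻¹) α = (mpow (fun j => (t₁ j / 2) ^ 2) α)⁻¹ := by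
      simp only [mpow, inv_pow, Finset.prod_inv_distrib]
    rw [e, ← mul_inv]
    exact inv_anti₀ (mul_pos hC (mpow_pos hp α)) (hle α)
  · have := Complex.ofReal_ne_zero.2 (hpos α).ne'
    rw [mul_assoc, inv_mul_cancel₀ this, mul_one]

theorem hasRepresentation_half_iff (hχ : χ ∈ RClass d) {S : Set ((Fin d → ℕ) → ℂ)}
    (hS : IsEntireClass S) (f : (Fin d → ℝ) → ℂ) :
    (MemLp f 2 ∧ scaled hermiteScale (hermiteCoeff f) ∈ S) ↔
      HasRepresentation (1 / 2) χ {c | taylorCoeff c ∈ S} f := by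
  obtain ⟨t₁, t₂, ht₁, ht₂, -, hχ⟩ := hχ
  exact hasRepresentation_iff hχ ht₂ _ hS
    (fun a A hA => funext fun β => hermiteCoeff_cutoff_half hχ ht₂ hA β)
    (fun a ha => mul_radialMoment_mem hχ ht₂ hS ha)
    (fun v hv => exists_mul_radialMoment_eq hχ ht₁ ht₂ hS hv) f

theorem hasRepresentation_one_iff (hχ : χ ∈ RClass d) {S : Set ((Fin d → ℕ) → ℂ)}
    (hS : IsGaussianClass S) (f : (Fin d → ℝ) → ℂ) :
    (MemLp f 2 ∧ scaled hermiteScale (hermiteCoeff f) ∈ S) ↔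
      HasRepresentation 1 χ {c | taylorCoeff c ∈ S} f := by
  obtain ⟨t₁, t₂, ht₁, ht₂, -, hχ⟩ := hχ
  have hε : ‖(1 / 8 : ℂ)‖ ≤ 1 / 2 := by norm_num
  have hε' : ‖(-(1 / 8) : ℂ)‖ ≤ 1 / 2 := by norm_num
  refine hasRepresentation_iff hχ ht₂ _ hS.toIsEntireClass
    (fun a A hA => funext fun β => hermiteCoeff_cutoff_one hχ ht₂ hA β)
    (fun a ha => hS.coshift_mem _ (mul_radialMoment_mem hχ ht₂ hS.toIsEntireClass
      (hS.cauchyProd_mem a ha _ hε)) _ hε') (fun v hv => ?_) f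
  -- The three operations making up `Φ` are undone in reverse order: transpose, moments, Gaussian
  -- factor.
  obtain ⟨b, hb, hbv⟩ := exists_mul_radialMoment_eq hχ ht₁ ht₂ hS.toIsEntireClass
    (hS.coshift_mem v hv _ hε)
  refine ⟨cauchyProd b (quadCoeff (-(1 / 8))), hS.cauchyProd_mem b hb _ hε', ?_⟩
  have h := cauchyProd_cauchyProd_quadCoeff (hS.hasSum hb) (-(1 / 8))
  rw [neg_neg] at h
  simp only [h]
  rw [hbv]
  exact hS.coshift_coshift v hv _ hε

end representation

/-! ### Classes of sequences with factorial weights -/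

section classes

variable {d : ℕ}

theorem DominatedBy.mul {v m : (Fin d → ℕ) → ℂ} {w u W : (Fin d → ℕ) → ℝ} {C : ℝ}
    (hv : DominatedBy v w) (hm : ∀ α, ‖m α‖ ≤ C * u α) (hC : 0 ≤ C)
    (h : ∃ K, ∀ α, u α * w α ≤ K * W α) (hw : ∀ α, 0 < w α) :
    DominatedBy (fun α => v α * m α) W := by
  obtain ⟨A, hA⟩ := hv
  obtain ⟨K, hK⟩ := h
  have hA0 : 0 ≤ A := nonneg_of_mul_nonneg_left ((norm_nonneg _).trans (hA 0)) (hw 0)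
  refine ⟨A * C * K, fun α => ?_⟩
  rw [norm_mul]
  calc ‖v α‖ * ‖m α‖ ≤ (A * w α) * (C * u α) :=
        mul_le_mul (hA α) (hm α) (norm_nonneg _) (mul_nonneg hA0 (hw α).le)
    _ = A * C * (u α * w α) := by ring
    _ ≤ A * C * (K * W α) := mul_le_mul_of_nonneg_left (hK α) (mul_nonneg hA0 hC)
    _ = _ := by ring

theorem nonneg_of_norm_le_mul_mpow {m : (Fin d → ℕ) → ℂ} {C : ℝ} {R : Fin d → ℝ} (hR : Pos R)
    (hm : ∀ α, ‖m α‖ ≤ C * mpow R α) : 0 ≤ C :=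
  nonneg_of_mul_nonneg_left ((norm_nonneg _).trans (hm 0)) (mpow_pos hR 0)

theorem dominatedBy_scaled_iff {c : (Fin d → ℕ) → ℂ} {m w : (Fin d → ℕ) → ℝ}
    (hm : ∀ α, 0 < m α) :
    DominatedBy (scaled m c) (fun α => m α * w α) ↔ DominatedBy c w := by
  refine exists_congr fun C => forall_congr' fun α => ?_
  rw [scaled, norm_mul, Complex.norm_real, Real.norm_eq_abs, abs_of_pos (hm α), mul_left_comm]
  exact mul_le_mul_iff_right₀ (hm α)

/-- Sequences dominated by `r^α α!^{-κ}` for some `r`. -/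
def factorialClass (d : ℕ) (κ : ℝ) : Set ((Fin d → ℕ) → ℂ) :=
  {v | ∃ r : Fin d → ℝ, Pos r ∧ DominatedBy v (factorialWeight κ r)}

/-- Sequences dominated by `r^α α!^{-κ}` for every `r`. -/
def factorialClass₀ (d : ℕ) (κ : ℝ) : Set ((Fin d → ℕ) → ℂ) :=
  {v | ∀ r : Fin d → ℝ, Pos r → DominatedBy v (factorialWeight κ r)}

theorem factorialClass₀_subset (κ : ℝ) : factorialClass₀ d κ ⊆ factorialClass d κ :=
  fun _ hv => ⟨fun _ => 1, Pos.const one_pos, hv _ (Pos.const one_pos)⟩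

theorem DominatedBy.summable_factorialWeight {κ : ℝ} (hκ : 0 < κ) {v : (Fin d → ℕ) → ℂ}
    {r : Fin d → ℝ} (hr : Pos r) (hv : DominatedBy v (factorialWeight κ r)) {ρ : Fin d → ℝ}
    (hρ : Pos ρ) : Summable fun α => ‖v α‖ * mpow ρ α := by
  obtain ⟨A, hA⟩ := hv
  refine Summable.of_nonneg_of_le (fun α => mul_nonneg (norm_nonneg _) (mpow_pos hρ α).le)
    (fun α => ?_) ((Pilipovic.summable_factorialWeight hκ (hρ.mul hr)).mul_left A)
  rw [factorialWeight_mul, mul_left_comm, mul_comm]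
  exact mul_le_mul_of_nonneg_left (hA α) (mpow_pos hρ α).le

theorem DominatedBy.mul_geometric {κ : ℝ} {v m : (Fin d → ℕ) → ℂ} {r R : Fin d → ℝ} (hr : Pos r)
    (hR : Pos R) {C : ℝ} (hv : DominatedBy v (factorialWeight κ r))
    (hm : ∀ α, ‖m α‖ ≤ C * mpow R α) :
    DominatedBy (fun α => v α * m α) (factorialWeight κ (R * r)) :=
  hv.mul hm (nonneg_of_norm_le_mul_mpow hR hm)
    ⟨1, fun α => by rw [factorialWeight_mul, one_mul]⟩ (factorialWeight_pos κ hr)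

theorem exists_eq_mul_of_pos {R r : Fin d → ℝ} (hR : Pos R) (hr : Pos r) :
    ∃ r', Pos r' ∧ R * r' = r :=
  ⟨(fun j => (R j)⁻¹) * r, hR.inv.mul hr, funext fun j => by
    simp only [Pi.mul_apply]
    exact mul_inv_cancel_left₀ (hR j).ne' _⟩

theorem isEntireClass_factorialClass {κ : ℝ} (hκ : 0 < κ) :
    IsEntireClass (factorialClass d κ) where
  summable := fun _ ⟨_, hr, hv⟩ _ hρ => hv.summable_factorialWeight hκ hr hρ
  mul_mem := fun _ ⟨_, hr, hv⟩ _ _ _ hR hm => ⟨_, hR.mul hr, hv.mul_geometric hr hR hm⟩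

theorem isEntireClass_factorialClass₀ {κ : ℝ} (hκ : 0 < κ) :
    IsEntireClass (factorialClass₀ d κ) where
  summable := fun v hv => (isEntireClass_factorialClass hκ).summable v (factorialClass₀_subset κ hv)
  mul_mem := fun v hv m C R hR hm r hr => by
    obtain ⟨r', hr', rfl⟩ := exists_eq_mul_of_pos hR hr
    exact (hv r' hr').mul_geometric hr' hR hm

theorem dominatedBy_cauchyProd {κ : ℝ} (hκ : 0 ≤ κ) (hκ1 : κ ≤ 1) {a b : (Fin d → ℕ) → ℂ}
    {r : Fin d → ℝ} (hr : Pos r) (ha : DominatedBy a (factorialWeight κ r))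
    (hb : DominatedBy b (factorialWeight κ r)) :
    DominatedBy (cauchyProd a b) (factorialWeight κ fun j => 4 * r j) := by
  obtain ⟨A, hA⟩ := ha
  obtain ⟨B, hB⟩ := hb
  exact ⟨A * B, norm_cauchyProd_le hκ hκ1 hr hA hB⟩

theorem DominatedBy.mono_factorialWeight {κ : ℝ} {a : (Fin d → ℕ) → ℂ} {r R : Fin d → ℝ}
    (hr : Pos r) (h : ∀ j, r j ≤ R j) (ha : DominatedBy a (factorialWeight κ r)) :
    DominatedBy a (factorialWeight κ R) := by
  obtain ⟨A, hA⟩ := ha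
  have hA0 : 0 ≤ A :=
    nonneg_of_mul_nonneg_left ((norm_nonneg _).trans (hA 0)) (factorialWeight_pos κ hr 0)
  exact ⟨A, fun α =>
    (hA α).trans (mul_le_mul_of_nonneg_left (factorialWeight_mono κ hr h α) hA0)⟩

theorem cauchyProd_mem_factorialClass {κ : ℝ} (hκ : 0 ≤ κ) (hκ1 : κ ≤ 1)
    {a b : (Fin d → ℕ) → ℂ} (ha : a ∈ factorialClass d κ) (hb : b ∈ factorialClass d κ) :
    cauchyProd a b ∈ factorialClass d κ := by
  obtain ⟨r, hr, ha⟩ := ha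
  obtain ⟨R, hR, hb⟩ := hb
  have hm : Pos fun j => max (r j) (R j) := fun j => lt_max_of_lt_left (hr j)
  exact ⟨_, fun j => mul_pos four_pos (hm j), dominatedBy_cauchyProd hκ hκ1 hm
    (ha.mono_factorialWeight hr fun j => le_max_left _ _)
    (hb.mono_factorialWeight hR fun j => le_max_right _ _)⟩

theorem cauchyProd_mem_factorialClass₀ {κ : ℝ} (hκ : 0 ≤ κ) (hκ1 : κ ≤ 1)
    {a b : (Fin d → ℕ) → ℂ} (ha : a ∈ factorialClass₀ d κ) (hb : b ∈ factorialClass₀ d κ) :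
    cauchyProd a b ∈ factorialClass₀ d κ := by
  intro r hr
  obtain ⟨r', hr', rfl⟩ := exists_eq_mul_of_pos (Pos.const (d := d) four_pos) hr
  exact dominatedBy_cauchyProd hκ hκ1 hr' (ha r' hr') (hb r' hr')

theorem dominatedBy_coshift {κ : ℝ} (hκ : 0 ≤ κ) {v : (Fin d → ℕ) → ℂ} {r : Fin d → ℝ}
    (hr : Pos r) (hv : DominatedBy v (factorialWeight κ r)) {ε : ℂ} (hε : ‖ε‖ ≤ 1 / 2) :
    DominatedBy (coshift (quadCoeff ε) v) (factorialWeight κ r) := by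
  obtain ⟨V, hV⟩ := hv
  exact ⟨_, norm_coshift_le hκ one_half_pos hr (norm_quadCoeff_le hε) hV⟩

theorem coshift_coshift_of_mem {κ : ℝ} (hκ : 0 ≤ κ) {v : (Fin d → ℕ) → ℂ}
    (hv : v ∈ factorialClass d κ) {ε : ℂ} (hε : ‖ε‖ ≤ 1 / 2) :
    coshift (quadCoeff (-ε)) (coshift (quadCoeff ε) v) = v := by
  obtain ⟨r, hr, V, hV⟩ := hv
  refine coshift_coshift hκ one_half_pos hr (norm_quadCoeff_le ((norm_neg ε).trans_le hε))
    (norm_quadCoeff_le hε) hV fun α => ?_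
  have h := cauchyProd_quadCoeff_neg (-ε) α
  rwa [neg_neg] at h

theorem factorialWeight_le_of_le {κ K : ℝ} (h : κ ≤ K) (α : Fin d → ℕ) :
    factorialWeight K (fun _ => 1) α ≤ factorialWeight κ (fun _ => 1) α := by
  refine mul_le_mul_of_nonneg_left (Real.rpow_le_rpow_of_exponent_le ?_ (neg_le_neg h))
    (mpow_pos (Pos.const one_pos) α).le
  exact_mod_cast Nat.one_le_iff_ne_zero.2 (by exact_mod_cast (multiFactorial_pos α).ne')

theorem quadCoeff_mem_factorialClass {κ : ℝ} (hκ : κ ≤ 1 / 2) {ε : ℂ} (hε : ‖ε‖ ≤ 1 / 2) :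
    quadCoeff ε ∈ factorialClass d κ :=
  ⟨fun _ => 1, Pos.const one_pos, 1, fun α => (norm_quadCoeff_le hε α).trans
    (mul_le_mul_of_nonneg_left (factorialWeight_le_of_le hκ α) zero_le_one)⟩

/-- The surplus decay `α!^{-(1/2-κ)}` absorbs `r^{-α}` for every `r`. No surplus is left at `κ =
1/2`, which is why the Beurling endpoint is handled for `θ = 1/2` only. -/
theorem quadCoeff_mem_factorialClass₀ {κ : ℝ} (hκ : κ < 1 / 2) {ε : ℂ} (hε : ‖ε‖ ≤ 1 / 2) :
    quadCoeff ε ∈ factorialClass₀ d κ := by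
  intro r hr
  obtain ⟨C, hC⟩ := exists_factorialWeight_le (sub_pos.2 hκ) hr.inv
  refine ⟨C, fun α => (norm_quadCoeff_le hε α).trans ?_⟩
  have e : (1 : ℝ) * factorialWeight (1 / 2) (fun _ => 1) α =
      factorialWeight (1 / 2 - κ) (fun j => (r j)⁻¹) α * factorialWeight κ r α := by
    have e1 : mpow (fun j => (r j)⁻¹) α * mpow r α = 1 := by
      rw [← mul_mpow]
      refine Finset.prod_eq_one fun j _ => ?_
      rw [Pi.mul_apply, inv_mul_cancel₀ (hr j).ne', one_pow]
    have e2 : (multiFactorial α : ℝ) ^ (-(1 / 2 - κ)) * (multiFactorial α : ℝ) ^ (-κ) =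
        (multiFactorial α : ℝ) ^ (-(1 / 2) : ℝ) := by
      rw [← Real.rpow_add (multiFactorial_pos α)]
      congr 1
      ring
    have e3 : mpow (fun _ : Fin d => (1 : ℝ)) α = 1 := by simp [mpow]
    rw [factorialWeight, factorialWeight, factorialWeight, e3, ← e2]
    linear_combination (-(multiFactorial α : ℝ) ^ (-(1 / 2 - κ)) *
      (multiFactorial α : ℝ) ^ (-κ)) * e1
  rw [e]
  exact mul_le_mul_of_nonneg_right (hC α) (factorialWeight_pos κ hr α).le

theorem isGaussianClass_factorialClass {κ : ℝ} (hκ : 0 < κ) (hκ1 : κ ≤ 1 / 2) :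
    IsGaussianClass (factorialClass d κ) where
  toIsEntireClass := isEntireClass_factorialClass hκ
  cauchyProd_mem := fun _ hv _ hε => cauchyProd_mem_factorialClass hκ.le (by linarith) hv
    (quadCoeff_mem_factorialClass hκ1 hε)
  coshift_mem := fun _ ⟨r, hr, hv⟩ _ hε => ⟨r, hr, dominatedBy_coshift hκ.le hr hv hε⟩
  coshift_coshift := fun _ hv _ hε => coshift_coshift_of_mem hκ.le hv hε

theorem isGaussianClass_factorialClass₀ {κ : ℝ} (hκ : 0 < κ) (hκ1 : κ < 1 / 2) :
    IsGaussianClass (factorialClass₀ d κ) where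
  toIsEntireClass := isEntireClass_factorialClass₀ hκ
  cauchyProd_mem := fun _ hv _ hε => cauchyProd_mem_factorialClass₀ hκ.le (by linarith) hv
    (quadCoeff_mem_factorialClass₀ hκ1 hε)
  coshift_mem := fun _ hv _ hε r hr => dominatedBy_coshift hκ.le hr (hv r hr) hε
  coshift_coshift := fun v hv _ hε =>
    coshift_coshift_of_mem hκ.le (factorialClass₀_subset κ hv) hε

/-- The factor `√α!` costs `1/2` in the exponent and `√2^{|α|}` is absorbed into `r`; this is the
origin of `κ = 1/(2σ) - 1/2`. -/
theorem hermiteScale_mul_weight (σ : ℝ) (r : Fin d → ℝ) (α : Fin d → ℕ) :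
    hermiteScale α * weight r (.flat σ) α =
      factorialWeight (1 / (2 * σ) - 1 / 2) ((fun _ => √2) * r) α := by
  have e : (multiFactorial α : ℝ) ^ (-(1 / (2 * σ) - 1 / 2)) =
      √(multiFactorial α : ℝ) * (multiFactorial α : ℝ) ^ (-(1 / (2 * σ))) := by
    rw [Real.sqrt_eq_rpow, ← Real.rpow_add (multiFactorial_pos α)]
    congr 1
    ring
  rw [factorialWeight_mul, factorialWeight, e, hermiteScale, weight, mpow, mpow]
  ring

theorem mem_H_flat_iff (σ : ℝ) (f : (Fin d → ℝ) → ℂ) : f ∈ H d (.flat σ) ↔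
    MemLp f 2 ∧ scaled hermiteScale (hermiteCoeff f) ∈ factorialClass d (1 / (2 * σ) - 1 / 2) := by
  have h2 : Pos fun _ : Fin d => √2 := Pos.const (by positivity)
  refine and_congr_right fun _ => ⟨fun ⟨r, hr, h⟩ => ⟨_, h2.mul hr, ?_⟩, fun ⟨r, hr, h⟩ => ?_⟩
  · rw [← dominatedBy_scaled_iff hermiteScale_pos] at h
    exact (congrArg _ (funext (hermiteScale_mul_weight σ r))).mp h
  · obtain ⟨r', hr', rfl⟩ := exists_eq_mul_of_pos h2 hr
    refine ⟨r', hr', ?_⟩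
    rw [← dominatedBy_scaled_iff hermiteScale_pos]
    exact (congrArg _ (funext (hermiteScale_mul_weight σ r'))).mpr h

theorem mem_H₀_flat_iff (σ : ℝ) (f : (Fin d → ℝ) → ℂ) : f ∈ H₀ d (.flat σ) ↔
    MemLp f 2 ∧
      scaled hermiteScale (hermiteCoeff f) ∈ factorialClass₀ d (1 / (2 * σ) - 1 / 2) := by
  have h2 : Pos fun _ : Fin d => √2 := Pos.const (by positivity)
  refine and_congr_right fun _ => ⟨fun h r hr => ?_, fun h r hr => ?_⟩
  · obtain ⟨r', hr', rfl⟩ := exists_eq_mul_of_pos h2 hr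
    have h' := h r' hr'
    rw [← dominatedBy_scaled_iff hermiteScale_pos] at h'
    exact (congrArg _ (funext (hermiteScale_mul_weight σ r'))).mp h'
  · rw [← dominatedBy_scaled_iff hermiteScale_pos]
    exact (congrArg _ (funext (hermiteScale_mul_weight σ r))).mpr (h _ (h2.mul hr))

theorem inv_sqrt_mul_rpow (α : Fin d → ℕ) {p κ : ℝ} (h : κ = 1 / 2 - p) (r : Fin d → ℝ) :
    (√(multiFactorial α : ℝ))⁻¹ * (mpow r α * (multiFactorial α : ℝ) ^ p) =
      factorialWeight κ r α := by
  rw [factorialWeight, Real.sqrt_eq_rpow, ← Real.rpow_neg (multiFactorial_pos α).le,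
    mul_left_comm, ← Real.rpow_add (multiFactorial_pos α)]
  congr 2
  rw [h]
  ring

/-- Serves all flat orders and the order 1/2 at once: `p = 1/(2σ)` for dual weights, `p = -1/(2σ)`
for ordinary ones, `p = 0` for order 1/2. -/
theorem dominatedBy_taylorCoeff_iff {c : (Fin d → ℕ) → ℂ} {w : (Fin d → ℕ) → ℝ} {p κ : ℝ}
    (h : κ = 1 / 2 - p) {r : Fin d → ℝ}
    (hw : ∀ α, w α = mpow r α * (multiFactorial α : ℝ) ^ p) :
    DominatedBy c w ↔ DominatedBy (taylorCoeff c) (factorialWeight κ r) := by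
  rw [taylorCoeff, ← dominatedBy_scaled_iff (m := fun α => (√(multiFactorial α : ℝ))⁻¹)
    fun α => inv_pos.2 (sqrt_multiFactorial_pos α)]
  have e : (fun α => (√(multiFactorial α : ℝ))⁻¹ * w α) = factorialWeight κ r :=
    funext fun α => by rw [hw, inv_sqrt_mul_rpow α h]
  rw [e]

theorem A₀Dual_flat_eq {σ κ : ℝ} (h : κ = 1 / 2 - 1 / (2 * σ)) :
    A₀Dual d (.flat σ) = {c | taylorCoeff c ∈ factorialClass d κ} :=
  Set.ext fun _ => exists_congr fun _ => and_congr_right fun _ =>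
    dominatedBy_taylorCoeff_iff h fun _ => rfl

theorem ADual_flat_eq {σ κ : ℝ} (h : κ = 1 / 2 - 1 / (2 * σ)) :
    ADual d (.flat σ) = {c | taylorCoeff c ∈ factorialClass₀ d κ} :=
  Set.ext fun _ => forall_congr' fun _ => imp_congr_right fun _ =>
    dominatedBy_taylorCoeff_iff h fun _ => rfl

theorem A_flat_eq {σ κ : ℝ} (h : κ = 1 / 2 - -(1 / (2 * σ))) :
    A d (.flat σ) = {c | taylorCoeff c ∈ factorialClass d κ} :=
  Set.ext fun _ => exists_congr fun _ => and_congr_right fun _ =>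
    dominatedBy_taylorCoeff_iff h fun _ => rfl

theorem A₀_flat_eq {σ κ : ℝ} (h : κ = 1 / 2 - -(1 / (2 * σ))) :
    A₀ d (.flat σ) = {c | taylorCoeff c ∈ factorialClass₀ d κ} :=
  Set.ext fun _ => forall_congr' fun _ => imp_congr_right fun _ =>
    dominatedBy_taylorCoeff_iff h fun _ => rfl

theorem A₀Dual_half_eq :
    A₀Dual d (.real (1 / 2)) = {c | taylorCoeff c ∈ factorialClass d (1 / 2)} :=
  Set.ext fun _ => exists_congr fun _ => and_congr_right fun _ =>
    dominatedBy_taylorCoeff_iff (p := 0) (by norm_num) fun _ => by simp [dualWeight, mpow]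

theorem A₀_half_eq :
    A₀ d (.real (1 / 2)) = {c | taylorCoeff c ∈ factorialClass₀ d (1 / 2)} :=
  Set.ext fun _ => forall_congr' fun _ => imp_congr_right fun _ =>
    dominatedBy_taylorCoeff_iff (p := 0) (by norm_num) fun _ => by simp [weight, mpow]

end classes

/-! ### Classes of sequences with exponential weights -/

section expClasses

variable {d : ℕ}

/-- The weight `exp(-∑ α_j^p / r_j)`. -/
def expWeight (p : ℝ) (r : Fin d → ℝ) (α : Fin d → ℕ) : ℝ :=
  Real.exp (-∑ j, (1 / r j) * (α j : ℝ) ^ p)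

/-- One has `Rⁿ n! ≤ e^{n log(Rn)}`, and `log(Rn) = o(n^{p-1})` because `p > 1`. Half of the
exponent absorbs this, at the price of doubling `r`. -/
theorem exists_pow_mul_factorial_le {p : ℝ} (hp : 1 < p) {r R : ℝ} (hr : 0 < r) (hR : 0 < R) :
    ∃ C, ∀ n : ℕ, R ^ n * n.factorial * Real.exp (-(1 / r * (n : ℝ) ^ p)) ≤
      C * Real.exp (-(1 / (2 * r) * (n : ℝ) ^ p)) := by
  have hev : ∀ᶠ n : ℕ in Filter.atTop,
      R ^ n * n.factorial * Real.exp (-(1 / (2 * r) * (n : ℝ) ^ p)) ≤ 1 := by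
    have hp' : 0 < p - 1 := sub_pos.2 hp
    have hRp : 0 < R ^ (p - 1) := Real.rpow_pos_of_pos hR _
    have hlim : Filter.Tendsto (fun n : ℕ => R * (n : ℝ)) Filter.atTop Filter.atTop :=
      tendsto_natCast_atTop_atTop.const_mul_atTop hR
    -- This `c` gives `c (Rn)^{p-1} = n^{p-1}/(2r)`.
    have ho := hlim.eventually ((isLittleO_log_rpow_atTop hp').def
      (c := 1 / (2 * r) / R ^ (p - 1)) (by positivity))
    filter_upwards [ho, Filter.eventually_gt_atTop 0] with n hn hn0
    have hn0' : (0 : ℝ) < n := by exact_mod_cast hn0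
    have hlog : Real.log (R * n) ≤ 1 / (2 * r) * (n : ℝ) ^ (p - 1) := by
      refine (Real.le_norm_self _).trans (hn.trans_eq ?_)
      rw [Real.norm_eq_abs, abs_of_pos (Real.rpow_pos_of_pos (by positivity) _),
        Real.mul_rpow hR.le hn0'.le]
      field_simp
    have hpow : (n : ℝ) * (n : ℝ) ^ (p - 1) = (n : ℝ) ^ p := by
      nth_rewrite 1 [← Real.rpow_one (n : ℝ)]
      rw [← Real.rpow_add hn0']
      congr 1
      ring
    have hfac : R ^ n * (n.factorial : ℝ) ≤ Real.exp (1 / (2 * r) * (n : ℝ) ^ p) := by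
      calc R ^ n * (n.factorial : ℝ) ≤ R ^ n * (n : ℝ) ^ n := by
            gcongr
            exact_mod_cast n.factorial_le_pow
        _ = Real.exp (n * Real.log (R * n)) := by
            rw [← mul_pow, Real.exp_nat_mul, Real.exp_log (by positivity)]
        _ ≤ Real.exp (1 / (2 * r) * (n : ℝ) ^ p) := by
            refine Real.exp_le_exp.2 ?_
            rw [← hpow, mul_left_comm]
            gcongr
    rw [Real.exp_neg, ← div_eq_mul_inv]
    exact div_le_one_of_le₀ hfac (Real.exp_pos _).le
  -- An eventually bounded real sequence is bounded above, the finitely many remaining terms being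
  -- absorbed in `C`.
  obtain ⟨C, hC⟩ := (Filter.isBoundedUnder_of_eventually_le hev).bddAbove_range
  refine ⟨C, fun n => ?_⟩
  have h := hC ⟨n, rfl⟩
  have e : -(1 / r * (n : ℝ) ^ p) =
      -(1 / (2 * r) * (n : ℝ) ^ p) + -(1 / (2 * r) * (n : ℝ) ^ p) := by
    field_simp
    ring
  rw [e, Real.exp_add, ← mul_assoc]
  exact mul_le_mul_of_nonneg_right h (Real.exp_pos _).le

theorem expWeight_eq_prod (p : ℝ) (r : Fin d → ℝ) (α : Fin d → ℕ) :
    expWeight p r α = ∏ j, Real.exp (-(1 / r j * (α j : ℝ) ^ p)) := by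
  rw [expWeight, ← Finset.sum_neg_distrib, Real.exp_sum]

theorem expWeight_pos (p : ℝ) (r : Fin d → ℝ) (α : Fin d → ℕ) : 0 < expWeight p r α :=
  Real.exp_pos _

theorem exists_mpow_mul_expWeight_le {p : ℝ} (hp : 1 < p) {r R : Fin d → ℝ} (hr : Pos r)
    (hR : Pos R) : ∃ C, ∀ α, mpow R α * multiFactorial α * expWeight p r α ≤
      C * expWeight p (fun j => 2 * r j) α := by
  choose C hC using fun j => exists_pow_mul_factorial_le hp (hr j) (hR j)
  refine ⟨∏ j, C j, fun α => ?_⟩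
  rw [expWeight_eq_prod, expWeight_eq_prod, mpow, multiFactorial]
  push_cast
  rw [← Finset.prod_mul_distrib, ← Finset.prod_mul_distrib, ← Finset.prod_mul_distrib]
  refine Finset.prod_le_prod (fun j _ => ?_) fun j _ => hC j (α j)
  have := hR j
  positivity

/-- Sequences dominated by `exp(-∑ α_j^p / r_j)` for some `r`. -/
def expClass (d : ℕ) (p : ℝ) : Set ((Fin d → ℕ) → ℂ) :=
  {v | ∃ r : Fin d → ℝ, Pos r ∧ DominatedBy v (expWeight p r)}

/-- Sequences dominated by `exp(-∑ α_j^p / r_j)` for every `r`. -/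
def expClass₀ (d : ℕ) (p : ℝ) : Set ((Fin d → ℕ) → ℂ) :=
  {v | ∀ r : Fin d → ℝ, Pos r → DominatedBy v (expWeight p r)}

theorem expClass₀_subset (p : ℝ) : expClass₀ d p ⊆ expClass d p :=
  fun _ hv => ⟨fun _ => 1, Pos.const one_pos, hv _ (Pos.const one_pos)⟩

theorem Pos.two_mul {r : Fin d → ℝ} (hr : Pos r) : Pos fun j => 2 * r j :=
  fun j => mul_pos two_pos (hr j)

theorem one_le_multiFactorial (α : Fin d → ℕ) : (1 : ℝ) ≤ multiFactorial α := by
  exact_mod_cast Nat.one_le_iff_ne_zero.2 (by exact_mod_cast (multiFactorial_pos α).ne')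

/-- Even factorial multipliers are allowed here, so the normalizations `√(2^{|α|} α!)` and `1/√α!`
leave the class unchanged and the same order `s` appears on both sides. -/
theorem mul_mem_expClass {p : ℝ} (hp : 1 < p) {v m : (Fin d → ℕ) → ℂ} (hv : v ∈ expClass d p)
    {C : ℝ} {R : Fin d → ℝ} (hR : Pos R) (hC : 0 ≤ C)
    (hm : ∀ α, ‖m α‖ ≤ C * (mpow R α * multiFactorial α)) :
    (fun α => v α * m α) ∈ expClass d p := by
  obtain ⟨r, hr, hv⟩ := hv
  exact ⟨_, hr.two_mul, hv.mul hm hC (exists_mpow_mul_expWeight_le hp hr hR) (expWeight_pos p r)⟩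

theorem mul_mem_expClass₀ {p : ℝ} (hp : 1 < p) {v m : (Fin d → ℕ) → ℂ} (hv : v ∈ expClass₀ d p)
    {C : ℝ} {R : Fin d → ℝ} (hR : Pos R) (hC : 0 ≤ C)
    (hm : ∀ α, ‖m α‖ ≤ C * (mpow R α * multiFactorial α)) :
    (fun α => v α * m α) ∈ expClass₀ d p := by
  intro r hr
  obtain ⟨r', hr', rfl⟩ := exists_eq_mul_of_pos (Pos.const (d := d) two_pos) hr
  exact (hv r' hr').mul hm hC (exists_mpow_mul_expWeight_le hp hr' hR) (expWeight_pos p r')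

theorem summable_of_mem_expClass {p : ℝ} (hp : 1 < p) {v : (Fin d → ℕ) → ℂ}
    (hv : v ∈ expClass d p) {ρ : Fin d → ℝ} (hρ : Pos ρ) :
    Summable fun α => ‖v α‖ * mpow ρ α := by
  have hm : ∀ α, ‖((mpow (fun j => 2 * ρ j) α : ℝ) : ℂ)‖ ≤
      1 * (mpow (fun j => 2 * ρ j) α * multiFactorial α) := fun α => by
    have h := mpow_pos hρ.two_mul α
    rw [Complex.norm_real, Real.norm_eq_abs, abs_of_pos h, one_mul]
    exact le_mul_of_one_le_right h.le (one_le_multiFactorial α)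
  -- Multiplying by `(2ρ)^α` instead of `ρ^α` leaves the summable factor `2^{-|α|}`.
  obtain ⟨r, hr, A, hA⟩ := mul_mem_expClass hp hv hρ.two_mul zero_le_one hm
  have hA0 : 0 ≤ A := nonneg_of_mul_nonneg_left ((norm_nonneg _).trans (hA 0)) (expWeight_pos p r 0)
  refine Summable.of_nonneg_of_le (fun α => mul_nonneg (norm_nonneg _) (mpow_pos hρ α).le)
    (fun α => ?_) (summable_mpow_half.mul_left A)
  have h := mpow_pos hρ.two_mul α
  have h1 := hA α
  have h2 : expWeight p r α ≤ 1 := Real.exp_le_one_iff.2 (neg_nonpos.2 (Finset.sum_nonneg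
    fun j _ => mul_nonneg (one_div_nonneg.2 (hr j).le) (Real.rpow_nonneg (by positivity) _)))
  rw [norm_mul, Complex.norm_real, Real.norm_eq_abs, abs_of_pos h] at h1
  have h3 := mpow_pos (Pos.const (d := d) (one_half_pos (α := ℝ))) α
  rw [mpow_half_mul_two ρ α, mul_left_comm, mul_comm A]
  exact mul_le_mul_of_nonneg_left (h1.trans (mul_le_of_le_one_right hA0 h2)) h3.le

theorem le_mul_multiFactorial {C : ℝ} {R : Fin d → ℝ} (hR : Pos R) {m : (Fin d → ℕ) → ℂ}
    (hm : ∀ α, ‖m α‖ ≤ C * mpow R α) (α : Fin d → ℕ) :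
    ‖m α‖ ≤ C * (mpow R α * multiFactorial α) := by
  refine (hm α).trans (mul_le_mul_of_nonneg_left ?_ (nonneg_of_norm_le_mul_mpow hR hm))
  exact le_mul_of_one_le_right (mpow_pos hR α).le (one_le_multiFactorial α)

theorem isEntireClass_expClass {p : ℝ} (hp : 1 < p) : IsEntireClass (expClass d p) where
  summable := fun _ hv _ hρ => summable_of_mem_expClass hp hv hρ
  mul_mem := fun _ hv _ _ _ hR hm => mul_mem_expClass hp hv hR (nonneg_of_norm_le_mul_mpow hR hm)
    (le_mul_multiFactorial hR hm)

theorem isEntireClass_expClass₀ {p : ℝ} (hp : 1 < p) : IsEntireClass (expClass₀ d p) where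
  summable := fun _ hv _ hρ => summable_of_mem_expClass hp (expClass₀_subset p hv) hρ
  mul_mem := fun _ hv _ _ _ hR hm => mul_mem_expClass₀ hp hv hR (nonneg_of_norm_le_mul_mpow hR hm)
    (le_mul_multiFactorial hR hm)

/-- A set closed under multiplication by sequences of size `R^α α!` is invariant under a positive
scaling `m` if both `m` and `m⁻¹` are of this size. -/
theorem scaled_mem_iff {S : Set ((Fin d → ℕ) → ℂ)}
    (hS : ∀ v ∈ S, ∀ (m : (Fin d → ℕ) → ℂ) (R : Fin d → ℝ), Pos R →
      (∀ α, ‖m α‖ ≤ 1 * (mpow R α * multiFactorial α)) → (fun α => v α * m α) ∈ S)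
    {m : (Fin d → ℕ) → ℝ} (hm0 : ∀ α, 0 < m α) {R : Fin d → ℝ} (hR : Pos R)
    (hm : ∀ α, m α ≤ mpow R α * multiFactorial α)
    (hm' : ∀ α, (m α)⁻¹ ≤ mpow R α * multiFactorial α) (c : (Fin d → ℕ) → ℂ) :
    scaled m c ∈ S ↔ c ∈ S := by
  constructor
  · intro h
    have h' := hS _ h (fun α => (((m α)⁻¹ : ℝ) : ℂ)) R hR fun α => by
      rw [Complex.norm_real, Real.norm_eq_abs, abs_of_pos (inv_pos.2 (hm0 α)), one_mul]
      exact hm' α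
    have e : (fun α => scaled m c α * (((m α)⁻¹ : ℝ) : ℂ)) = c := funext fun α => by
      have := Complex.ofReal_ne_zero.2 (hm0 α).ne'
      rw [scaled, Complex.ofReal_inv]
      field_simp
    rwa [e] at h'
  · intro h
    have h' := hS _ h (fun α => (m α : ℂ)) R hR fun α => by
      rw [Complex.norm_real, Real.norm_eq_abs, abs_of_pos (hm0 α), one_mul]
      exact hm α
    have e : (fun α => c α * (m α : ℂ)) = scaled m c := funext fun α => mul_comm _ _
    rwa [e] at h'

theorem one_le_sqrt_multiFactorial (α : Fin d → ℕ) : 1 ≤ √(multiFactorial α : ℝ) :=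
  Real.one_le_sqrt.2 (one_le_multiFactorial α)

theorem sqrt_multiFactorial_le (α : Fin d → ℕ) :
    √(multiFactorial α : ℝ) ≤ multiFactorial α :=
  Real.sqrt_le_iff.2 ⟨(multiFactorial_pos α).le,
    le_self_pow₀ (one_le_multiFactorial α) two_ne_zero⟩

theorem one_le_mpow_sqrt_two (α : Fin d → ℕ) : 1 ≤ mpow (fun _ : Fin d => √2) α :=
  Finset.one_le_prod fun _ _ => one_le_pow₀ (Real.one_le_sqrt.2 one_le_two)

theorem scaled_hermiteScale_mem_iff {S : Set ((Fin d → ℕ) → ℂ)}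
    (hS : ∀ v ∈ S, ∀ (m : (Fin d → ℕ) → ℂ) (R : Fin d → ℝ), Pos R →
      (∀ α, ‖m α‖ ≤ 1 * (mpow R α * multiFactorial α)) → (fun α => v α * m α) ∈ S)
    (c : (Fin d → ℕ) → ℂ) : scaled hermiteScale c ∈ S ↔ c ∈ S := by
  have h1 := one_le_mpow_sqrt_two (d := d)
  refine scaled_mem_iff hS hermiteScale_pos (Pos.const (by positivity : (0 : ℝ) < √2))
    (fun α => mul_le_mul_of_nonneg_left (sqrt_multiFactorial_le α) (zero_le_one.trans (h1 α)))
    (fun α => ?_) c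
  have h2 := one_le_mul_of_one_le_of_one_le (h1 α) (one_le_sqrt_multiFactorial α)
  exact (inv_le_one_of_one_le₀ h2).trans
    (one_le_mul_of_one_le_of_one_le (h1 α) (one_le_multiFactorial α))

theorem taylorCoeff_mem_iff {S : Set ((Fin d → ℕ) → ℂ)}
    (hS : ∀ v ∈ S, ∀ (m : (Fin d → ℕ) → ℂ) (R : Fin d → ℝ), Pos R →
      (∀ α, ‖m α‖ ≤ 1 * (mpow R α * multiFactorial α)) → (fun α => v α * m α) ∈ S)
    (c : (Fin d → ℕ) → ℂ) : taylorCoeff c ∈ S ↔ c ∈ S := by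
  have e : ∀ α, mpow (fun _ : Fin d => (1 : ℝ)) α = 1 := fun α => by simp [mpow]
  refine scaled_mem_iff hS (fun α => inv_pos.2 (sqrt_multiFactorial_pos α))
    (Pos.const one_pos) (fun α => ?_) (fun α => ?_) c
  · rw [e, one_mul]
    exact (inv_le_one_of_one_le₀ (one_le_sqrt_multiFactorial α)).trans (one_le_multiFactorial α)
  · rw [e, one_mul, inv_inv]
    exact sqrt_multiFactorial_le α

theorem weight_real_eq {s : ℝ} (hs : s ≠ 1 / 2) (r : Fin d → ℝ) :
    weight r (.real s) = expWeight (1 / (2 * s)) r := by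
  ext α
  simp only [weight, if_neg hs, expWeight]

theorem A_real_eq {s : ℝ} (hs : s ≠ 1 / 2) : A d (.real s) = expClass d (1 / (2 * s)) := by
  simp only [A, expClass, weight_real_eq hs]

theorem A₀_real_eq {s : ℝ} (hs : s ≠ 1 / 2) : A₀ d (.real s) = expClass₀ d (1 / (2 * s)) := by
  simp only [A₀, expClass₀, weight_real_eq hs]

theorem mem_H_real_iff_hasRepresentation {χ : (Fin d → ℂ) → ℝ} (hχ : χ ∈ RClass d) {s : ℝ}
    (hs : 0 < s) (hs1 : s < 1 / 2) (f : (Fin d → ℝ) → ℂ) :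
    f ∈ H d (.real s) ↔ HasRepresentation (1 / 2) χ (A d (.real s)) f := by
  -- The condition `s < 1/2` enters exactly as `p > 1`.
  have hp : 1 < 1 / (2 * s) := by rw [lt_div_iff₀ (by positivity)]; linarith
  have hS : ∀ v ∈ expClass d (1 / (2 * s)), ∀ (m : (Fin d → ℕ) → ℂ) (R : Fin d → ℝ), Pos R →
      (∀ α, ‖m α‖ ≤ 1 * (mpow R α * multiFactorial α)) →
        (fun α => v α * m α) ∈ expClass d (1 / (2 * s)) :=
    fun _ hv _ _ hR hm => mul_mem_expClass hp hv hR zero_le_one hm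
  have h := hasRepresentation_half_iff hχ (isEntireClass_expClass hp) f
  rw [scaled_hermiteScale_mem_iff hS] at h
  simp only [taylorCoeff_mem_iff hS] at h
  rw [← A_real_eq hs1.ne] at h
  exact h

theorem mem_H₀_real_iff_hasRepresentation {χ : (Fin d → ℂ) → ℝ} (hχ : χ ∈ RClass d) {s : ℝ}
    (hs : 0 < s) (hs1 : s < 1 / 2) (f : (Fin d → ℝ) → ℂ) :
    f ∈ H₀ d (.real s) ↔ HasRepresentation (1 / 2) χ (A₀ d (.real s)) f := by
  have hp : 1 < 1 / (2 * s) := by rw [lt_div_iff₀ (by positivity)]; linarith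
  have hS : ∀ v ∈ expClass₀ d (1 / (2 * s)), ∀ (m : (Fin d → ℕ) → ℂ) (R : Fin d → ℝ), Pos R →
      (∀ α, ‖m α‖ ≤ 1 * (mpow R α * multiFactorial α)) →
        (fun α => v α * m α) ∈ expClass₀ d (1 / (2 * s)) :=
    fun _ hv _ _ hR hm => mul_mem_expClass₀ hp hv hR zero_le_one hm
  have h := hasRepresentation_half_iff hχ (isEntireClass_expClass₀ hp) f
  rw [scaled_hermiteScale_mem_iff hS] at h
  simp only [taylorCoeff_mem_iff hS] at h
  rw [← A₀_real_eq hs1.ne] at h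
  exact h

theorem hasRepresentation_iff_of_isGaussianClass {χ : (Fin d → ℂ) → ℝ} (hχ : χ ∈ RClass d)
    {S : Set ((Fin d → ℕ) → ℂ)} (hS : IsGaussianClass S) (f : (Fin d → ℝ) → ℂ) {θ : ℝ}
    (hθ : θ ∈ ({1, 1 / 2} : Set ℝ)) :
    (MemLp f 2 ∧ scaled hermiteScale (hermiteCoeff f) ∈ S) ↔
      HasRepresentation θ χ {c | taylorCoeff c ∈ S} f := by
  rcases hθ with rfl | rfl
  · exact hasRepresentation_one_iff hχ hS f
  · exact hasRepresentation_half_iff hχ hS.toIsEntireClass f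

end expClasses

end Pilipovic

end

/-! ### Matching the orders with the exponent `κ = 1/(2σ) - 1/2` -/

theorem mainTheorem12 (d : ℕ) (χ : (Fin d → ℂ) → ℝ) (hχ : χ ∈ Pilipovic.RClass d)
    (f : (Fin d → ℝ) → ℂ) :
    -- orders `♭_σ` with `σ ∈ (1/2, 1)`
    (∀ σ : ℝ, 1 / 2 < σ → σ < 1 → ∀ θ ∈ ({1, 1 / 2} : Set ℝ),
      (f ∈ Pilipovic.H d (.flat σ) ↔
        Pilipovic.HasRepresentation θ χ (Pilipovic.A₀Dual d (.flat (σ / (2 * σ - 1)))) f) ∧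
      (f ∈ Pilipovic.H₀ d (.flat σ) ↔
        Pilipovic.HasRepresentation θ χ (Pilipovic.ADual d (.flat (σ / (2 * σ - 1)))) f)) ∧
    -- order `♭_{1/2}`
    (∀ θ ∈ ({1, 1 / 2} : Set ℝ),
      (f ∈ Pilipovic.H d (.flat (1 / 2)) ↔
        Pilipovic.HasRepresentation θ χ (Pilipovic.A₀Dual d (.real (1 / 2))) f)) ∧
    (f ∈ Pilipovic.H₀ d (.flat (1 / 2)) ↔
      Pilipovic.HasRepresentation (1 / 2) χ (Pilipovic.A₀ d (.real (1 / 2))) f) ∧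
    -- orders `♭_σ` with `σ ∈ (0, 1/2)`
    (∀ σ : ℝ, 0 < σ → σ < 1 / 2 →
      (f ∈ Pilipovic.H d (.flat σ) ↔
        Pilipovic.HasRepresentation (1 / 2) χ (Pilipovic.A d (.flat (σ / (1 - 2 * σ)))) f) ∧
      (f ∈ Pilipovic.H₀ d (.flat σ) ↔
        Pilipovic.HasRepresentation (1 / 2) χ (Pilipovic.A₀ d (.flat (σ / (1 - 2 * σ)))) f)) ∧
    -- real orders `s ∈ (0, 1/2)`
    (∀ s : ℝ, 0 < s → s < 1 / 2 →
      (f ∈ Pilipovic.H d (.real s) ↔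
        Pilipovic.HasRepresentation (1 / 2) χ (Pilipovic.A d (.real s)) f) ∧
      (f ∈ Pilipovic.H₀ d (.real s) ↔
        Pilipovic.HasRepresentation (1 / 2) χ (Pilipovic.A₀ d (.real s)) f)) := by
  refine ⟨fun σ h1 h2 θ hθ => ?_, fun θ hθ => ?_, ?_, fun σ h1 h2 => ?_, fun s h1 h2 => ?_⟩
  · have hσ : 0 < σ := by linarith
    have h0 : 0 < 2 * σ - 1 := by linarith
    -- The choice of `σ₀` is what makes the exponents on the Hermite side and on the power series
    -- side agree.
    have e : 1 / (2 * σ) - 1 / 2 = 1 / 2 - 1 / (2 * (σ / (2 * σ - 1))) := by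
      field_simp
      ring
    have hκ : 0 < 1 / (2 * σ) - 1 / 2 := by
      rw [sub_pos, one_div_lt_one_div two_pos (by positivity)]
      linarith
    -- Here `σ > 1/2` enters; it gives stability under Gaussian factors, hence `θ = 1`, for both
    -- types of spaces.
    have hκ1 : 1 / (2 * σ) - 1 / 2 < 1 / 2 := by
      rw [sub_lt_iff_lt_add, add_halves, div_lt_one (by positivity)]
      linarith
    rw [Pilipovic.mem_H_flat_iff, Pilipovic.mem_H₀_flat_iff, Pilipovic.A₀Dual_flat_eq e,
      Pilipovic.ADual_flat_eq e]
    exact ⟨Pilipovic.hasRepresentation_iff_of_isGaussianClass hχ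
      (Pilipovic.isGaussianClass_factorialClass hκ hκ1.le) f hθ,
      Pilipovic.hasRepresentation_iff_of_isGaussianClass hχ
      (Pilipovic.isGaussianClass_factorialClass₀ hκ hκ1) f hθ⟩
  -- At the endpoint `κ = 1/2` the Roumieu class still contains the Gaussian coefficients, so `θ =
  -- 1` remains available.
  · have e : (1 : ℝ) / (2 * (1 / 2)) - 1 / 2 = 1 / 2 := by norm_num
    rw [Pilipovic.mem_H_flat_iff, Pilipovic.A₀Dual_half_eq, e]
    exact Pilipovic.hasRepresentation_iff_of_isGaussianClass hχ
      (Pilipovic.isGaussianClass_factorialClass one_half_pos le_rfl) f hθ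
  · have e : (1 : ℝ) / (2 * (1 / 2)) - 1 / 2 = 1 / 2 := by norm_num
    rw [Pilipovic.mem_H₀_flat_iff, Pilipovic.A₀_half_eq, e]
    exact Pilipovic.hasRepresentation_half_iff hχ
      (Pilipovic.isEntireClass_factorialClass₀ one_half_pos) f
  · have h0 : 0 < 1 - 2 * σ := by linarith
    -- Now `κ > 1/2`, so the power series weights carry a negative power of `α!`; the diagonal case
    -- `θ = 1/2` needs only `κ > 0`.
    have e : 1 / (2 * σ) - 1 / 2 = 1 / 2 - -(1 / (2 * (σ / (1 - 2 * σ)))) := by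
      field_simp
      ring
    have hκ : 0 < 1 / (2 * σ) - 1 / 2 := by
      rw [sub_pos, one_div_lt_one_div two_pos (by positivity)]
      linarith
    rw [Pilipovic.mem_H_flat_iff, Pilipovic.mem_H₀_flat_iff, Pilipovic.A_flat_eq e,
      Pilipovic.A₀_flat_eq e]
    exact ⟨Pilipovic.hasRepresentation_half_iff hχ (Pilipovic.isEntireClass_factorialClass hκ) f,
      Pilipovic.hasRepresentation_half_iff hχ (Pilipovic.isEntireClass_factorialClass₀ hκ) f⟩
  · exact ⟨Pilipovic.mem_H_real_iff_hasRepresentation hχ h1 h2 f,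
      Pilipovic.mem_H₀_real_iff_hasRepresentation hχ h1 h2 f⟩
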